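/- **Setting.** Let $\epsilon=+1$ (compact case) or $\epsilon=-1$ (noncompact case), and let $\mathbb O(V)=\mathbb H\oplus\mathbb H$ be the octonions, resp. the split octonions, with the Cayley–Dickson product $(a,b)(c,d)=(ac-\epsilon\,\bar d b,\ da+b\bar c)$ and the inner product polarizing $|a|^2+\epsilon|b|^2$. Let $V$ be its imaginary part with basis $e_1,\dots,e_7=(i,0),(j,0),(k,0),(0,1),(0,i),(0,j),(0,k)$, so $V=\mathbb R^7$ or $V=\mathbb R^{3,4}$ (the vectors of positive square are called time-like). Let $G_2(V)\subset SO(V)$ be the automorphism group of $\mathbb O(V)$ acting on $V$, and $\phi_V(x,y,z)=\langle x,yz\rangle$ the associative 3-form. For $x\in V$ let $A_x\in\mathfrak{so}(V)$ be defined by $\langle A_xy,z\rangle=\phi_V(x,y,z)$, and let $T_x=\{\exp(tA_x):t\in\mathbb R\}$. Let $SO(3)$, $SO(4)\subset SO(V)$ be the pointwise stabilizers of $e_4,\dots,e_7$ and of $e_1,e_2,e_3$, and $H=SO(3)\times SO(4)$. Let $\mathfrak s\cong\mathfrak{sp}(1)$ be the ideal $\{(a,b)\mapsto(0,\tau b):\tau\in\mathrm{Im}\,\mathbb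 H\}$ of $\mathfrak h=\mathrm{Lie}(H)$, let $H'$ be the centralizer of $\mathfrak s$ in $H$, and for a unit $\tau\in\mathrm{Im}\,\mathbb H$ let $H'U_\tau$ be the centralizer of the corresponding element of $\mathfrak s$ in $H$. The moment map of $v\in\mathfrak{so}(V)$ is $\mu_v(g)=(\mathrm{Ad}_g^{-1}v)_{\mathfrak s}$, the $\mathfrak s$-component being the orthogonal projection for the invariant form $\mathrm{tr}(BC)$. Set $Z_G^x=\{g\in SO(V):\mu_{A_x}(g)=0\}$. The reductions at the group, 3-Sasakian, twistor and quaternion-Kähler (QK) level are the quotient spaces $\mathcal R_G^x=T_x\backslash Z_G^x$, $T_x\backslash Z_G^x/H'$, $T_x\backslash Z_G^x/H'U_\tau$ and $T_x\backslash Z_G^x/H$. Inside $G_2(V)$ consider the maps $(a,b)\mapsto(pa\bar p,\,qb\bar p)$ with unit quaternions $p,q$: they form a group $SO(4)$; those with $q\tau=\tau q$ form $Sp(1)U(1)$; those with $q=1$ form $Sp(1)$. Call $g\in SO(V)$ *irregular* if $g^{-1}T_xg\subset H'$, i.e. if $T_x$ fixes the point $gH'$, and *regular* otherwise. **Theorem.**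 Let $x\in V$ with $\langle x,x\rangle=1$ (a unit vector of $\mathbb R^7$, or a unit time-like vector of $\mathbb R^{3,4}$). Then: 1. $Z_G^x=T_x\cdot G_2(V)\cdot SO(3)$. 2. $\mathbb Z_3:=T_x\cap G_2(V)$ is cyclic of order three. 3. For $g\in G_2(V)\cdot SO(3)$ and $t\in T_x$, the point $tg$ lies in $G_2(V)\cdot SO(3)$ if and only if $t\in\mathbb Z_3$ or $g$ is irregular. The inclusion $G_2(V)\cdot SO(3)\subset Z_G^x$ induces a topological quotient map $\mathbb Z_3\backslash G_2(V)\cdot SO(3)\to\mathcal R_G^x$, which restricts to a homeomorphism from $\mathbb Z_3\backslash (G_2(V)\cdot SO(3))^{\mathrm{reg}}$ onto $T_x\backslash (Z_G^x)^{\mathrm{reg}}$; here "reg" denotes the subset of regular points, and $(Z_G^x)^{\mathrm{reg}}$ is open and dense in $Z_G^x$. 4. The inclusion $G_2(V)\subset Z_G^x$ induces homeomorphisms - $\mathbb Z_3\backslash G_2(V)/Sp(1)\cong T_x\backslash Z_G^x/H'$ (3-Sasakian reduction), - $\mathbb Z_3\backslash G_2(V)/Sp(1)U(1)\cong T_x\backslash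 Z_G^x/H'U_\tau$ (twistor reduction), for every unit $\tau\in\mathrm{Im}\,\mathbb H$, - $\mathbb Z_3\backslash G_2(V)/SO(4)\cong T_x\backslash Z_G^x/H$ (QK reduction). -/

import Mathlib

open scoped Quaternion Pointwise

noncomputable section

namespace OctRed

/-- The two cases: `V = ℝ⁷ = Im 𝕆` (octonions, compact case) and
`V = ℝ^{3,4}`, the imaginary part of the split octonions (noncompact case). -/
inductive Kind where
  | compact
  | split

/-- The sign `ε_V`: `+1` for `ℝ⁷`, `-1` for `ℝ^{3,4}`. -/
def Kind.eps : Kind → ℝ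
  | .compact => 1
  | .split => -1

/-- The underlying vector space `ℍ ⊕ ℍ` of the (split) octonions. The componentwise product of
`ℍ × ℍ` is never used; the multiplication is `octMul`. -/
abbrev Oct := ℍ[ℝ] × ℍ[ℝ]

/-- The Cayley-Dickson product `(a, b)(c, d) = (ac ∓ d̄b, da + bc̄)` on `ℍ ⊕ ℍ`. -/
def octMul (k : Kind) (p q : Oct) : Oct :=
  (p.1 * q.1 - k.eps • (star q.2 * p.2), q.2 * p.1 + p.2 * star q.1)

/-- The polarization of the Cayley-Dickson norm `‖(a, b)‖ = ‖a‖ ± ‖b‖`. -/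
def octInner (k : Kind) (p q : Oct) : ℝ :=
  (p.1 * star q.1).re + k.eps * (p.2 * star q.2).re

/-- The quaternion with the given coordinates. -/
def quat (a b c d : ℝ) : ℍ[ℝ] := ⟨a, b, c, d⟩

@[simp] theorem quat_re (a b c d : ℝ) : (quat a b c d).re = a := rfl
@[simp] theorem quat_imI (a b c d : ℝ) : (quat a b c d).imI = b := rfl
@[simp] theorem quat_imJ (a b c d : ℝ) : (quat a b c d).imJ = c := rfl
@[simp] theorem quat_imK (a b c d : ℝ) : (quat a b c d).imK = d := rfl

/-- The identification of `ℝ⁷` with the imaginary (split) octonions: the standard basis goes to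
`(i,0), (j,0), (k,0), (0,1), (0,i), (0,j), (0,k)`. -/
def toOct : (Fin 7 → ℝ) →ₗ[ℝ] Oct where
  toFun v := (quat 0 (v 0) (v 1) (v 2), quat (v 3) (v 4) (v 5) (v 6))
  map_add' u v := by ext <;> simp
  map_smul' c v := by ext <;> simp

/-- The coordinates of the imaginary part of a (split) octonion. -/
def ofOct (p : Oct) : Fin 7 → ℝ :=
  ![p.1.imI, p.1.imJ, p.1.imK, p.2.re, p.2.imI, p.2.imJ, p.2.imK]

/-- The (pseudo-)scalar product of `V`, of signature `(7,0)` or `(3,4)`. -/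
def formV (k : Kind) (x y : Fin 7 → ℝ) : ℝ := octInner k (toOct x) (toOct y)

theorem formV_eq (k : Kind) (x y : Fin 7 → ℝ) :
    formV k x y = x 0 * y 0 + x 1 * y 1 + x 2 * y 2
      + k.eps * (x 3 * y 3 + x 4 * y 4 + x 5 * y 5 + x 6 * y 6) := by
  simp [formV, octInner, toOct]

/-- The associative 3-form `φ_V(x, y, z) = ⟨x, yz⟩`. -/
def phi (k : Kind) (x y z : Fin 7 → ℝ) : ℝ :=
  octInner k (toOct x) (octMul k (toOct y) (toOct z))

/-- The `j`-th vector of the standard basis of `V`. -/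
abbrev e (j : Fin 7) : Fin 7 → ℝ := Pi.single j 1

/-- `A_x = F⁻¹(i_x φ_V)`, where `F(A) = ⟨A ·, ·⟩`; see `formV_genA`. -/
def genA (k : Kind) (x : Fin 7 → ℝ) : Matrix (Fin 7) (Fin 7) ℝ :=
  Matrix.of fun i j => formV k (e i) (e i) * phi k x (e j) (e i)

theorem phi_eq (k : Kind) (x y z : Fin 7 → ℝ) :
    phi k x y z =
      x 0 * (y 1 * z 2 - y 2 * z 1) + x 1 * (y 2 * z 0 - y 0 * z 2) + x 2 * (y 0 * z 1 - y 1 * z 0)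
      + k.eps * (x 0 * (y 3 * z 4 - y 4 * z 3 + y 6 * z 5 - y 5 * z 6)
        + x 1 * (y 3 * z 5 - y 5 * z 3 + y 4 * z 6 - y 6 * z 4)
        + x 2 * (y 3 * z 6 - y 6 * z 3 + y 5 * z 4 - y 4 * z 5)
        + x 3 * (y 4 * z 0 - y 0 * z 4 + y 5 * z 1 - y 1 * z 5 + y 6 * z 2 - y 2 * z 6)
        + x 4 * (y 0 * z 3 - y 3 * z 0 + y 6 * z 1 - y 1 * z 6 + y 2 * z 5 - y 5 * z 2)
        + x 5 * (y 1 * z 3 - y 3 * z 1 + y 4 * z 2 - y 2 * z 4 + y 0 * z 6 - y 6 * z 0)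
        + x 6 * (y 2 * z 3 - y 3 * z 2 + y 5 * z 0 - y 0 * z 5 + y 1 * z 4 - y 4 * z 1)) := by
  simp [phi, octInner, octMul, toOct]
  ring

theorem formV_genA (k : Kind) (x y z : Fin 7 → ℝ) :
    formV k ((genA k x).mulVec y) z = phi k x y z := by
  have h : k.eps * k.eps = 1 := by cases k <;> simp [Kind.eps]
  have h1 : ∀ w, phi k x y w = ∑ j, phi k x (e j) w * y j := fun w => by
    simp [Fin.sum_univ_seven, phi_eq, Pi.single_apply]
    ring
  have h2 : phi k x y z = ∑ i, phi k x y (e i) * z i := by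
    simp [Fin.sum_univ_seven, phi_eq, Pi.single_apply]
    ring
  have h3 : ∀ i, (genA k x).mulVec y i = formV k (e i) (e i) * phi k x y (e i) := fun i => by
    rw [h1, Finset.mul_sum]
    simp only [genA, Matrix.mulVec, dotProduct, Matrix.of_apply, mul_assoc]
  rw [h2, formV_eq]
  simp only [h3, formV_eq]
  generalize phi k x y = P
  simp [Fin.sum_univ_seven]
  linear_combination (P (e 3) * z 3 + P (e 4) * z 4 + P (e 5) * z 5 + P (e 6) * z 6) * h

/-- `SO(V)`: the matrices of determinant one that preserve the scalar product of `V`. -/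
def SOV (k : Kind) : Subgroup (GL (Fin 7) ℝ) where
  carrier := {g | (∀ y z, formV k (g.1.mulVec y) (g.1.mulVec z) = formV k y z) ∧ g.1.det = 1}
  one_mem' := by simp
  mul_mem' := by
    rintro a b ⟨ha, ha'⟩ ⟨hb, hb'⟩
    refine ⟨fun y z => ?_, ?_⟩
    · simp only [Units.val_mul, ← Matrix.mulVec_mulVec, ha, hb]
    · simp [ha', hb']
  inv_mem' := by
    rintro a ⟨ha, ha'⟩
    have h1 : ∀ y, a.1.mulVec ((a⁻¹).1.mulVec y) = y := fun y => by
      rw [Matrix.mulVec_mulVec, ← Units.val_mul]; simp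
    refine ⟨fun y z => ?_, ?_⟩
    · rw [← ha, h1, h1]
    · have h2 : a.1 * (a⁻¹).1 = 1 := by rw [← Units.val_mul]; simp
      have h3 := congrArg Matrix.det h2
      rw [Matrix.det_mul, ha', one_mul, Matrix.det_one] at h3
      exact h3

/-- `G₂(V)`: the automorphism group of the (split) octonion algebra, acting on its imaginary
part `V`. -/
def G2 (k : Kind) : Subgroup (GL (Fin 7) ℝ) where
  carrier := {g | ∃ Φ : Oct ≃ₗ[ℝ] Oct,
    (∀ p q, Φ (octMul k p q) = octMul k (Φ p) (Φ q)) ∧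
    ∀ v, Φ (toOct v) = toOct (g.1.mulVec v)}
  one_mem' := ⟨LinearEquiv.refl ℝ Oct, by simp, by simp⟩
  mul_mem' := by
    rintro a b ⟨Φ, h, h'⟩ ⟨Ψ, j, j'⟩
    refine ⟨Ψ.trans Φ, fun p q => ?_, fun v => ?_⟩
    · simp [h, j]
    · simp [h', j']
  inv_mem' := by
    rintro a ⟨Φ, h, h'⟩
    refine ⟨Φ.symm, fun p q => ?_, fun v => ?_⟩
    · apply Φ.injective; simp [h]
    · apply Φ.injective
      rw [h', Matrix.mulVec_mulVec, ← Units.val_mul]; simp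

/-- `T_A = {exp (tA)}`, the one-parameter group generated by `A`. -/
def oneParam (A : Matrix (Fin 7) (Fin 7) ℝ) : Subgroup (GL (Fin 7) ℝ) where
  carrier := {g | ∃ t : ℝ, g.1 = NormedSpace.exp (t • A)}
  one_mem' := ⟨0, by simp⟩
  mul_mem' := by
    rintro a b ⟨s, hs⟩ ⟨t, ht⟩
    refine ⟨s + t, ?_⟩
    rw [add_smul, Matrix.exp_add_of_commute _ _
      (((Commute.refl A).smul_left s).smul_right t), ← hs, ← ht, Units.val_mul]
  inv_mem' := by
    rintro a ⟨t, ht⟩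
    refine ⟨-t, ?_⟩
    rw [neg_smul, Matrix.exp_neg, ← ht, Matrix.coe_units_inv]

/-- `T_x`, the group generated by `A_x`. -/
def T (k : Kind) (x : Fin 7 → ℝ) : Subgroup (GL (Fin 7) ℝ) := oneParam (genA k x)

/-- The subgroup `SO(3)` of `SO(V)` that fixes the last four basis vectors. -/
def SO3 (k : Kind) : Subgroup (GL (Fin 7) ℝ) where
  carrier := {g | g ∈ SOV k ∧ ∀ j, 3 ≤ j → g.1.mulVec (e j) = e j}
  one_mem' := ⟨one_mem _, fun j _ => by rw [Units.val_one, Matrix.one_mulVec]⟩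
  mul_mem' := by
    rintro a b ⟨ha, ha'⟩ ⟨hb, hb'⟩
    refine ⟨mul_mem ha hb, fun j hj => ?_⟩
    rw [Units.val_mul, ← Matrix.mulVec_mulVec, hb' j hj, ha' j hj]
  inv_mem' := by
    rintro a ⟨ha, ha'⟩
    refine ⟨inv_mem ha, fun j hj => ?_⟩
    conv_lhs => rw [← ha' j hj, Matrix.mulVec_mulVec, ← Units.val_mul, inv_mul_cancel,
      Units.val_one, Matrix.one_mulVec]

/-- The subgroup `SO(4)` of `SO(V)` that fixes the first three basis vectors. -/
def SO4 (k : Kind) : Subgroup (GL (Fin 7) ℝ) where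
  carrier := {g | g ∈ SOV k ∧ ∀ j, j < 3 → g.1.mulVec (e j) = e j}
  one_mem' := ⟨one_mem _, fun j _ => by rw [Units.val_one, Matrix.one_mulVec]⟩
  mul_mem' := by
    rintro a b ⟨ha, ha'⟩ ⟨hb, hb'⟩
    refine ⟨mul_mem ha hb, fun j hj => ?_⟩
    rw [Units.val_mul, ← Matrix.mulVec_mulVec, hb' j hj, ha' j hj]
  inv_mem' := by
    rintro a ⟨ha, ha'⟩
    refine ⟨inv_mem ha, fun j hj => ?_⟩
    conv_lhs => rw [← ha' j hj, Matrix.mulVec_mulVec, ← Units.val_mul, inv_mul_cancel,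
      Units.val_one, Matrix.one_mulVec]

/-- The isotropy group `H = SO(3) × SO(4)` of the Wolf space `SO(V)/SO(3)×SO(4)`. -/
def H (k : Kind) : Subgroup (GL (Fin 7) ℝ) := SO3 k ⊔ SO4 k

/-- The purely imaginary quaternion with the given coordinates. -/
def imQ (τ : Fin 3 → ℝ) : ℍ[ℝ] := quat 0 (τ 0) (τ 1) (τ 2)

/-- The elements of the ideal `𝔰 ≅ 𝔰𝔭(1)` of `𝔰𝔬(3) ⊕ 𝔰𝔬(4)`: the self-dual part of `𝔰𝔬(4)`, that
is, `(a, b) ↦ (0, τb)` with `τ` an imaginary quaternion; see `toOct_sMat`. -/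
def sMat (τ : Fin 3 → ℝ) : Matrix (Fin 7) (Fin 7) ℝ :=
  Matrix.of fun i j => ofOct (0, imQ τ * (toOct (e j)).2) i

theorem toOct_sMat (τ : Fin 3 → ℝ) (v : Fin 7 → ℝ) :
    toOct ((sMat τ).mulVec v) = (0, imQ τ * (toOct v).2) := by
  ext <;> simp [sMat, Matrix.mulVec, dotProduct, Fin.sum_univ_seven, toOct, ofOct, imQ,
    Pi.single_apply] <;> ring

/-- The component `B_𝔰` of `B ∈ 𝔰𝔬(V) = 𝔥' ⊕ 𝔰 ⊕ 𝔪`: the projection to `𝔰` that is orthogonal for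
the invariant form `tr (BC)`, for which the three summands are orthogonal. -/
def sPart (B : Matrix (Fin 7) (Fin 7) ℝ) : Matrix (Fin 7) (Fin 7) ℝ :=
  sMat fun a => -(1 / 4) * (B * sMat (Pi.single a 1)).trace

theorem sPart_eq (B : Matrix (Fin 7) (Fin 7) ℝ) :
    sPart B = sMat ![
      (1 / 4) * (B 4 3 - B 3 4 + B 6 5 - B 5 6),
      (1 / 4) * (B 5 3 - B 3 5 + B 4 6 - B 6 4),
      (1 / 4) * (B 6 3 - B 3 6 + B 5 4 - B 4 5)] := by
  refine congrArg sMat (funext fun a => ?_)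
  fin_cases a <;>
  · simp [Matrix.trace, Matrix.mul_apply, Fin.sum_univ_seven, sMat, toOct, ofOct, imQ,
      Pi.single_apply]
    ring

theorem sPart_sMat (τ : Fin 3 → ℝ) : sPart (sMat τ) = sMat τ := by
  rw [sPart_eq]
  refine congrArg sMat (funext fun a => ?_)
  fin_cases a <;>
  · simp [sMat, toOct, ofOct, imQ, Pi.single_apply]
    ring

/-- The moment map `μ_v(g) = (Ad_g⁻¹ v)_𝔰`. -/
def momentMap (v : Matrix (Fin 7) (Fin 7) ℝ) (g : GL (Fin 7) ℝ) : Matrix (Fin 7) (Fin 7) ℝ :=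
  sPart ((g⁻¹).1 * v * g.1)

/-- For skew `v` with associated two-form `ω = ⟨v ·, ·⟩` the moment map vanishes at `g ∈ SO(V)` if
and only if the last four columns `f₁, …, f₄` of `g` satisfy `ω(f₁,f₂) + ω(f₃,f₄) = 0`,
`ω(f₁,f₃) - ω(f₂,f₄) = 0` and `ω(f₁,f₄) + ω(f₂,f₃) = 0`. -/
theorem momentMap_eq_zero_iff (k : Kind) (v : Matrix (Fin 7) (Fin 7) ℝ)
    (hv : ∀ y z, formV k (v.mulVec y) z = -formV k y (v.mulVec z))
    (g : GL (Fin 7) ℝ) (hg : g ∈ SOV k) :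
    momentMap v g = 0 ↔
      (let ω := fun i j => formV k (v.mulVec (g.1.mulVec (e i))) (g.1.mulVec (e j))
       ω 3 4 + ω 5 6 = 0 ∧ ω 3 5 - ω 4 6 = 0 ∧ ω 3 6 + ω 4 5 = 0) := by
  have hinv := (SOV k).inv_mem hg
  have hgi : ∀ y, (g⁻¹).1.mulVec (g.1.mulVec y) = y := fun y => by
    rw [Matrix.mulVec_mulVec, ← Units.val_mul, inv_mul_cancel, Units.val_one, Matrix.one_mulVec]
  set B := (g⁻¹).1 * v * g.1 with hB
  have hω : ∀ i j, formV k (v.mulVec (g.1.mulVec (e i))) (g.1.mulVec (e j)) =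
      formV k (B.mulVec (e i)) (e j) := fun i j => by
    rw [← hinv.1, hgi, hB, ← Matrix.mulVec_mulVec, ← Matrix.mulVec_mulVec]
  have hskew : ∀ i j, formV k (B.mulVec (e i)) (e j) = -formV k (B.mulVec (e j)) (e i) := by
    intro i j
    rw [← hω, ← hω, hv]
    simp only [formV_eq]
    ring
  have h43 := hskew 3 4
  have h65 := hskew 5 6
  have h53 := hskew 3 5
  have h46 := hskew 4 6
  have h63 := hskew 3 6
  have h54 := hskew 4 5
  have hz : ∀ τ : Fin 3 → ℝ, sMat τ = 0 ↔ τ 0 = 0 ∧ τ 1 = 0 ∧ τ 2 = 0 := by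
    intro τ
    constructor
    · intro h
      have a := congrFun (congrFun h 4) 3
      have b := congrFun (congrFun h 5) 3
      have c := congrFun (congrFun h 6) 3
      simp [sMat, toOct, ofOct, imQ] at a b c
      exact ⟨a, b, c⟩
    · rintro ⟨a, b, c⟩
      ext i j
      fin_cases i <;> simp [sMat, ofOct, imQ, a, b, c]
  simp only [hω]
  rw [momentMap, ← hB, sPart_eq, hz]
  simp only [formV_eq] at h43 h65 h53 h46 h63 h54
  cases k <;> simp [formV_eq, Kind.eps] at h43 h65 h53 h46 h63 h54 ⊢ <;>
  exact ⟨fun ⟨a, b, c⟩ => ⟨by linarith, by linarith, by linarith⟩,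
    fun ⟨a, b, c⟩ => ⟨by linarith, by linarith, by linarith⟩⟩

/-- The zero locus `Z_G(𝔱) = {g ∈ SO(V) : μ_v(g) = 0 for each v ∈ 𝔱}`. -/
def zeroLocus (k : Kind) (𝔱 : Submodule ℝ (Matrix (Fin 7) (Fin 7) ℝ)) : Set (GL (Fin 7) ℝ) :=
  {g | g ∈ SOV k ∧ ∀ v ∈ 𝔱, momentMap v g = 0}

/-- `Z_G^x`, the zero locus of the action generated by `A_x`. -/
def Z (k : Kind) (x : Fin 7 → ℝ) : Set (GL (Fin 7) ℝ) :=
  zeroLocus k (Submodule.span ℝ {genA k x})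

/-- `H'U_τ`, where `U_τ ≅ U(1)` is the centralizer in `S` of the element of `𝔰` with coordinates
`τ`: since `H = H'S` with `H'` and `S` commuting, `H'U_τ` is the centralizer of that element
in `H`. -/
def HU (k : Kind) (τ : Fin 3 → ℝ) : Subgroup (GL (Fin 7) ℝ) where
  carrier := {g | g ∈ H k ∧ g.1 * sMat τ = sMat τ * g.1}
  one_mem' := ⟨one_mem _, by simp⟩
  mul_mem' := by
    rintro a b ⟨ha, ha'⟩ ⟨hb, hb'⟩
    refine ⟨mul_mem ha hb, ?_⟩
    rw [Units.val_mul, mul_assoc, hb', ← mul_assoc, ha', mul_assoc]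
  inv_mem' := by
    rintro a ⟨ha, ha'⟩
    exact ⟨inv_mem ha, (Units.inv_mul_eq_iff_eq_mul a).2
      (by rw [← mul_assoc, ha', mul_assoc, Units.mul_inv, mul_one])⟩

/-- `H' = SO(3)·Sp(1)`, the factor of `H = H'S` complementary to `S`: the centralizer of
`𝔰` in `H`. -/
def Hprime (k : Kind) : Subgroup (GL (Fin 7) ℝ) := ⨅ τ : Fin 3 → ℝ, HU k τ

/-- The centralizer of the imaginary quaternion `τ` in the group `Sp(1)` of unit quaternions, a
circle group if `τ ≠ 0`. -/
def U1 (τ : Fin 3 → ℝ) : Subgroup (unitary ℍ[ℝ]) where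
  carrier := {q | (q : ℍ[ℝ]) * imQ τ = imQ τ * q}
  one_mem' := by simp
  mul_mem' := by
    intro a b ha hb
    simp only [Set.mem_ofPred_eq] at ha hb ⊢
    rw [Submonoid.coe_mul, mul_assoc, hb, ← mul_assoc, ha, mul_assoc]
  inv_mem' := by
    intro a ha
    simp only [Set.mem_ofPred_eq] at ha ⊢
    have h1 : ((a⁻¹ : unitary ℍ[ℝ]) : ℍ[ℝ]) * a = 1 := by
      rw [← Submonoid.coe_mul, inv_mul_cancel, Submonoid.coe_one]
    have h2 : (a : ℍ[ℝ]) * ((a⁻¹ : unitary ℍ[ℝ]) : ℍ[ℝ]) = 1 := by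
      rw [← Submonoid.coe_mul, mul_inv_cancel, Submonoid.coe_one]
    calc ((a⁻¹ : unitary ℍ[ℝ]) : ℍ[ℝ]) * imQ τ
        = ((a⁻¹ : unitary ℍ[ℝ]) : ℍ[ℝ]) * (imQ τ * a) * ((a⁻¹ : unitary ℍ[ℝ]) : ℍ[ℝ]) := by
          rw [mul_assoc, mul_assoc, h2, mul_one]
      _ = imQ τ * ((a⁻¹ : unitary ℍ[ℝ]) : ℍ[ℝ]) := by
          rw [← ha, ← mul_assoc, h1, one_mul]

/-- For a group `Q` of unit quaternions, the group of the transformations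
`(a, b) ↦ (p a p̄, q b p̄)` with `p ∈ Sp(1)` and `q ∈ Q`. They are automorphisms of the (split)
octonions. -/
def quatGroup (Q : Subgroup (unitary ℍ[ℝ])) : Subgroup (GL (Fin 7) ℝ) where
  carrier := {g | ∃ p : unitary ℍ[ℝ], ∃ q ∈ Q, ∀ v, toOct (g.1.mulVec v) =
    ((p : ℍ[ℝ]) * (toOct v).1 * star (p : ℍ[ℝ]), (q : ℍ[ℝ]) * (toOct v).2 * star (p : ℍ[ℝ]))}
  one_mem' := ⟨1, 1, one_mem _, by simp⟩
  mul_mem' := by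
    rintro a b ⟨p, q, hq, h⟩ ⟨p', q', hq', h'⟩
    refine ⟨p * p', q * q', mul_mem hq hq', fun v => ?_⟩
    rw [Units.val_mul, ← Matrix.mulVec_mulVec, h, h']
    simp [mul_assoc]
  inv_mem' := by
    rintro a ⟨p, q, hq, h⟩
    refine ⟨p⁻¹, q⁻¹, inv_mem hq, fun v => ?_⟩
    have hv := h ((a⁻¹).1.mulVec v)
    rw [Matrix.mulVec_mulVec, ← Units.val_mul, mul_inv_cancel, Units.val_one,
      Matrix.one_mulVec] at hv
    have hp : star (p : ℍ[ℝ]) * p = 1 := Unitary.coe_star_mul_self p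
    have hq : star (q : ℍ[ℝ]) * q = 1 := Unitary.coe_star_mul_self q
    rw [hv]
    generalize toOct ((a⁻¹).1.mulVec v) = w
    have e1 : ((p⁻¹ : unitary ℍ[ℝ]) : ℍ[ℝ]) = star (p : ℍ[ℝ]) := rfl
    have e2 : ((q⁻¹ : unitary ℍ[ℝ]) : ℍ[ℝ]) = star (q : ℍ[ℝ]) := rfl
    rw [e1, e2, star_star]
    ext1
    · show w.1 = star (p : ℍ[ℝ]) * (p * w.1 * star (p : ℍ[ℝ])) * p
      rw [mul_assoc, mul_assoc, hp, mul_one, ← mul_assoc, hp, one_mul]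
    · show w.2 = star (q : ℍ[ℝ]) * (q * w.2 * star (p : ℍ[ℝ])) * p
      rw [mul_assoc, mul_assoc, hp, mul_one, ← mul_assoc, hq, one_mul]

/-- The subgroup `Sp(1)` of `G₂(V)`: the transformations `(a, b) ↦ (p a p̄, b p̄)`. -/
def G2Sp1 : Subgroup (GL (Fin 7) ℝ) := quatGroup ⊥

/-- The subgroup `Sp(1)U(1)` of `G₂(V)`. -/
def G2Sp1U1 (τ : Fin 3 → ℝ) : Subgroup (GL (Fin 7) ℝ) := quatGroup (U1 τ)

/-- The subgroup `SO(4) = Sp(1)·Sp(1)` of `G₂(V)`. -/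
def G2SO4 : Subgroup (GL (Fin 7) ℝ) := quatGroup ⊤

/-- The group `T_x ∩ G₂(V)`. -/
def Z3 (k : Kind) (x : Fin 7 → ℝ) : Subgroup (GL (Fin 7) ℝ) := T k x ⊓ G2 k

/-- The subset `G₂(V)·SO(3)` of `SO(V)`. -/
def sect (k : Kind) : Set (GL (Fin 7) ℝ) := (G2 k : Set (GL (Fin 7) ℝ)) * (SO3 k : Set _)

/-- The (3-Sasakian) irregular points: those `g` for which the isotropy group `T_x ∩ gH'g⁻¹` of `gH'`
is not discrete. As `T_x` is one-dimensional and connected, this means that `T_x` fixes the point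
`gH'` of `SO(V)/H'`. -/
def Irregular (k : Kind) (x : Fin 7 → ℝ) (g : GL (Fin 7) ℝ) : Prop :=
  ∀ t ∈ T k x, g⁻¹ * t * g ∈ Hprime k

/-- Two points of `X` are equivalent if they lie in the same double coset of `L` and `K`. -/
def dcSetoid (L : Subgroup (GL (Fin 7) ℝ)) (X : Set (GL (Fin 7) ℝ))
    (K : Subgroup (GL (Fin 7) ℝ)) : Setoid X where
  r a b := ∃ l ∈ L, ∃ h ∈ K, b.1 = l * a.1 * h
  iseqv :=
    { refl := fun a => ⟨1, one_mem _, 1, one_mem _, by simp⟩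
      symm := by
        rintro a b ⟨l, hl, h, hh, hb⟩
        exact ⟨l⁻¹, inv_mem hl, h⁻¹, inv_mem hh, by rw [hb]; group⟩
      trans := by
        rintro a b c ⟨l, hl, h, hh, hb⟩ ⟨l', hl', h', hh', hc⟩
        exact ⟨l' * l, mul_mem hl' hl, h * h', mul_mem hh hh', by rw [hc, hb]; group⟩ }

/-- The space `L\X/K`, with the quotient topology. -/
abbrev DC (L : Subgroup (GL (Fin 7) ℝ)) (X : Set (GL (Fin 7) ℝ))
    (K : Subgroup (GL (Fin 7) ℝ)) : Type := Quotient (dcSetoid L X K)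

/-- The class of a point of `X` in `L\X/K`. -/
def DC.mk (L : Subgroup (GL (Fin 7) ℝ)) {X : Set (GL (Fin 7) ℝ)}
    (K : Subgroup (GL (Fin 7) ℝ)) {g : GL (Fin 7) ℝ} (hg : g ∈ X) : DC L X K :=
  Quotient.mk (dcSetoid L X K) ⟨g, hg⟩

/-- The map `f : L\X/K → L'\X'/K'` is induced by an inclusion `X ⊆ X'`. -/
def IsInduced {L L' K K' : Subgroup (GL (Fin 7) ℝ)} {X X' : Set (GL (Fin 7) ℝ)}
    (f : DC L X K → DC L' X' K') : Prop :=
  ∀ g, ∀ hg : g ∈ X, ∃ hg' : g ∈ X', f (DC.mk L K hg) = DC.mk L' K' hg'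

/-- `R_G^x = T_x\Z_G^x`. -/
abbrev RG (k : Kind) (x : Fin 7 → ℝ) : Type := DC (T k x) (Z k x) ⊥

/-- The 3-Sasakian reduction `T_x\(Z_G^x/H')`. -/
abbrev RS (k : Kind) (x : Fin 7 → ℝ) : Type := DC (T k x) (Z k x) (Hprime k)

/-- The twistor reduction `T_x\(Z_G^x/H'U_τ)`. -/
abbrev RZ (k : Kind) (x : Fin 7 → ℝ) (τ : Fin 3 → ℝ) : Type := DC (T k x) (Z k x) (HU k τ)

/-- The quaternion-Kähler reduction `T_x\(Z_G^x/H)`. -/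
abbrev RO (k : Kind) (x : Fin 7 → ℝ) : Type := DC (T k x) (Z k x) (H k)

end OctRed

end

noncomputable section

namespace OctRed

variable {k : Kind}

/-! The octonions are used as the spinor module of V: left multiplications by imaginary elements
satisfy the Clifford relations, and automorphisms fix the spinor 1. For g in SO(V) let f₀, …, f₃ be
its last four columns and let Σ₀ = f₀f₁ + f₂f₃, Σ₁ = f₀f₂ − f₁f₃, Σ₂ = f₀f₃ + f₁f₂ act on spinors.
Then g lies in G₂·SO(3) if and only if every Σₐ annihilates 1 (`mem_sect_iff`), since these
equations say that the products of the fᵢ follow the standard multiplication table; and the moment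
map of A_x vanishes at g if and only if ⟨x, Σₐ1⟩ = 0 for all a (`mem_Z_iff`).

The Σₐ vanish on the (+1)-eigenspace of the volume element f₀f₁f₂f₃ and act like the imaginary
quaternions on the four-dimensional (−1)-eigenspace. Hence the moment map equations force the
(−1)-components of 1 and x to be linearly dependent, so that some spinor cos φ + x sin φ is
annihilated by all Σₐ (`CliffordFrame.exists_combination`). The rotation exp(2θA_x) is y ↦ u y ū
with u = cos θ + x sin θ. By the Moufang identities p ↦ u p u² lifts it to spinors (`spin_octMul`),
and this lift sends cos 3θ − x sin 3θ to 1 (`spin_unitO`). With 3θ = −φ the point g moves into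
G₂·SO(3), which gives the zero locus (`Z_eq`).

The angle 3θ also accounts for the group of order three: exp(2θA_x) is an automorphism only if sin
3θ = 0. It lies in G₂·SO(3) if sin 3θ = 0 or x belongs to ℍ ⊕ 0, and the second alternative is
irregularity of the identity; conjugation by automorphisms gives the general case
(`mul_mem_sect_iff`).

For the topology, T_x and the groups on the right are compact while G₂ and G₂·SO(3) are closed, so
the induced maps are quotient maps (`DC.isQuotientMap_map`). The groups on the right are the
corresponding subgroups of G₂ times SO(3), and G₂ ∩ SO(3) is trivial. Injectivity follows because at
a regular point only the group of order three keeps the orbit in G₂·SO(3), while at an irregular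
point tg = g(g⁻¹tg) with g⁻¹tg in H', which the right quotient absorbs
(`exists_homeomorph_reduction`). Density of the regular points comes from an explicit one-parameter
group of automorphisms that moves imaginary quaternions out of ℍ ⊕ 0 (`exists_path`). -/

theorem Kind.eps_mul_self (k : Kind) : k.eps * k.eps = 1 := by cases k <;> simp [Kind.eps]

theorem Kind.eps_ne_zero (k : Kind) : k.eps ≠ 0 := by cases k <;> simp [Kind.eps]

/-! ### Algebra of the (split) octonions: alternativity, Moufang identities, Clifford relations. -/

/-- The unit of the (split) octonions. -/
def one : Oct := (1, 0)

/-- The conjugation of the (split) octonions. -/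
def conj (p : Oct) : Oct := (star p.1, -p.2)

/-- The product of the (split) octonions as a bilinear map. -/
def mulL (k : Kind) : Oct →ₗ[ℝ] Oct →ₗ[ℝ] Oct :=
  LinearMap.mk₂ ℝ (octMul k)
    (fun a b c => by ext <;> simp [octMul] <;> ring)
    (fun r a b => by ext <;> simp [octMul] <;> ring)
    (fun a b c => by ext <;> simp [octMul] <;> ring)
    (fun r a b => by ext <;> simp [octMul] <;> ring)

theorem mulL_apply (p q : Oct) : mulL k p q = octMul k p q := rfl

theorem octMul_add (a b c : Oct) : octMul k a (b + c) = octMul k a b + octMul k a c :=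
  (mulL k a).map_add b c

theorem add_octMul (a b c : Oct) : octMul k (a + b) c = octMul k a c + octMul k b c :=
  (mulL k).map_add₂ a b c

theorem octMul_sub (a b c : Oct) : octMul k a (b - c) = octMul k a b - octMul k a c :=
  (mulL k a).map_sub b c

theorem octMul_smul (r : ℝ) (a b : Oct) : octMul k a (r • b) = r • octMul k a b :=
  (mulL k a).map_smul r b

theorem smul_octMul (r : ℝ) (a b : Oct) : octMul k (r • a) b = r • octMul k a b :=
  (mulL k).map_smul₂ r a b

theorem octMul_neg (a b : Oct) : octMul k a (-b) = -octMul k a b := (mulL k a).map_neg b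

theorem neg_octMul (a b : Oct) : octMul k (-a) b = -octMul k a b := (mulL k).map_neg₂ a b

@[simp] theorem octMul_one (a : Oct) : octMul k a one = a := by ext <;> simp [octMul, one]

@[simp] theorem one_octMul (a : Oct) : octMul k one a = a := by ext <;> simp [octMul, one]

/-- The (split) octonion with the given coordinates. -/
def oct8 (a b c d e f g h : ℝ) : Oct := (quat a b c d, quat e f g h)

theorem oct8_eta (p : Oct) :
    p = oct8 p.1.re p.1.imI p.1.imJ p.1.imK p.2.re p.2.imI p.2.imJ p.2.imK := rfl

theorem oct8_congr {a b c d e f g h a' b' c' d' e' f' g' h' : ℝ} (h0 : a = a') (h1 : b = b')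
    (h2 : c = c') (h3 : d = d') (h4 : e = e') (h5 : f = f') (h6 : g = g') (h7 : h = h') :
    oct8 a b c d e f g h = oct8 a' b' c' d' e' f' g' h' := by
  subst h0 h1 h2 h3 h4 h5 h6 h7
  rfl

theorem octMul_oct8 (a b c d e f g h a' b' c' d' e' f' g' h' : ℝ) :
    octMul k (oct8 a b c d e f g h) (oct8 a' b' c' d' e' f' g' h') =
      oct8 (a * a' - b * b' - c * c' - d * d' - k.eps * (e' * e + f' * f + g' * g + h' * h))
        (a * b' + b * a' + c * d' - d * c' - k.eps * (e' * f - f' * e - g' * h + h' * g))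
        (a * c' - b * d' + c * a' + d * b' - k.eps * (e' * g + f' * h - g' * e - h' * f))
        (a * d' + b * c' - c * b' + d * a' - k.eps * (e' * h - f' * g + g' * f - h' * e))
        (e' * a - f' * b - g' * c - h' * d + (e * a' + f * b' + g * c' + h * d'))
        (e' * b + f' * a + g' * d - h' * c + (-(e * b') + f * a' - g * d' + h * c'))
        (e' * c - f' * d + g' * a + h' * b + (-(e * c') + f * d' + g * a' - h * b'))
        (e' * d + f' * c - g' * b + h' * a + (-(e * d') - f * c' + g * b' + h * a')) := by
  cases k <;> ext <;> simp [octMul, oct8, Kind.eps] <;> ring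

theorem conj_oct8 (a b c d e f g h : ℝ) :
    conj (oct8 a b c d e f g h) = oct8 a (-b) (-c) (-d) (-e) (-f) (-g) (-h) := by
  ext <;> simp [conj, oct8]

theorem octInner_oct8 (a b c d e f g h a' b' c' d' e' f' g' h' : ℝ) :
    octInner k (oct8 a b c d e f g h) (oct8 a' b' c' d' e' f' g' h') =
      a * a' + b * b' + c * c' + d * d' + k.eps * (e * e' + f * f' + g * g' + h * h') := by
  simp [octInner, oct8]

theorem smul_oct8 (r a b c d e f g h : ℝ) :
    r • oct8 a b c d e f g h = oct8 (r * a) (r * b) (r * c) (r * d) (r * e) (r * f) (r * g)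
      (r * h) := by
  ext <;> simp [oct8]

/-- The composition property in the form ā(ap) = |a|²p. It yields the Clifford relation for
imaginary a and the invertibility of multiplication by a unit element. -/
theorem conj_octMul_cancel (a p : Oct) :
    octMul k (conj a) (octMul k a p) = octInner k a a • p := by
  rw [oct8_eta a, oct8_eta p]
  simp only [octMul_oct8, conj_oct8, octInner_oct8, smul_oct8]
  cases k <;> apply oct8_congr <;> simp only [Kind.eps] <;> ring

theorem octMul_cancel_conj (a p : Oct) :
    octMul k (octMul k p a) (conj a) = octInner k a a • p := by
  rw [oct8_eta a, oct8_eta p]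
  simp only [octMul_oct8, conj_oct8, octInner_oct8, smul_oct8]
  cases k <;> apply oct8_congr <;> simp only [Kind.eps] <;> ring

theorem octMul_self_left (a b : Oct) : octMul k (octMul k a a) b = octMul k a (octMul k a b) := by
  rw [oct8_eta a, oct8_eta b]
  simp only [octMul_oct8]
  cases k <;> apply oct8_congr <;> simp only [Kind.eps] <;> ring

theorem octMul_self_right (a b : Oct) : octMul k b (octMul k a a) = octMul k (octMul k b a) a := by
  rw [oct8_eta a, oct8_eta b]
  simp only [octMul_oct8]
  cases k <;> apply oct8_congr <;> simp only [Kind.eps] <;> ring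

theorem octMul_flexible (a b : Oct) : octMul k (octMul k a b) a = octMul k a (octMul k b a) := by
  rw [oct8_eta a, oct8_eta b]
  simp only [octMul_oct8]
  cases k <;> apply oct8_congr <;> simp only [Kind.eps] <;> ring

/-- Polarization of the left alternative law. -/
theorem octMul_alt_left (a b c : Oct) : octMul k (octMul k a b) c + octMul k (octMul k b a) c =
    octMul k a (octMul k b c) + octMul k b (octMul k a c) := by
  have h := octMul_self_left (k := k) (a + b) c
  simp only [octMul_add, add_octMul, octMul_self_left] at h
  linear_combination (norm := module) h

theorem octMul_alt_right (a b c : Oct) : octMul k (octMul k a b) c + octMul k (octMul k a c) b =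
    octMul k a (octMul k b c) + octMul k a (octMul k c b) := by
  have h := octMul_self_right (k := k) (b + c) a
  simp only [octMul_add, add_octMul, octMul_self_right] at h
  linear_combination (norm := module) -h

/-- The Moufang identity is a linear combination of four instances of the polarized alternative
laws. With its mirror image it provides the lift of rotations to spinors. -/
theorem moufang_left (a b c : Oct) :
    octMul k (octMul k (octMul k a b) a) c = octMul k a (octMul k b (octMul k a c)) := by
  have h1 := octMul_alt_left (k := k) (octMul k a b) a c
  have h2 := octMul_alt_right (k := k) a b (octMul k a c)
  have h3 := octMul_alt_right (k := k) (octMul k a a) b c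
  have h4 := congrArg (octMul k a) (octMul_alt_right (k := k) a b c)
  simp only [octMul_self_left, octMul_add] at h3 h4
  linear_combination (norm := module) h1 + h2 - h3 + h4

theorem moufang_right (a b c : Oct) :
    octMul k c (octMul k (octMul k a b) a) = octMul k (octMul k (octMul k c a) b) a := by
  have h1 := octMul_alt_right (k := k) c a (octMul k b a)
  have h2 := octMul_alt_left (k := k) (octMul k c a) b a
  have h3 := octMul_alt_left (k := k) c b (octMul k a a)
  have h4 := congrArg (octMul k · a) (octMul_alt_left (k := k) c b a)
  simp only [octMul_self_right, add_octMul] at h3 h4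
  rw [octMul_flexible]
  linear_combination (norm := module) -h1 - h2 + h3 - h4

theorem octInner_octMul (p a b : Oct) :
    octInner k (octMul k p a) (octMul k p b) = octInner k p p * octInner k a b := by
  rw [oct8_eta a, oct8_eta b, oct8_eta p]
  simp only [octMul_oct8, octInner_oct8]
  cases k <;> simp only [Kind.eps] <;> ring

theorem ofOct_toOct (v : Fin 7 → ℝ) : ofOct (toOct v) = v := by
  ext i; fin_cases i <;> rfl

theorem toOct_injective : Function.Injective toOct :=
  Function.LeftInverse.injective ofOct_toOct

theorem toOct_ofOct (p : Oct) : p.1.re • one + toOct (ofOct p) = p := by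
  ext <;> simp [toOct, ofOct, one]

/-- The coordinates of the imaginary part, as a linear map. -/
def ofOctL : Oct →ₗ[ℝ] Fin 7 → ℝ where
  toFun := ofOct
  map_add' _ _ := by ext i; fin_cases i <;> rfl
  map_smul' _ _ := by ext i; fin_cases i <;> rfl

/-- The real part, as a linear map. -/
def reL : Oct →ₗ[ℝ] ℝ where
  toFun p := p.1.re
  map_add' _ _ := rfl
  map_smul' _ _ := rfl

theorem reL_apply (p : Oct) : reL p = p.1.re := rfl

theorem reL_one : reL one = 1 := rfl

theorem reL_toOct (v : Fin 7 → ℝ) : reL (toOct v) = 0 := rfl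

theorem ofOctL_toOct (v : Fin 7 → ℝ) : ofOctL (toOct v) = v := ofOct_toOct v

theorem ofOctL_one : ofOctL one = 0 := by
  ext i; fin_cases i <;> rfl

/-- The scalar product of the (split) octonions as a bilinear form. -/
def octForm (k : Kind) : LinearMap.BilinForm ℝ Oct :=
  LinearMap.mk₂ ℝ (octInner k)
    (fun a b c => by simp [octInner]; ring)
    (fun r a b => by simp [octInner]; ring)
    (fun a b c => by simp [octInner]; ring)
    (fun r a b => by simp [octInner]; ring)

theorem octForm_apply (p q : Oct) : octForm k p q = octInner k p q := rfl

theorem octInner_comm (p q : Oct) : octInner k p q = octInner k q p := by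
  simp [octInner]; ring

theorem eq_zero_of_octInner (p : Oct) (h : ∀ q, octInner k p q = 0) : p = 0 := by
  -- Rescaling the second component by ε turns the pairing into the positive definite norm, also in
  -- the split case.
  have h1 := h (p.1, k.eps • p.2)
  have h2 := k.eps_mul_self
  have h3 : (p.1 * star p.1).re + (p.2 * star p.2).re = 0 := by
    refine Eq.trans ?_ h1
    simp only [octInner, mul_smul_comm, Quaternion.re_smul, smul_eq_mul, ← mul_assoc, h2,
      Quaternion.star_smul, one_mul]
  simp only [← Quaternion.normSq_def] at h3
  have a := Quaternion.normSq_nonneg (a := p.1)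
  have b := Quaternion.normSq_nonneg (a := p.2)
  exact Prod.ext (Quaternion.normSq_eq_zero.1 (by linarith)) (Quaternion.normSq_eq_zero.1 (by linarith))

/-- The cross product of `V`, the imaginary part of the product of (split) octonions. -/
def cross (k : Kind) (y z : Fin 7 → ℝ) : Fin 7 → ℝ := ofOct (octMul k (toOct y) (toOct z))

theorem octMul_toOct (y z : Fin 7 → ℝ) :
    octMul k (toOct y) (toOct z) = -(formV k y z) • one + toOct (cross k y z) := by
  rw [cross, ← toOct_ofOct (octMul k (toOct y) (toOct z))]
  congr 2
  · rw [formV_eq]; simp [octMul, toOct]; ring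
  · rw [toOct_ofOct]

theorem conj_toOct (y : Fin 7 → ℝ) : conj (toOct y) = -toOct y := by
  ext <;> simp [conj, toOct]

/-- Conjugation is −1 on imaginary elements, so ȳ(yp) = |y|²p becomes the Clifford relation. This
makes ℍ ⊕ ℍ a spinor module of V. -/
theorem clifford (y : Fin 7 → ℝ) (p : Oct) :
    octMul k (toOct y) (octMul k (toOct y) p) = -(formV k y y) • p := by
  have h := conj_octMul_cancel (k := k) (toOct y) p
  rw [conj_toOct, neg_octMul] at h
  rw [neg_smul, formV, ← h, neg_neg]

theorem formV_add (x y z : Fin 7 → ℝ) : formV k x (y + z) = formV k x y + formV k x z := by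
  simp only [formV_eq, Pi.add_apply]; ring

theorem formV_comm (x y : Fin 7 → ℝ) : formV k x y = formV k y x := octInner_comm _ _

theorem add_formV (x y z : Fin 7 → ℝ) : formV k (x + y) z = formV k x z + formV k y z := by
  simp only [formV_eq, Pi.add_apply]; ring

theorem smul_formV (r : ℝ) (x y : Fin 7 → ℝ) : formV k (r • x) y = r * formV k x y := by
  simp only [formV_eq, Pi.smul_apply, smul_eq_mul]; ring

theorem clifford_polar (y z : Fin 7 → ℝ) (p : Oct) :
    octMul k (toOct y) (octMul k (toOct z) p) + octMul k (toOct z) (octMul k (toOct y) p) =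
      -(2 * formV k y z) • p := by
  have h := clifford (k := k) (y + z) p
  simp only [map_add, add_octMul, octMul_add, clifford, formV_add, add_formV] at h
  rw [formV_comm z y] at h
  linear_combination (norm := module) h

theorem clifford_anti {y z : Fin 7 → ℝ} (h : formV k y z = 0) (p : Oct) :
    octMul k (toOct y) (octMul k (toOct z) p) = -octMul k (toOct z) (octMul k (toOct y) p) := by
  have h1 := clifford_polar (k := k) y z p
  rw [h] at h1
  linear_combination (norm := module) h1

theorem octInner_skew (y : Fin 7 → ℝ) (p q : Oct) :
    octInner k (octMul k (toOct y) p) q = -octInner k p (octMul k (toOct y) q) := by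
  rw [oct8_eta p, oct8_eta q, oct8_eta (toOct y)]
  simp only [octMul_oct8, octInner_oct8]
  cases k <;> simp [Kind.eps, toOct] <;> ring

theorem octMul_im (p q : Oct) : octMul k p q =
    (reL p * reL q) • one + reL p • toOct (ofOctL q) + reL q • toOct (ofOctL p)
      + octMul k (toOct (ofOctL p)) (toOct (ofOctL q)) := by
  have hp : p = reL p • one + toOct (ofOctL p) := (toOct_ofOct p).symm
  have hq : q = reL q • one + toOct (ofOctL q) := (toOct_ofOct q).symm
  conv_lhs => rw [hp, hq]
  simp only [octMul_add, add_octMul, smul_octMul, octMul_smul, octMul_one, one_octMul]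
  module

/-! ### The group G₂(V) in terms of matrices, and its inclusion in SO(V). -/

/-- The extension of a linear transformation of `V` to the (split) octonions that fixes `1`. -/
def extend (M : Matrix (Fin 7) (Fin 7) ℝ) : Oct →ₗ[ℝ] Oct :=
  reL.smulRight one + toOct ∘ₗ M.mulVecLin ∘ₗ ofOctL

theorem extend_apply (M : Matrix (Fin 7) (Fin 7) ℝ) (p : Oct) :
    extend M p = reL p • one + toOct (M.mulVec (ofOctL p)) := rfl

theorem extend_mul (M N : Matrix (Fin 7) (Fin 7) ℝ) (p : Oct) :
    extend (M * N) p = extend M (extend N p) := by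
  simp [extend_apply, reL_one, reL_toOct, ofOctL_toOct, ofOctL_one]

theorem extend_one (p : Oct) : extend 1 p = p := by
  rw [extend_apply, Matrix.one_mulVec]; exact toOct_ofOct p

theorem reL_extend (M : Matrix (Fin 7) (Fin 7) ℝ) (p : Oct) : reL (extend M p) = reL p := by
  simp [extend_apply, reL_one, reL_toOct]

theorem extend_one_eq (M : Matrix (Fin 7) (Fin 7) ℝ) : extend M one = one := by
  simp [extend_apply, reL_one, ofOctL_one]

theorem extend_toOct (M : Matrix (Fin 7) (Fin 7) ℝ) (v : Fin 7 → ℝ) :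
    extend M (toOct v) = toOct (M.mulVec v) := by
  rw [extend_apply, reL_toOct, ofOctL_toOct, zero_smul, zero_add]

theorem extend_octMul {M : Matrix (Fin 7) (Fin 7) ℝ}
    (h : ∀ y z, octMul k (toOct (M.mulVec y)) (toOct (M.mulVec z)) =
      -(formV k y z) • one + toOct (M.mulVec (cross k y z))) (p q : Oct) :
    extend M (octMul k p q) = octMul k (extend M p) (extend M q) := by
  rw [octMul_im p q, octMul_im (extend M p), octMul_toOct]
  simp only [extend_apply, map_add, map_smul, reL_one, reL_toOct, ofOctL_toOct, ofOctL_one, h,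
    smul_zero, zero_add, Matrix.mulVec_zero, map_zero]
  simp only [smul_eq_mul, mul_one, add_zero]
  module

/-- An automorphism fixes 1 and so is determined by its restriction to V. This replaces the
existential over Φ by equations in the matrix, which also show that the group is closed. -/
theorem mem_G2_iff (g : GL (Fin 7) ℝ) : g ∈ G2 k ↔ ∀ y z,
    octMul k (toOct (g.1.mulVec y)) (toOct (g.1.mulVec z)) =
      -(formV k y z) • one + toOct (g.1.mulVec (cross k y z)) := by
  constructor
  · rintro ⟨Φ, h, h'⟩ y z
    have h1 : Φ one = one := by
      have := h one (Φ.symm one)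
      simpa using this.symm
    rw [← h', ← h', ← h, octMul_toOct, map_add, map_smul, h1, h']
  · intro h
    let Φ : Oct ≃ₗ[ℝ] Oct := LinearEquiv.ofLinearMap (extend g.1) (extend (g⁻¹).1)
      (LinearMap.ext fun p => by
        show extend g.1 (extend (g⁻¹).1 p) = p
        rw [← extend_mul, ← Units.val_mul, mul_inv_cancel, Units.val_one, extend_one])
      (LinearMap.ext fun p => by
        show extend (g⁻¹).1 (extend g.1 p) = p
        rw [← extend_mul, ← Units.val_mul, inv_mul_cancel, Units.val_one, extend_one])
    exact ⟨Φ, extend_octMul h, extend_toOct g.1⟩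

theorem G2_extend_octMul {g : GL (Fin 7) ℝ} (hg : g ∈ G2 k) (p q : Oct) :
    extend g.1 (octMul k p q) = octMul k (extend g.1 p) (extend g.1 q) :=
  extend_octMul ((mem_G2_iff g).1 hg) p q

theorem formV_of_octMul {a b y z w : Fin 7 → ℝ}
    (h : octMul k (toOct a) (toOct b) = -(formV k y z) • one + toOct w) :
    formV k a b = formV k y z := by
  rw [octMul_toOct] at h
  have := congrArg reL h
  simpa [reL_one, reL_toOct] using this

theorem G2_formV {g : GL (Fin 7) ℝ} (hg : g ∈ G2 k) (y z : Fin 7 → ℝ) :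
    formV k (g.1.mulVec y) (g.1.mulVec z) = formV k y z :=
  formV_of_octMul ((mem_G2_iff g).1 hg y z)

/-- The real part of the product `v₀(v₁(v₂(v₃(v₄(v₅v₆)))))`. -/
def prod7 (k : Kind) : MultilinearMap ℝ (fun _ : Fin 7 => Fin 7 → ℝ) ℝ :=
  (reL ∘ₗ LinearMap.applyₗ (one : Oct)).compMultilinearMap
    ((MultilinearMap.mkPiAlgebraFin ℝ 7 (Module.End ℝ Oct)).compLinearMap
      fun _ => (mulL k).comp toOct)

theorem prod7_apply (v : Fin 7 → Fin 7 → ℝ) : prod7 k v = reL (octMul k (toOct (v 0))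
    (octMul k (toOct (v 1)) (octMul k (toOct (v 2)) (octMul k (toOct (v 3)) (octMul k (toOct (v 4))
      (octMul k (toOct (v 5)) (octMul k (toOct (v 6)) one))))))) := by
  simp [prod7, List.ofFn_succ, mulL_apply]

/-- Left multiplications by orthogonal vectors anticommute. -/
theorem prod7_swap (v : Fin 7 → Fin 7 → ℝ) (hv : ∀ i j, i ≠ j → formV k (v i) (v j) = 0)
    (i : Fin 6) : prod7 k (v ∘ Equiv.swap i.castSucc i.succ) = -prod7 k v := by
  rw [prod7_apply, prod7_apply]
  fin_cases i <;> simp [Equiv.swap_apply_def]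
  · rw [clifford_anti (hv 1 0 (by decide))]; simp only [map_neg]
  · rw [clifford_anti (hv 2 1 (by decide))]; simp only [octMul_neg, map_neg]
  · rw [clifford_anti (hv 3 2 (by decide))]; simp only [octMul_neg, map_neg]
  · rw [clifford_anti (hv 4 3 (by decide))]; simp only [octMul_neg, map_neg]
  · rw [clifford_anti (hv 5 4 (by decide))]; simp only [octMul_neg, map_neg]
  · have h := clifford_anti (hv 6 5 (by decide)) one
    simp only [octMul_one] at h
    rw [h]; simp only [octMul_neg, map_neg]

theorem prod7_perm (σ : Equiv.Perm (Fin 7)) : ∀ v : Fin 7 → Fin 7 → ℝ,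
    (∀ i j, i ≠ j → formV k (v i) (v j) = 0) →
      prod7 k (v ∘ σ) = (Equiv.Perm.sign σ : ℤ) • prod7 k v := by
  have hσ : σ ∈ Submonoid.closure (Set.range fun i : Fin 6 ↦ Equiv.swap i.castSucc i.succ) := by
    rw [Equiv.Perm.mclosure_swap_castSucc_succ]; trivial
  induction hσ using Submonoid.closure_induction with
  | mem τ hτ =>
    obtain ⟨i, rfl⟩ := hτ
    intro v hv
    rw [prod7_swap v hv, Equiv.Perm.sign_swap (Fin.castSucc_lt_succ).ne]
    simp
  | one => intro v _; simp
  | mul τ ρ _ _ hτ hρ =>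
    intro v hv
    have e : v ∘ (τ * ρ) = (v ∘ τ) ∘ ρ := rfl
    rw [e, hρ (v ∘ τ) fun i j hij => hv _ _ (τ.injective.ne hij), hτ v hv, smul_smul, mul_comm]
    simp

theorem formV_e (i j : Fin 7) (h : i ≠ j) : formV k (e i) (e j) = 0 := by
  rw [formV_eq]
  fin_cases i <;> fin_cases j <;> simp [e] at h ⊢

/-- By `prod7_perm` each of the 7! = 5040 permutations contributes the same value, as its sign
occurs twice. -/
theorem alternatization_prod7_e :
    MultilinearMap.alternatization (prod7 k) e = 5040 * prod7 k e := by
  rw [MultilinearMap.alternatization_apply]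
  have h : ∀ σ : Equiv.Perm (Fin 7),
      Equiv.Perm.sign σ • (prod7 k).domDomCongr σ e = prod7 k e := by
    intro σ
    have : (prod7 k).domDomCongr σ e = prod7 k (e ∘ σ) := rfl
    rw [this, prod7_perm σ e formV_e, Units.smul_def, smul_smul, ← Units.val_mul]
    simp
  simp only [h, Finset.sum_const, Finset.card_univ, Fintype.card_perm, Fintype.card_fin]
  norm_num [Nat.factorial]

theorem prod7_e : prod7 k e ≠ 0 := by
  have h (j : Fin 7) : toOct (e j) = oct8 0 (e j 0) (e j 1) (e j 2) (e j 3) (e j 4) (e j 5) (e j 6) :=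
    rfl
  have h1 : one = oct8 1 0 0 0 0 0 0 0 := rfl
  rw [prod7_apply]
  simp only [h, h1, octMul_oct8]
  cases k <;> simp [Kind.eps, oct8, reL_apply]

/-- The alternatization of `prod7` is a nonzero volume form built only from the product, the unit
and the real part. Automorphisms preserve it, whereas a linear map scales it by its determinant. -/
theorem G2_det {g : GL (Fin 7) ℝ} (hg : g ∈ G2 k) : g.1.det = 1 := by
  set F := MultilinearMap.alternatization (prod7 k) with hF
  have h1 := AlternatingMap.eq_smul_basis_det (Pi.basisFun ℝ (Fin 7)) F
  have hP : ∀ v : Fin 7 → Fin 7 → ℝ, prod7 k (fun i => g.1.mulVec (v i)) = prod7 k v := by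
    intro v
    simp only [prod7_apply, ← extend_toOct]
    conv_lhs => rw [← extend_one_eq g.1]
    simp only [← G2_extend_octMul hg, reL_extend]
  have hFg : F (fun i => g.1.mulVec (e i)) = F e := by
    rw [hF, MultilinearMap.alternatization_apply, MultilinearMap.alternatization_apply]
    exact Finset.sum_congr rfl fun σ _ => congrArg _ (hP fun i => e (σ i))
  have h2 : F e ≠ 0 := by
    rw [alternatization_prod7_e]; exact mul_ne_zero (by norm_num) prod7_e
  have h3 : F (fun i => g.1.mulVec (e i)) = F e * g.1.det := by
    rw [h1, Pi.basisFun_det]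
    simp only [AlternatingMap.smul_apply, smul_eq_mul]
    have e1 : Matrix.detRowAlternating (fun i => g.1.mulVec (e i)) = g.1.det := by
      rw [← Matrix.det_transpose g.1]
      refine congrArg Matrix.det (Matrix.ext fun i j => ?_)
      simp [Matrix.mulVec_single]
    have e2 : Matrix.detRowAlternating (e : Fin 7 → Fin 7 → ℝ) = 1 := by
      rw [← Matrix.det_one (n := Fin 7) (R := ℝ)]
      refine congrArg Matrix.det (Matrix.ext fun i j => ?_)
      simp [Matrix.one_apply, Pi.single_apply, eq_comm]
    have e3 : ⇑(Pi.basisFun ℝ (Fin 7)) = e := by ext; simp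
    rw [e1, e2, e3, mul_one]
  rw [h3] at hFg
  exact mul_left_cancel₀ h2 (by rw [hFg, mul_one])

theorem G2_le_SOV : G2 k ≤ SOV k := fun _ hg => ⟨G2_formV hg, G2_det hg⟩

/-! ### The rotations exp(tA_x) and their lift to spinors. -/

theorem formV_toOct (y z : Fin 7 → ℝ) : octInner k (toOct y) (toOct z) = formV k y z := rfl

theorem eq_of_formV {y y' : Fin 7 → ℝ} (h : ∀ z, formV k y z = formV k y' z) : y = y' := by
  have e1 := k.eps_ne_zero
  ext i
  have := h (e i)
  fin_cases i <;> simpa [formV_eq, e1] using this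

theorem octInner_one_toOct (z : Fin 7 → ℝ) : octInner k one (toOct z) = 0 := by
  simp [octInner, one, toOct]

theorem neg_formV (y z : Fin 7 → ℝ) : formV k (-y) z = -formV k y z := by
  simp only [formV_eq, Pi.neg_apply]; ring

theorem octInner_add (p q r : Oct) : octInner k p (q + r) = octInner k p q + octInner k p r :=
  (octForm k p).map_add q r

theorem add_octInner (p q r : Oct) : octInner k (p + q) r = octInner k p r + octInner k q r :=
  (octForm k).map_add₂ p q r

theorem smul_octInner (c : ℝ) (p r : Oct) : octInner k (c • p) r = c * octInner k p r :=
  (octForm k).map_smul₂ c p r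

theorem octInner_smul (c : ℝ) (p r : Oct) : octInner k p (c • r) = c * octInner k p r :=
  (octForm k p).map_smul c r

theorem cross_anti (y z : Fin 7 → ℝ) : cross k y z = -cross k z y := by
  have h := clifford_polar (k := k) y z one
  simp only [octMul_one, octMul_toOct] at h
  rw [formV_comm z y] at h
  apply toOct_injective
  rw [map_neg]
  linear_combination (norm := module) h

theorem genA_mulVec (x y : Fin 7 → ℝ) : (genA k x).mulVec y = cross k x y := by
  refine eq_of_formV (k := k) fun z => ?_
  rw [formV_genA, phi, octInner_comm, octInner_skew, octMul_toOct, octInner_comm, add_octInner,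
    smul_octInner, octInner_one_toOct, mul_zero, zero_add, formV_toOct, cross_anti, neg_formV,
    neg_neg]

theorem toOct_cross (y z : Fin 7 → ℝ) :
    toOct (cross k y z) = octMul k (toOct y) (toOct z) + formV k y z • one := by
  rw [octMul_toOct]; module

theorem formV_cross_self (x y : Fin 7 → ℝ) : formV k x (cross k x y) = 0 := by
  rw [formV_comm, ← genA_mulVec, formV_genA, phi_eq]
  ring

/-- A_x annihilates x and is a complex structure on the orthogonal complement of x. This is why T_x
is a circle. -/
theorem genA_sq (x y : Fin 7 → ℝ) (hx : formV k x x = 1) :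
    cross k x (cross k x y) = -y + formV k x y • x := by
  apply toOct_injective
  rw [toOct_cross, formV_cross_self, toOct_cross, octMul_add, clifford, hx, octMul_smul, octMul_one,
    map_add, map_neg, map_smul]
  module

theorem genA_cube (x : Fin 7 → ℝ) (hx : formV k x x = 1) :
    genA k x * genA k x * genA k x = -genA k x := by
  refine Matrix.toLin'.injective (LinearMap.ext fun y => ?_)
  rw [Matrix.toLin'_apply, Matrix.toLin'_apply, ← Matrix.mulVec_mulVec, ← Matrix.mulVec_mulVec,
    Matrix.neg_mulVec, genA_mulVec, genA_mulVec, genA_mulVec, genA_sq x _ hx, formV_cross_self,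
    zero_smul, add_zero]

/-- The exponential of `tA` if `A³ = -A`. -/
def rot (A : Matrix (Fin 7) (Fin 7) ℝ) (t : ℝ) : Matrix (Fin 7) (Fin 7) ℝ :=
  1 + Real.sin t • A + (1 - Real.cos t) • (A * A)

/-- The derivative of exp(−tA) · `rot A t` vanishes because A³ = −A, so this product keeps its value
1 at t = 0. -/
theorem exp_eq_rot {A : Matrix (Fin 7) (Fin 7) ℝ} (hA : A * A * A = -A) (t : ℝ) :
    NormedSpace.exp (t • A) = rot A t := by
  let _ : NormedRing (Matrix (Fin 7) (Fin 7) ℝ) := Matrix.linftyOpNormedRing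
  let _ : NormedAlgebra ℝ (Matrix (Fin 7) (Fin 7) ℝ) := Matrix.linftyOpNormedAlgebra
  have hA' : A * (A * A) = -A := by rw [← mul_assoc, hA]
  have h1 (t : ℝ) : HasDerivAt (rot A) (Real.cos t • A + Real.sin t • (A * A)) t := by
    have h := (((Real.hasDerivAt_sin t).smul_const A).const_add 1).add
      (((Real.hasDerivAt_cos t).const_sub 1).smul_const (A * A))
    rw [neg_neg] at h
    exact h
  have h2 (t : ℝ) : HasDerivAt (fun t : ℝ => NormedSpace.exp (t • -A) * rot A t) 0 t := by
    have h := (hasDerivAt_exp_smul_const (𝕂 := ℝ) (-A) t).mul (h1 t)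
    have e : NormedSpace.exp (t • -A) * -A * rot A t +
        NormedSpace.exp (t • -A) * (Real.cos t • A + Real.sin t • (A * A)) = 0 := by
      rw [mul_assoc, ← mul_add]
      have : -A * rot A t + (Real.cos t • A + Real.sin t • (A * A)) = 0 := by
        simp only [rot, mul_add, mul_one, mul_smul_comm, neg_mul, hA']
        module
      rw [this, mul_zero]
    exact h.congr_deriv e
  have h3 := is_const_of_deriv_eq_zero (fun t => (h2 t).differentiableAt) (fun t => (h2 t).deriv) t 0
  simp only [smul_neg, zero_smul, neg_zero, NormedSpace.exp_zero, one_mul, Matrix.exp_neg] at h3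
  have h4 : rot A 0 = 1 := by simp [rot]
  rw [h4] at h3
  have hu : IsUnit (NormedSpace.exp (t • A)) := Matrix.isUnit_exp _
  have hd := (Matrix.isUnit_iff_isUnit_det _).1 hu
  calc NormedSpace.exp (t • A) = NormedSpace.exp (t • A) * ((NormedSpace.exp (t • A))⁻¹ * rot A t) := by
        rw [h3, mul_one]
    _ = rot A t := by rw [← mul_assoc, Matrix.mul_nonsing_inv _ hd, one_mul]

/-- The unit octonion `cos θ + x sin θ`. -/
def unitO (x : Fin 7 → ℝ) (θ : ℝ) : Oct := Real.cos θ • one + Real.sin θ • toOct x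

theorem conj_unitO (x : Fin 7 → ℝ) (θ : ℝ) : conj (unitO x θ) = unitO x (-θ) := by
  ext <;> simp [conj, unitO, toOct, one]

theorem octInner_unitO (x : Fin 7 → ℝ) (hx : formV k x x = 1) (θ : ℝ) :
    octInner k (unitO x θ) (unitO x θ) = 1 := by
  have h1 : octInner k one one = 1 := by simp [octInner, one]
  simp only [unitO, octInner_add, add_octInner, smul_octInner, octInner_smul, h1,
    octInner_one_toOct, octInner_comm _ one, formV_toOct, hx]
  linarith [Real.sin_sq_add_cos_sq θ]

/-- Conjugation by u = cos θ + x sin θ fixes x; a vector y orthogonal to x satisfies yū = uy, so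
that uyū = u²y. Hence the rotation angle is 2θ, and T_x is parametrized by half angles below. -/
theorem toOct_rot (x y : Fin 7 → ℝ) (hx : formV k x x = 1) (θ : ℝ) :
    toOct ((rot (genA k x) (2 * θ)).mulVec y) =
      octMul k (octMul k (unitO x θ) (toOct y)) (unitO x (-θ)) := by
  have h1 : octMul k (octMul k (toOct x) (toOct y)) (toOct x) =
      toOct y - (2 * formV k x y) • toOct x := by
    have h := clifford_polar (k := k) x y one
    simp only [octMul_one] at h
    rw [octMul_flexible]
    have h' : octMul k (toOct y) (toOct x) =
      -(2 * formV k x y) • one - octMul k (toOct x) (toOct y) := by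
        rw [← h]; module
    rw [h', octMul_sub, octMul_smul, octMul_one, clifford, hx]
    module
  have h2 : octMul k (toOct y) (toOct x) =
      -(2 * formV k x y) • one - octMul k (toOct x) (toOct y) := by
    have h := clifford_polar (k := k) x y one
    simp only [octMul_one] at h
    rw [← h]; module
  simp only [unitO, Real.cos_neg, Real.sin_neg, rot, Matrix.add_mulVec, Matrix.smul_mulVec,
    Matrix.one_mulVec, ← Matrix.mulVec_mulVec, genA_mulVec, genA_sq x y hx, map_add, map_smul,
    map_neg, octMul_add, add_octMul, octMul_smul, smul_octMul, octMul_one, one_octMul, h1, h2,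
    toOct_cross, Real.sin_two_mul, Real.cos_two_mul]
  have h3 := Real.sin_sq_add_cos_sq θ
  match_scalars
  · linear_combination h3
  · ring
  · ring
  · linear_combination (-2 * formV k x y) * h3

theorem unitO_cancel_left (x : Fin 7 → ℝ) (hx : formV k x x = 1) (θ : ℝ) (p : Oct) :
    octMul k (unitO x (-θ)) (octMul k (unitO x θ) p) = p := by
  rw [← conj_unitO, conj_octMul_cancel, octInner_unitO x hx, one_smul]

theorem unitO_cancel_right (x : Fin 7 → ℝ) (hx : formV k x x = 1) (θ : ℝ) (p : Oct) :
    octMul k (octMul k p (unitO x θ)) (unitO x (-θ)) = p := by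
  rw [← conj_unitO, octMul_cancel_conj, octInner_unitO x hx, one_smul]

/-- The transformation `p ↦ u p u²` for `u = cos θ + x sin θ`, a lift of the rotation `y ↦ u y ū` to
the spin representation. -/
def spin (k : Kind) (x : Fin 7 → ℝ) (θ : ℝ) (p : Oct) : Oct :=
  octMul k (octMul k (octMul k (unitO x θ) p) (unitO x θ)) (unitO x θ)

theorem spin_injective (x : Fin 7 → ℝ) (hx : formV k x x = 1) (θ : ℝ) :
    Function.Injective (spin k x θ) := by
  intro p q h
  have := congrArg (fun p => octMul k (unitO x (-θ)) (octMul k (octMul k p (unitO x (-θ)))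
    (unitO x (-θ)))) h
  simpa only [spin, unitO_cancel_right x hx, unitO_cancel_left x hx] using this

theorem spin_add (x : Fin 7 → ℝ) (θ : ℝ) (p q : Oct) :
    spin k x θ (p + q) = spin k x θ p + spin k x θ q := by
  simp only [spin, octMul_add, add_octMul]

theorem spin_smul (x : Fin 7 → ℝ) (θ : ℝ) (c : ℝ) (p : Oct) :
    spin k x θ (c • p) = c • spin k x θ p := by
  simp only [spin, octMul_smul, smul_octMul]

/-- Left Moufang gives u(yp) = (uyu)(ūp). Right Moufang in the form (ab)u = (aū)(ubu), applied
twice, turns ((uyu)(ūp))u into (uy)(pu) and then ((uy)(pu))u into (uyū)(upu²). -/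
theorem spin_octMul (x : Fin 7 → ℝ) (hx : formV k x x = 1) (θ : ℝ) (y : Fin 7 → ℝ) (p : Oct) :
    spin k x θ (octMul k (toOct y) p) =
      octMul k (toOct ((rot (genA k x) (2 * θ)).mulVec y)) (spin k x θ p) := by
  rw [toOct_rot x y hx]
  set u := unitO x θ with hu
  set v := unitO x (-θ) with hv
  have c1 (p) : octMul k v (octMul k u p) = p := unitO_cancel_left x hx θ p
  have c2 (p) : octMul k (octMul k p u) v = p := unitO_cancel_right x hx θ p
  have c3 (p) : octMul k u (octMul k v p) = p := by
    have := unitO_cancel_left (k := k) x hx (-θ) p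
    rwa [neg_neg] at this
  have c4 (p) : octMul k (octMul k p v) u = p := by
    have := unitO_cancel_right (k := k) x hx (-θ) p
    rwa [neg_neg] at this
  have h1 : octMul k u (octMul k (toOct y) p) =
      octMul k (octMul k (octMul k u (toOct y)) u) (octMul k v p) := by
    rw [moufang_left, c3]
  have h2 (a b : Oct) : octMul k (octMul k a b) u =
      octMul k (octMul k a v) (octMul k (octMul k u b) u) := by
    rw [moufang_right, c4]
  rw [spin, spin, ← hu, h1, h2 (octMul k (octMul k u (toOct y)) u) (octMul k v p), c2, c3, h2,
    ← octMul_flexible]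

/-- All factors lie in the commutative algebra spanned by 1 and x, where angles add: θ − 3θ + θ + θ
= 0. The factor 3 here is the origin of the group of order three. -/
theorem spin_unitO (x : Fin 7 → ℝ) (hx : formV k x x = 1) (θ : ℝ) :
    spin k x θ (unitO x (-(3 * θ))) = one := by
  have h1 : octMul k (toOct x) (toOct x) = -one := by
    have := clifford (k := k) x one
    rwa [octMul_one, hx, neg_one_smul] at this
  have h2 (α β : ℝ) : octMul k (unitO x α) (unitO x β) = unitO x (α + β) := by
    simp only [unitO, octMul_add, add_octMul, octMul_smul, smul_octMul, octMul_one, one_octMul, h1,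
      Real.cos_add, Real.sin_add]
    module
  rw [spin, h2, h2, h2]
  have : θ + -(3 * θ) + θ + θ = 0 := by ring
  simp [this, unitO]

/-! ### Self-dual elements of the Clifford algebra of a definite four-space. -/

section Spinor

variable {S : Type*} [AddCommGroup S] [Module ℝ S]

/-- Four endomorphisms that represent the Clifford algebra of a definite four-space with
`fᵢ² = -ε`, `ε = ±1`. -/
structure CliffordFrame (ε : ℝ) (F : Fin 4 → S →ₗ[ℝ] S) : Prop where
  eps : ε * ε = 1
  sq : ∀ i p, F i (F i p) = -ε • p
  anti : ∀ i j, j < i → ∀ p, F i (F j p) = -F j (F i p)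

/-- The volume element of a Clifford frame. -/
def vol4 (F : Fin 4 → S →ₗ[ℝ] S) : S →ₗ[ℝ] S := F 0 ∘ₗ F 1 ∘ₗ F 2 ∘ₗ F 3

/-- The self-dual elements of `𝔰𝔬(4)` in the spin representation. -/
def selfDual (F : Fin 4 → S →ₗ[ℝ] S) : Fin 3 → S →ₗ[ℝ] S :=
  ![F 0 ∘ₗ F 1 + F 2 ∘ₗ F 3, F 0 ∘ₗ F 2 - F 1 ∘ₗ F 3, F 0 ∘ₗ F 3 + F 1 ∘ₗ F 2]

namespace CliffordFrame

variable {ε : ℝ} {F : Fin 4 → S →ₗ[ℝ] S} (hF : CliffordFrame ε F)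
include hF

theorem vol4_vol4 (p : S) : vol4 F (vol4 F p) = p := by
  have e := hF.eps
  simp only [vol4, LinearMap.comp_apply]
  simp only [hF.sq, hF.anti 1 0 (by decide), hF.anti 2 0 (by decide), hF.anti 3 0 (by decide),
    hF.anti 2 1 (by decide), hF.anti 3 1 (by decide), hF.anti 3 2 (by decide), map_neg, map_smul]
  match_scalars
  linear_combination (ε ^ 2 + 1) * e

/-- Multiplication by the volume element exchanges the two summands of each self-dual element up to
sign. Consequently these elements vanish on its (+1)-eigenspace. -/
theorem selfDual_vol4 (a : Fin 3) (p : S) : selfDual F a (vol4 F p) = -selfDual F a p := by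
  have e := hF.eps
  fin_cases a <;>
  simp [selfDual, vol4, hF.sq, hF.anti 1 0 (by decide), hF.anti 2 0 (by decide),
    hF.anti 3 0 (by decide), hF.anti 2 1 (by decide), hF.anti 3 1 (by decide),
    hF.anti 3 2 (by decide), smul_smul, e]

theorem vol4_selfDual (a : Fin 3) (p : S) : vol4 F (selfDual F a p) = -selfDual F a p := by
  have e := hF.eps
  fin_cases a <;>
  simp [selfDual, vol4, hF.sq, hF.anti 1 0 (by decide), hF.anti 2 0 (by decide),
    hF.anti 3 0 (by decide), hF.anti 2 1 (by decide), hF.anti 3 1 (by decide),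
    hF.anti 3 2 (by decide), smul_smul, e]
  abel

theorem vol4_zero (p : S) : vol4 F (F 0 p) = -F 0 (vol4 F p) := by
  simp [vol4, hF.sq, hF.anti 1 0 (by decide), hF.anti 2 0 (by decide), hF.anti 3 0 (by decide)]

theorem selfDual_self (a : Fin 3) (p : S) :
    selfDual F a (selfDual F a p) = (2 : ℝ) • (vol4 F p - p) := by
  have e := hF.eps
  fin_cases a <;>
  simp [selfDual, vol4, hF.sq, hF.anti 1 0 (by decide), hF.anti 2 0 (by decide),
    hF.anti 3 0 (by decide), hF.anti 2 1 (by decide), hF.anti 3 1 (by decide),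
    hF.anti 3 2 (by decide), smul_smul, e] <;> module

/-- Together with `selfDual_self` this says that, on the (−1)-eigenspace of the volume element, the
halves of the self-dual elements multiply like i, j, k up to the sign ε. -/
theorem selfDual_mul (p : S) :
    selfDual F 0 (selfDual F 1 p) = (2 * ε) • selfDual F 2 p ∧
    selfDual F 1 (selfDual F 0 p) = -(2 * ε) • selfDual F 2 p ∧
    selfDual F 1 (selfDual F 2 p) = (2 * ε) • selfDual F 0 p ∧
    selfDual F 2 (selfDual F 1 p) = -(2 * ε) • selfDual F 0 p ∧
    selfDual F 2 (selfDual F 0 p) = (2 * ε) • selfDual F 1 p ∧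
    selfDual F 0 (selfDual F 2 p) = -(2 * ε) • selfDual F 1 p := by
  refine ⟨?_, ?_, ?_, ?_, ?_, ?_⟩ <;>
  simp [selfDual, hF.sq, hF.anti 1 0 (by decide), hF.anti 2 0 (by decide),
    hF.anti 3 0 (by decide), hF.anti 2 1 (by decide), hF.anti 3 1 (by decide),
    hF.anti 3 2 (by decide)] <;> module

/-- A half-spinor that is not zero and its images under the self-dual elements are linearly
independent. -/
theorem linearIndependent {P : S} (hP : vol4 F P = -P) (h0 : P ≠ 0) :
    LinearIndependent ℝ ![P, selfDual F 0 P, selfDual F 1 P, selfDual F 2 P] := by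
  rw [Fintype.linearIndependent_iff]
  intro c hc
  simp only [Fin.sum_univ_four, Matrix.cons_val_zero, Matrix.cons_val_one, Matrix.cons_val] at hc
  obtain ⟨h01, h10, h12, h21, h20, h02⟩ := hF.selfDual_mul P
  have h1 := congrArg (selfDual F 0) hc
  have h2 := congrArg (selfDual F 1) hc
  have h3 := congrArg (selfDual F 2) hc
  simp only [map_add, map_smul, map_zero, hF.selfDual_self, h01, h10, h12, h21, h20, h02, hP]
    at h1 h2 h3
  -- Applying the conjugate c₀ − c₁Σ₀ − c₂Σ₁ − c₃Σ₂ to the relation leaves only the quaternionic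
  -- norm.
  have h : (c 0 ^ 2 + 4 * (c 1 ^ 2 + c 2 ^ 2 + c 3 ^ 2)) • P = 0 := by
    have := congrArg (c 0 • ·) hc
    have h1' := congrArg (c 1 • ·) h1
    have h2' := congrArg (c 2 • ·) h2
    have h3' := congrArg (c 3 • ·) h3
    simp only [smul_zero] at this h1' h2' h3'
    linear_combination (norm := module) this - h1' - h2' - h3'
  have h' := (smul_eq_zero.1 h).resolve_right h0
  intro i
  have : c i ^ 2 = 0 := by
    fin_cases i <;> simp only [Fin.zero_eta, Fin.mk_one, Fin.reduceFinMk] <;>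
    linarith [sq_nonneg (c 0), sq_nonneg (c 1), sq_nonneg (c 2), sq_nonneg (c 3)]
  exact pow_eq_zero_iff (two_ne_zero) |>.1 this

/-- The volume element is an involution, and the injective map `F 0` anticommutes with it. So its
two eigenspaces are complementary and have equal dimension. -/
theorem finrank_ker [FiniteDimensional ℝ S] (hS : Module.finrank ℝ S = 8) :
    Module.finrank ℝ (LinearMap.ker (vol4 F + LinearMap.id)) = 4 := by
  set W := LinearMap.ker (vol4 F + LinearMap.id)
  set W' := LinearMap.ker (vol4 F - LinearMap.id)
  have hW (p : S) : p ∈ W ↔ vol4 F p = -p := by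
    rw [LinearMap.mem_ker, LinearMap.add_apply, LinearMap.id_apply, add_eq_zero_iff_eq_neg]
  have hW' (p : S) : p ∈ W' ↔ vol4 F p = p := by
    rw [LinearMap.mem_ker, LinearMap.sub_apply, LinearMap.id_apply, sub_eq_zero]
  have hε : ε ≠ 0 := fun h => by simpa [h] using hF.eps
  have hinj : Function.Injective (F 0) := by
    intro p q h
    have := congrArg (F 0) h
    simpa [hF.sq, hε] using this
  have h1 : Module.finrank ℝ W ≤ Module.finrank ℝ W' :=
    LinearMap.finrank_le_finrank_of_injective (f := (F 0).restrict (p := W) (q := W') fun p hp => by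
      rw [hW']
      rw [hW] at hp
      rw [hF.vol4_zero, hp, map_neg, neg_neg]) fun p q h => Subtype.ext (hinj (congrArg Subtype.val h))
  have h2 : Module.finrank ℝ W' ≤ Module.finrank ℝ W :=
    LinearMap.finrank_le_finrank_of_injective (f := (F 0).restrict (p := W') (q := W) fun p hp => by
      rw [hW]
      rw [hW'] at hp
      rw [hF.vol4_zero, hp]) fun p q h => Subtype.ext (hinj (congrArg Subtype.val h))
  have hc : IsCompl W W' := by
    constructor
    · rw [Submodule.disjoint_def]
      intro p h h'
      rw [hW] at h
      rw [hW', h] at h'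
      exact (smul_eq_zero.1 (show (2 : ℝ) • p = 0 by linear_combination (norm := module) -h')).resolve_left
        two_ne_zero
    · rw [codisjoint_iff, eq_top_iff]
      intro p _
      have e : p = (1 / 2 : ℝ) • (p - vol4 F p) + (1 / 2 : ℝ) • (p + vol4 F p) := by module
      rw [e]
      refine Submodule.add_mem_sup (W.smul_mem _ ?_) (W'.smul_mem _ ?_)
      · rw [hW, map_sub, hF.vol4_vol4]; abel
      · rw [hW', map_add, hF.vol4_vol4]; abel
  have h3 := Submodule.finrank_add_eq_of_isCompl hc
  omega

/-- By dimension, the four independent vectors of `linearIndependent` form a basis of the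
(−1)-eigenspace. -/
theorem mem_span [FiniteDimensional ℝ S] (hS : Module.finrank ℝ S = 8) {P Q : S}
    (hP : vol4 F P = -P) (hQ : vol4 F Q = -Q) (h0 : P ≠ 0) : ∃ c : Fin 4 → ℝ,
      Q = c 0 • P + c 1 • selfDual F 0 P + c 2 • selfDual F 1 P + c 3 • selfDual F 2 P := by
  set W := LinearMap.ker (vol4 F + LinearMap.id) with hWdef
  have hW (p : S) : p ∈ W ↔ vol4 F p = -p := by
    rw [LinearMap.mem_ker, LinearMap.add_apply, LinearMap.id_apply, add_eq_zero_iff_eq_neg]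
  have hl := hF.linearIndependent hP h0
  have hle : Submodule.span ℝ (Set.range ![P, selfDual F 0 P, selfDual F 1 P, selfDual F 2 P]) ≤ W := by
    rw [Submodule.span_le]
    rintro _ ⟨i, rfl⟩
    fin_cases i
    · exact (hW _).2 hP
    all_goals exact (hW _).2 (hF.vol4_selfDual _ _)
  have heq := Submodule.eq_of_le_of_finrank_eq hle (by
    rw [finrank_span_eq_card hl, hF.finrank_ker hS, Fintype.card_fin])
  have hQ' := (hW Q).2 hQ
  rw [← heq, Submodule.mem_span_range_iff_exists_fun] at hQ'
  obtain ⟨c, hc⟩ := hQ'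
  refine ⟨c, ?_⟩
  rw [← hc]
  simp [Fin.sum_univ_four]

theorem bilin_selfDual (B : LinearMap.BilinForm ℝ S) (hskew : ∀ i p q, B (F i p) q = -B p (F i q))
    (a : Fin 3) (p q : S) : B (selfDual F a p) q = -B p (selfDual F a q) := by
  fin_cases a <;> simp [selfDual, hskew, hF.anti 1 0 (by decide), hF.anti 2 0 (by decide),
    hF.anti 3 0 (by decide), hF.anti 2 1 (by decide), hF.anti 3 1 (by decide),
    hF.anti 3 2 (by decide)] <;> ring

/-- If `x` is orthogonal to the images of `s` under the self-dual elements, a combination of `s`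
and `x` is annihilated by these. -/
theorem exists_combination [FiniteDimensional ℝ S] (hS : Module.finrank ℝ S = 8)
    (B : LinearMap.BilinForm ℝ S) (hB : ∀ p q, B p q = B q p) (hnd : ∀ p, (∀ q, B p q = 0) → p = 0)
    (hskew : ∀ i p q, B (F i p) q = -B p (F i q)) {s x : S}
    (hx : ∀ a, B x (selfDual F a s) = 0) :
    ∃ α β : ℝ, (α ≠ 0 ∨ β ≠ 0) ∧ ∀ a, selfDual F a (α • s + β • x) = 0 := by
  have hvol : ∀ p q, B (vol4 F p) q = B p (vol4 F q) := by
    intro p q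
    simp only [vol4, LinearMap.comp_apply, hskew]
    simp [hF.anti 1 0 (by decide), hF.anti 2 0 (by decide), hF.anti 3 0 (by decide),
      hF.anti 2 1 (by decide), hF.anti 3 1 (by decide), hF.anti 3 2 (by decide)]
  have hsd := hF.bilin_selfDual B hskew
  have hproj : ∀ a p, selfDual F a (p - vol4 F p) = (2 : ℝ) • selfDual F a p := by
    intro a p
    rw [map_sub, hF.selfDual_vol4]; module
  have hneg : ∀ p, vol4 F (p - vol4 F p) = -(p - vol4 F p) := by
    intro p
    rw [map_sub, hF.vol4_vol4]; abel
  -- P and Q are twice the projections of s and x to the (−1)-eigenspace, the only part on which the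
  -- self-dual elements act.
  set P := s - vol4 F s with hPdef
  set Q := x - vol4 F x with hQdef
  by_cases h0 : P = 0
  · refine ⟨1, 0, Or.inl one_ne_zero, fun a => ?_⟩
    have := hproj a s
    rw [← hPdef, h0, map_zero] at this
    simpa using this.symm
  obtain ⟨c, hc⟩ := hF.mem_span hS (hneg s) (hneg x) h0
  rw [← hPdef, ← hQdef] at hc
  have hPP : ∀ a, B P (selfDual F a P) = 0 := by
    intro a
    have h1 := hsd a P P
    rw [hB] at h1
    linarith
  have hQ : ∀ a, B Q (selfDual F a P) = 0 := by
    intro a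
    rw [hPdef, hproj, hQdef, map_sub, LinearMap.sub_apply, hvol]
    simp [hF.vol4_selfDual, hx]
  have hmul : ∀ a b, B (selfDual F a P) (selfDual F b P) = if a = b then 4 * B P P else 0 := by
    intro a b
    obtain ⟨h01, h10, h12, h21, h20, h02⟩ := hF.selfDual_mul P
    have hVP : vol4 F P = -P := hneg s
    rw [hsd]
    fin_cases a <;> fin_cases b <;>
    simp [h01, h10, h12, h21, h20, h02, hPP, hF.selfDual_self, hVP] <;> ring
  -- The form may be indefinite. An isotropic P would be orthogonal to its images under the
  -- self-dual elements and to itself, hence to the whole (−1)-eigenspace; as it is also orthogonal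
  -- to the (+1)-eigenspace, it would vanish by nondegeneracy.
  have hB0 : B P P ≠ 0 := by
    intro h
    apply h0
    apply hnd
    intro q
    have h2 : B P (q + vol4 F q) = 0 := by
      have hVP : vol4 F P = -P := hneg s
      rw [map_add, ← hvol, hVP]; simp
    obtain ⟨d, hd⟩ := hF.mem_span hS (hneg s) (hneg q) h0
    rw [← hPdef] at hd
    have h3 : B P (q - vol4 F q) = 0 := by
      rw [hd]; simp [hPP, h]
    rw [map_sub] at h3
    rw [map_add] at h2
    linarith
  -- The ΣₐP are mutually orthogonal of square 4B(P,P) and orthogonal to P, so pairing Q with them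
  -- isolates the coefficients. Hence Q = c₀P.
  have hc' : c 1 = 0 ∧ c 2 = 0 ∧ c 3 = 0 := by
    have h1 := hQ 0
    have h2 := hQ 1
    have h3 := hQ 2
    rw [hc] at h1 h2 h3
    simp only [map_add, LinearMap.add_apply, map_smul, LinearMap.smul_apply, hPP, hmul] at h1 h2 h3
    simpa [hB0] using And.intro h1 (And.intro h2 h3)
  -- The spinor x − c₀s has no (−1)-component.
  refine ⟨-c 0, 1, Or.inr one_ne_zero, fun a => ?_⟩
  have h1 := hproj a (-c 0 • s + (1 : ℝ) • x)
  have h2 : (-c 0 • s + (1 : ℝ) • x) - vol4 F (-c 0 • s + (1 : ℝ) • x) = 0 := by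
    have : (-c 0 • s + (1 : ℝ) • x) - vol4 F (-c 0 • s + (1 : ℝ) • x) = -c 0 • P + Q := by
      rw [map_add, map_smul, map_smul, hPdef, hQdef]; module
    rw [this, hc, hc'.1, hc'.2.1, hc'.2.2]
    module
  rw [h2, map_zero] at h1
  exact (smul_eq_zero.1 h1.symm).resolve_left two_ne_zero

end CliffordFrame

end Spinor

/-! ### Frames, their annihilated spinors, and the set G₂(V)·SO(3). -/

theorem det_mul_self_of_formV {M : Matrix (Fin 7) (Fin 7) ℝ}
    (h : ∀ y z, formV k (M.mulVec y) (M.mulVec z) = formV k y z) : M.det * M.det = 1 := by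
  set η : Matrix (Fin 7) (Fin 7) ℝ := Matrix.diagonal fun i => formV k (e i) (e i) with hη
  have h1 : ∀ y z, formV k y z = y ⬝ᵥ η.mulVec z := by
    intro y z
    rw [formV_eq, hη]
    simp [Matrix.mulVec_diagonal, dotProduct, Fin.sum_univ_seven, formV_eq]
    ring
  have h2 : M.transpose * η * M = η := by
    ext i j
    have e1 := h (e i) (e j)
    rw [h1, h1, Matrix.mulVec_mulVec, ← Matrix.vecMul_transpose, ← Matrix.dotProduct_mulVec,
      Matrix.mulVec_mulVec, ← mul_assoc] at e1
    simpa [Matrix.mulVec_single, dotProduct, Pi.single_apply] using e1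
  have h3 := congrArg Matrix.det h2
  rw [Matrix.det_mul, Matrix.det_mul, Matrix.det_transpose] at h3
  have h4 : η.det ≠ 0 := by
    rw [hη, Matrix.det_diagonal, Fin.prod_univ_seven]
    simp [formV_eq, k.eps_ne_zero]
  exact mul_left_cancel₀ h4 (by linear_combination h3)

/-- The last four columns of a matrix. -/
def frame (M : Matrix (Fin 7) (Fin 7) ℝ) : Fin 4 → Fin 7 → ℝ := fun i => M.mulVec (e (Fin.natAdd 3 i))

/-- The left multiplications by the members of a frame. -/
def leftMul (k : Kind) (f : Fin 4 → Fin 7 → ℝ) (i : Fin 4) : Oct →ₗ[ℝ] Oct := mulL k (toOct (f i))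

theorem leftMul_apply (f : Fin 4 → Fin 7 → ℝ) (i : Fin 4) (p : Oct) :
    leftMul k f i p = octMul k (toOct (f i)) p := rfl

/-- The orthonormal frames of definite four-planes. -/
def IsFrame (k : Kind) (f : Fin 4 → Fin 7 → ℝ) : Prop :=
  ∀ i j, formV k (f i) (f j) = if i = j then k.eps else 0

theorem isFrame_frame {M : Matrix (Fin 7) (Fin 7) ℝ}
    (h : ∀ y z, formV k (M.mulVec y) (M.mulVec z) = formV k y z) : IsFrame k (frame M) := by
  intro i j
  rw [frame, frame, h, formV_eq]
  fin_cases i <;> fin_cases j <;> simp [e, Fin.natAdd]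

theorem IsFrame.cliffordFrame {f : Fin 4 → Fin 7 → ℝ} (hf : IsFrame k f) :
    CliffordFrame k.eps (leftMul k f) where
  eps := k.eps_mul_self
  sq i p := by rw [leftMul_apply, leftMul_apply, clifford, hf, if_pos rfl]
  anti i j hij p := by
    simp only [leftMul_apply]
    exact clifford_anti (by rw [hf, if_neg hij.ne']) p

/-- The spinors that are annihilated by the self-dual elements of the `𝔰𝔬(4)` of a frame. -/
def Annihilates (k : Kind) (f : Fin 4 → Fin 7 → ℝ) (s : Oct) : Prop :=
  ∀ a, selfDual (leftMul k f) a s = 0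

theorem selfDual_intertwine {f f' : Fin 4 → Fin 7 → ℝ} (Ψ : Oct →ₗ[ℝ] Oct)
    (h : ∀ i p, Ψ (octMul k (toOct (f i)) p) = octMul k (toOct (f' i)) (Ψ p)) (a : Fin 3) (s : Oct) :
    Ψ (selfDual (leftMul k f) a s) = selfDual (leftMul k f') a (Ψ s) := by
  fin_cases a <;> simp [selfDual, leftMul_apply, h]

theorem annihilates_intertwine {f f' : Fin 4 → Fin 7 → ℝ} (Ψ : Oct →ₗ[ℝ] Oct)
    (hΨ : Function.Injective Ψ)
    (h : ∀ i p, Ψ (octMul k (toOct (f i)) p) = octMul k (toOct (f' i)) (Ψ p)) (s : Oct) :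
    Annihilates k f' (Ψ s) ↔ Annihilates k f s := by
  simp only [Annihilates, ← selfDual_intertwine Ψ h, map_eq_zero_iff Ψ hΨ]

theorem frame_mul (M N : Matrix (Fin 7) (Fin 7) ℝ) (i : Fin 4) :
    frame (M * N) i = M.mulVec (frame N i) := by
  rw [frame, frame, Matrix.mulVec_mulVec]

/-- The lift `spin` intertwines the Clifford action of a frame with that of the rotated frame and
takes cos 3θ − x sin 3θ to 1. Rotating by T_x thus amounts to changing the spinor tested. -/
theorem annihilates_rot (x : Fin 7 → ℝ) (hx : formV k x x = 1) (θ : ℝ)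
    (M : Matrix (Fin 7) (Fin 7) ℝ) :
    Annihilates k (frame (rot (genA k x) (2 * θ) * M)) one ↔
      Annihilates k (frame M) (unitO x (-(3 * θ))) := by
  let Ψ : Oct →ₗ[ℝ] Oct :=
    { toFun := spin k x θ, map_add' := spin_add x θ, map_smul' := fun c p => spin_smul x θ c p }
  have h := annihilates_intertwine (k := k) (f := frame M)
    (f' := frame (rot (genA k x) (2 * θ) * M)) Ψ (spin_injective x hx θ)
    (fun i p => by rw [frame_mul]; exact spin_octMul x hx θ _ p) (unitO x (-(3 * θ)))
  have h1 : Ψ (unitO x (-(3 * θ))) = one := spin_unitO x hx θ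
  rwa [h1] at h

theorem extend_injective (g : GL (Fin 7) ℝ) : Function.Injective (extend g.1) := by
  intro p q h
  have := congrArg (extend (g⁻¹).1) h
  rwa [← extend_mul, ← extend_mul, ← Units.val_mul, inv_mul_cancel, Units.val_one, extend_one,
    extend_one] at this

theorem annihilates_G2_mul {g : GL (Fin 7) ℝ} (hg : g ∈ G2 k) (M : Matrix (Fin 7) (Fin 7) ℝ) (s : Oct) :
    Annihilates k (frame (g.1 * M)) (extend g.1 s) ↔ Annihilates k (frame M) s :=
  annihilates_intertwine (extend g.1) (extend_injective g)
    (fun i p => by rw [frame_mul, G2_extend_octMul hg, extend_toOct]) s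

theorem annihilates_G2_mul_one {g : GL (Fin 7) ℝ} (hg : g ∈ G2 k) (M : Matrix (Fin 7) (Fin 7) ℝ) :
    Annihilates k (frame (g.1 * M)) one ↔ Annihilates k (frame M) one := by
  have := annihilates_G2_mul hg M one
  rwa [extend_one_eq] at this

theorem toOct_frame_one (i : Fin 4) : toOct (frame 1 i) =
    oct8 0 0 0 0 (if i = 0 then 1 else 0) (if i = 1 then 1 else 0) (if i = 2 then 1 else 0)
      (if i = 3 then 1 else 0) := by
  rw [frame, Matrix.one_mulVec]
  fin_cases i <;> ext <;> simp [toOct, oct8, e, Fin.natAdd]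

/-- For the standard frame the (+1)-eigenspace of the volume element is ℍ ⊕ 0. -/
theorem annihilates_one (p : Oct) : Annihilates k (frame 1) p ↔ p.2 = 0 := by
  simp only [Annihilates, Fin.forall_fin_succ, selfDual]
  simp [leftMul_apply, toOct_frame_one]
  rw [oct8_eta p]
  simp only [octMul_oct8]
  cases k <;> simp [oct8, Kind.eps, Prod.ext_iff, Quaternion.ext_iff] <;>
  exact ⟨fun ⟨⟨a, b, c, d⟩, _, _⟩ => ⟨b, a, d, c⟩, fun ⟨a, b, c, d⟩ => by simp [a, b, c, d]⟩

theorem octMul_toOct_comm {y z : Fin 7 → ℝ} (h : formV k y z = 0) :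
    octMul k (toOct z) (toOct y) = -octMul k (toOct y) (toOct z) := by
  have := clifford_anti h one
  simpa only [octMul_one, neg_neg] using (congrArg Neg.neg this).symm

theorem formV_eq_of_octMul {y z w : Fin 7 → ℝ}
    (h : octMul k (toOct y) (toOct z) = toOct w) : formV k y z = 0 := by
  rw [octMul_toOct] at h
  have := congrArg reL h
  simpa [reL_one, reL_toOct] using this

/-- The matrix whose last four columns are the members of a frame, and whose first three columns
are the products that this prescribes for an automorphism. -/
def frameMatrix (k : Kind) (f : Fin 4 → Fin 7 → ℝ) : Matrix (Fin 7) (Fin 7) ℝ :=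
  (Matrix.of ![k.eps • cross k (f 0) (f 1), k.eps • cross k (f 0) (f 2), k.eps • cross k (f 0) (f 3),
    f 0, f 1, f 2, f 3]).transpose

theorem toOct_frameMatrix (f : Fin 4 → Fin 7 → ℝ) (y : Fin 7 → ℝ) :
    toOct ((frameMatrix k f).mulVec y) =
      y 0 • toOct (k.eps • cross k (f 0) (f 1)) + y 1 • toOct (k.eps • cross k (f 0) (f 2))
      + y 2 • toOct (k.eps • cross k (f 0) (f 3)) + y 3 • toOct (f 0) + y 4 • toOct (f 1)
      + y 5 • toOct (f 2) + y 6 • toOct (f 3) := by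
  rw [← map_smul, ← map_smul, ← map_smul, ← map_smul, ← map_smul, ← map_smul, ← map_smul, ← map_add,
    ← map_add, ← map_add, ← map_add, ← map_add, ← map_add]
  congr 1
  ext i
  simp [frameMatrix, Matrix.mulVec, dotProduct, Fin.sum_univ_seven]
  ring

theorem cross_eq (y z : Fin 7 → ℝ) : cross k y z =
    ![y 1 * z 2 - y 2 * z 1 + k.eps * (y 3 * z 4 - y 4 * z 3 + y 6 * z 5 - y 5 * z 6),
      y 2 * z 0 - y 0 * z 2 + k.eps * (y 3 * z 5 - y 5 * z 3 + y 4 * z 6 - y 6 * z 4),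
      y 0 * z 1 - y 1 * z 0 + k.eps * (y 3 * z 6 - y 6 * z 3 + y 5 * z 4 - y 4 * z 5),
      y 4 * z 0 - y 0 * z 4 + y 5 * z 1 - y 1 * z 5 + y 6 * z 2 - y 2 * z 6,
      y 0 * z 3 - y 3 * z 0 + y 6 * z 1 - y 1 * z 6 + y 2 * z 5 - y 5 * z 2,
      y 1 * z 3 - y 3 * z 1 + y 4 * z 2 - y 2 * z 4 + y 0 * z 6 - y 6 * z 0,
      y 2 * z 3 - y 3 * z 2 + y 5 * z 0 - y 0 * z 5 + y 1 * z 4 - y 4 * z 1] := by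
  ext i
  fin_cases i <;> simp [cross, octMul, toOct, ofOct] <;> ring

/-- That 1 is annihilated reads f₂f₃ = −f₀f₁, f₁f₃ = f₀f₂, f₁f₂ = −f₀f₃. Together with the Clifford
relations this determines all products of the seven columns, and they agree with the standard
multiplication table. -/
theorem frameMatrix_octMul {f : Fin 4 → Fin 7 → ℝ} (hf : IsFrame k f) (ha : Annihilates k f one)
    (y z : Fin 7 → ℝ) :
    octMul k (toOct ((frameMatrix k f).mulVec y)) (toOct ((frameMatrix k f).mulVec z)) =
      -(formV k y z) • one + toOct ((frameMatrix k f).mulVec (cross k y z)) := by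
  have hε := k.eps_mul_self
  have hs (c : ℝ) (p : Oct) : k.eps • k.eps • p = p := by rw [smul_smul, hε, one_smul]
  have h0 := ha 0
  have h1 := ha 1
  have h2 := ha 2
  simp [selfDual, leftMul_apply] at h0 h1 h2
  have orth (i j : Fin 4) (h : i ≠ j) : formV k (f i) (f j) = 0 := by rw [hf, if_neg h]
  have sq (i : Fin 4) (p : Oct) :
      octMul k (toOct (f i)) (octMul k (toOct (f i)) p) = -k.eps • p := by
    rw [clifford, hf, if_pos rfl]
  have sq' (i : Fin 4) : octMul k (toOct (f i)) (toOct (f i)) = -k.eps • one := by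
    have := sq i one
    rwa [octMul_one] at this
  have cr (i j : Fin 4) (h : i ≠ j) :
      toOct (k.eps • cross k (f i) (f j)) = k.eps • octMul k (toOct (f i)) (toOct (f j)) := by
    rw [map_smul, toOct_cross, orth i j h, zero_smul, add_zero]
  set u1 := k.eps • cross k (f 0) (f 1) with hu1
  set u2 := k.eps • cross k (f 0) (f 2) with hu2
  set u3 := k.eps • cross k (f 0) (f 3) with hu3
  have e01 : octMul k (toOct (f 0)) (toOct (f 1)) = k.eps • toOct u1 := by rw [hu1, cr 0 1 (by decide), hs 1]
  have e02 : octMul k (toOct (f 0)) (toOct (f 2)) = k.eps • toOct u2 := by rw [hu2, cr 0 2 (by decide), hs 1]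
  have e03 : octMul k (toOct (f 0)) (toOct (f 3)) = k.eps • toOct u3 := by rw [hu3, cr 0 3 (by decide), hs 1]
  have e23 : octMul k (toOct (f 2)) (toOct (f 3)) = -k.eps • toOct u1 := by
    rw [e01] at h0; linear_combination (norm := module) h0
  have e13 : octMul k (toOct (f 1)) (toOct (f 3)) = k.eps • toOct u2 := by
    rw [e02] at h1; linear_combination (norm := module) -h1
  have e12 : octMul k (toOct (f 1)) (toOct (f 2)) = -k.eps • toOct u3 := by
    rw [e03] at h2; linear_combination (norm := module) h2
  have sw (i j : Fin 4) (h : i ≠ j) : octMul k (toOct (f j)) (toOct (f i)) =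
      -octMul k (toOct (f i)) (toOct (f j)) := octMul_toOct_comm (orth i j h)
  have e10 : octMul k (toOct (f 1)) (toOct (f 0)) = -k.eps • toOct u1 := by
    rw [sw 0 1 (by decide), e01, neg_smul]
  have e20 : octMul k (toOct (f 2)) (toOct (f 0)) = -k.eps • toOct u2 := by
    rw [sw 0 2 (by decide), e02, neg_smul]
  have e30 : octMul k (toOct (f 3)) (toOct (f 0)) = -k.eps • toOct u3 := by
    rw [sw 0 3 (by decide), e03, neg_smul]
  have e32 : octMul k (toOct (f 3)) (toOct (f 2)) = k.eps • toOct u1 := by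
    rw [sw 2 3 (by decide), e23, neg_smul, neg_neg]
  have e31 : octMul k (toOct (f 3)) (toOct (f 1)) = -k.eps • toOct u2 := by
    rw [sw 1 3 (by decide), e13, neg_smul]
  have e21 : octMul k (toOct (f 2)) (toOct (f 1)) = k.eps • toOct u3 := by
    rw [sw 1 2 (by decide), e12, neg_smul, neg_neg]
  -- from `f g = ± ε u` to `f u = ∓ g` and `u f = ± g`
  have left {i j : Fin 4} {u : Fin 7 → ℝ}
      (h : octMul k (toOct (f i)) (toOct (f j)) = k.eps • toOct u) :
      octMul k (toOct (f i)) (toOct u) = -toOct (f j) := by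
    have h' := sq i (toOct (f j))
    rw [h, octMul_smul] at h'
    have := congrArg (k.eps • ·) h'
    simp only [hs 1, smul_smul] at this
    rw [this, mul_neg, hε, neg_one_smul]
  have left' {i j : Fin 4} {u : Fin 7 → ℝ}
      (h : octMul k (toOct (f i)) (toOct (f j)) = -k.eps • toOct u) :
      octMul k (toOct (f i)) (toOct u) = toOct (f j) := by
    have := left (u := -u) (by rw [h, map_neg]; module)
    rwa [map_neg, octMul_neg, neg_inj] at this
  have right {i j : Fin 4} {u : Fin 7 → ℝ}
      (h : octMul k (toOct (f i)) (toOct u) = -toOct (f j)) :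
      octMul k (toOct u) (toOct (f i)) = toOct (f j) := by
    rw [← map_neg] at h
    rw [octMul_toOct_comm (formV_eq_of_octMul h), h, map_neg, neg_neg]
  have right' {i j : Fin 4} {u : Fin 7 → ℝ}
      (h : octMul k (toOct (f i)) (toOct u) = toOct (f j)) :
      octMul k (toOct u) (toOct (f i)) = -toOct (f j) := by
    rw [octMul_toOct_comm (formV_eq_of_octMul h), h]
  have a01 := left e01
  have a02 := left e02
  have a03 := left e03
  have a11 := left' e10
  have a12 := left e13
  have a13 := left' e12
  have a21 := left' e23
  have a22 := left' e20
  have a23 := left e21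
  have a31 := left e32
  have a32 := left' e31
  have a33 := left' e30
  have b01 := right a01
  have b02 := right a02
  have b03 := right a03
  have b11 := right' a11
  have b12 := right a12
  have b13 := right' a13
  have b21 := right' a21
  have b22 := right' a22
  have b23 := right a23
  have b31 := right a31
  have b32 := right' a32
  have b33 := right' a33
  -- Since f₀u is imaginary, u is orthogonal to f₀ and their left multiplications anticommute.
  -- Writing v = ε f₀fⱼ then reduces uv to products that are already known.
  have uu {u v : Fin 7 → ℝ} {j l : Fin 4} (hu : octMul k (toOct (f 0)) (toOct u) = -toOct (f l))
      (hv : octMul k (toOct (f 0)) (toOct (f j)) = k.eps • toOct v) :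
      octMul k (toOct u) (toOct v) = -k.eps • octMul k (toOct (f 0)) (octMul k (toOct u) (toOct (f j))) := by
    rw [← map_neg] at hu
    have h' := clifford_anti (formV_eq_of_octMul hu) (toOct (f j))
    rw [hv, octMul_smul] at h'
    have := congrArg (k.eps • ·) h'
    simp only [hs 1, smul_neg] at this
    rw [neg_smul, this, neg_neg]
  have c11 : octMul k (toOct u1) (toOct u1) = -one := by
    rw [uu a01 e01, b11, octMul_neg, sq' 0]
    simp [smul_smul, hε]
  have c12 : octMul k (toOct u1) (toOct u2) = toOct u3 := by
    rw [uu a01 e02, b21, octMul_neg, e03]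
    simp [smul_smul, hε]
  have c13 : octMul k (toOct u1) (toOct u3) = -toOct u2 := by
    rw [uu a01 e03, b31, e02]
    simp [smul_smul, hε]
  have c21 : octMul k (toOct u2) (toOct u1) = -toOct u3 := by
    rw [uu a02 e01, b12, e03]
    simp [smul_smul, hε]
  have c22 : octMul k (toOct u2) (toOct u2) = -one := by
    rw [uu a02 e02, b22, octMul_neg, sq' 0]
    simp [smul_smul, hε]
  have c23 : octMul k (toOct u2) (toOct u3) = toOct u1 := by
    rw [uu a02 e03, b32, octMul_neg, e01]
    simp [smul_smul, hε]
  have c31 : octMul k (toOct u3) (toOct u1) = toOct u2 := by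
    rw [uu a03 e01, b13, octMul_neg, e02]
    simp [smul_smul, hε]
  have c32 : octMul k (toOct u3) (toOct u2) = -toOct u1 := by
    rw [uu a03 e02, b23, e01]
    simp [smul_smul, hε]
  have c33 : octMul k (toOct u3) (toOct u3) = -one := by
    rw [uu a03 e03, b33, octMul_neg, sq' 0]
    simp [smul_smul, hε]
  rw [toOct_frameMatrix, toOct_frameMatrix, toOct_frameMatrix]
  simp only [octMul_add, add_octMul, octMul_smul, smul_octMul, ← hu1, ← hu2, ← hu3,
    e01, e02, e03, e10, e12, e13, e20, e21, e23, e30, e31, e32, sq' 0, sq' 1,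
    sq' 2, sq' 3, a01, a02, a03, a11, a12, a13, a21, a22, a23, a31, a32, a33, b01, b02, b03,
    b11, b12, b13, b21, b22, b23, b31, b32, b33, c11, c12, c13, c21, c22, c23, c31, c32, c33]
  rw [formV_eq, cross_eq]
  simp only [Matrix.cons_val]
  module

theorem frameMatrix_mulVec_e (f : Fin 4 → Fin 7 → ℝ) : frame (frameMatrix k f) = f := by
  funext i
  fin_cases i <;> simp [frame, frameMatrix, Fin.natAdd, Matrix.mulVec_single]

/-- An orthonormal frame that annihilates the spinor `1` is the image of the standard one under an
automorphism. -/
theorem exists_G2_of_frame {f : Fin 4 → Fin 7 → ℝ} (hf : IsFrame k f) (ha : Annihilates k f one) :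
    ∃ g ∈ G2 k, frame g.1 = f := by
  have h := frameMatrix_octMul hf ha
  have h1 : IsUnit (frameMatrix k f).det :=
    IsUnit.of_mul_eq_one _ (det_mul_self_of_formV fun y z => formV_of_octMul (h y z))
  exact ⟨Matrix.nonsingInvUnit _ h1, (mem_G2_iff _).2 h, frameMatrix_mulVec_e f⟩

theorem mem_SO3_of_frame {g : GL (Fin 7) ℝ} (hg : g ∈ SOV k) (h : frame g.1 = frame 1) : g ∈ SO3 k := by
  refine ⟨hg, fun j hj => ?_⟩
  have h1 (i : Fin 4) := congrFun h i
  simp only [frame, Matrix.one_mulVec] at h1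
  obtain ⟨i, rfl⟩ : ∃ i : Fin 4, j = Fin.natAdd 3 i := by
    refine ⟨⟨j.1 - 3, by omega⟩, Fin.ext ?_⟩
    have : 3 ≤ j.1 := hj
    simp only [Fin.natAdd_mk]
    omega
  exact h1 i

theorem frame_of_mem_SO3 {g : GL (Fin 7) ℝ} (hg : g ∈ SO3 k) : frame g.1 = frame 1 := by
  funext i
  rw [frame, frame, hg.2 _ (by fin_cases i <;> decide), Matrix.one_mulVec]

theorem frame_mul_of_mem_SO3 (M : Matrix (Fin 7) (Fin 7) ℝ) {s : GL (Fin 7) ℝ} (hs : s ∈ SO3 k) :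
    frame (M * s.1) = frame M := by
  funext i
  rw [frame_mul, frame_of_mem_SO3 hs, ← frame_mul, mul_one]

theorem SO3_le_SOV : SO3 k ≤ SOV k := fun _ h => h.1

/-- If 1 is annihilated, some automorphism a has the same last four columns as g, and a⁻¹g then
fixes the last four basis vectors. Conversely, SO(3) does not change the frame, automorphisms fix
the spinor 1, and the standard frame annihilates it. -/
theorem mem_sect_iff (g : GL (Fin 7) ℝ) :
    g ∈ sect k ↔ g ∈ SOV k ∧ Annihilates k (frame g.1) one := by
  constructor
  · rintro ⟨a, ha, s, hs, rfl⟩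
    refine ⟨mul_mem (G2_le_SOV ha) (SO3_le_SOV hs), ?_⟩
    rw [Units.val_mul, frame_mul_of_mem_SO3 a.1 hs, ← mul_one a.1, annihilates_G2_mul_one ha,
      annihilates_one]
    rfl
  · rintro ⟨hg, h⟩
    obtain ⟨a, ha, hf⟩ := exists_G2_of_frame (isFrame_frame hg.1) h
    refine ⟨a, ha, a⁻¹ * g, mem_SO3_of_frame (mul_mem (inv_mem (G2_le_SOV ha)) hg) ?_, by group⟩
    funext i
    rw [Units.val_mul, frame_mul, ← hf, ← frame_mul, ← Units.val_mul, inv_mul_cancel, Units.val_one]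

/-! ### The zero locus of the moment map. -/

theorem annihilates_unitO (f : Fin 4 → Fin 7 → ℝ) (x : Fin 7 → ℝ) (φ : ℝ) :
    Annihilates k f (unitO x φ) ↔ ∀ a, Real.cos φ • selfDual (leftMul k f) a one +
      Real.sin φ • selfDual (leftMul k f) a (toOct x) = 0 := by
  simp only [Annihilates, unitO, map_add, map_smul]

theorem mem_T_iff {x : Fin 7 → ℝ} (hx : formV k x x = 1) (t : GL (Fin 7) ℝ) :
    t ∈ T k x ↔ ∃ θ : ℝ, t.1 = rot (genA k x) (2 * θ) := by
  constructor
  · rintro ⟨s, hs⟩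
    exact ⟨s / 2, by rw [hs, exp_eq_rot (genA_cube x hx), mul_div_cancel₀ _ two_ne_zero]⟩
  · rintro ⟨θ, hθ⟩
    exact ⟨2 * θ, by rw [hθ, exp_eq_rot (genA_cube x hx)]⟩

theorem octInner_octMul_right (p a b : Oct) :
    octInner k (octMul k a p) (octMul k b p) = octInner k p p * octInner k a b := by
  rw [oct8_eta a, oct8_eta b, oct8_eta p]
  simp only [octMul_oct8, octInner_oct8]
  cases k <;> simp only [Kind.eps] <;> ring

theorem rot_formV {x : Fin 7 → ℝ} (hx : formV k x x = 1) (θ : ℝ) (y z : Fin 7 → ℝ) :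
    formV k ((rot (genA k x) (2 * θ)).mulVec y) ((rot (genA k x) (2 * θ)).mulVec z) =
      formV k y z := by
  rw [formV, toOct_rot x y hx, toOct_rot x z hx, octInner_octMul_right, octInner_octMul,
    octInner_unitO x hx, octInner_unitO x hx, one_mul, one_mul, formV]

theorem T_le_SOV {x : Fin 7 → ℝ} (hx : formV k x x = 1) : T k x ≤ SOV k := by
  intro t ht
  obtain ⟨θ, hθ⟩ := (mem_T_iff hx t).1 ht
  refine ⟨fun y z => by rw [hθ, rot_formV hx], ?_⟩
  -- The determinant of exp(2θA) is the square of that of the isometry exp(θA), hence 1.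
  rw [hθ, ← exp_eq_rot (genA_cube x hx), two_mul, add_smul,
    Matrix.exp_add_of_commute _ _ (((Commute.refl _).smul_left _).smul_right _), Matrix.det_mul]
  have h := det_mul_self_of_formV (rot_formV hx (θ / 2))
  rwa [mul_div_cancel₀ _ two_ne_zero, ← exp_eq_rot (genA_cube x hx)] at h

theorem G2_cross {g : GL (Fin 7) ℝ} (hg : g ∈ G2 k) (y z : Fin 7 → ℝ) :
    cross k (g.1.mulVec y) (g.1.mulVec z) = g.1.mulVec (cross k y z) := by
  have h := (mem_G2_iff g).1 hg y z
  rw [octMul_toOct, G2_formV hg] at h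
  exact toOct_injective (add_left_cancel h)

theorem G2_mul_genA {g : GL (Fin 7) ℝ} (hg : g ∈ G2 k) (x : Fin 7 → ℝ) :
    genA k (g.1.mulVec x) * g.1 = g.1 * genA k x := by
  refine Matrix.toLin'.injective (LinearMap.ext fun y => ?_)
  rw [Matrix.toLin'_apply, Matrix.toLin'_apply, ← Matrix.mulVec_mulVec, ← Matrix.mulVec_mulVec,
    genA_mulVec, genA_mulVec, G2_cross hg]

theorem rot_mul_of_intertwine {A B M : Matrix (Fin 7) (Fin 7) ℝ} (h : B * M = M * A) (θ : ℝ) :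
    rot B θ * M = M * rot A θ := by
  have h2 : B * B * M = M * (A * A) := by rw [mul_assoc, h, ← mul_assoc, h, mul_assoc]
  simp only [rot, add_mul, mul_add, one_mul, mul_one, smul_mul_assoc, mul_smul_comm, h, h2]

theorem G2_conj_T {g : GL (Fin 7) ℝ} (hg : g ∈ G2 k) {x : Fin 7 → ℝ} (hx : formV k x x = 1)
    {t : GL (Fin 7) ℝ} (ht : t ∈ T k x) : g * t * g⁻¹ ∈ T k (g.1.mulVec x) := by
  obtain ⟨θ, hθ⟩ := (mem_T_iff hx t).1 ht
  refine (mem_T_iff (by rw [G2_formV hg, hx]) _).2 ⟨θ, ?_⟩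
  rw [Units.val_mul, Units.val_mul, hθ, ← rot_mul_of_intertwine (G2_mul_genA hg x), mul_assoc,
    ← Units.val_mul, mul_inv_cancel, Units.val_one, mul_one]

theorem phi_eq_octInner (x y z : Fin 7 → ℝ) :
    phi k x y z = octInner k (toOct x) (octMul k (toOct y) (toOct z)) := rfl

/-- The two-form of A_x is ω(y,z) = φ(x,y,z) = ⟨x, yz⟩, so the three moment map equations are the
pairings of x with the Σₐ1. -/
theorem momentMap_genA_eq_zero_iff (x : Fin 7 → ℝ) {g : GL (Fin 7) ℝ} (hg : g ∈ SOV k) :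
    momentMap (genA k x) g = 0 ↔
      ∀ a, octInner k (toOct x) (selfDual (leftMul k (frame g.1)) a one) = 0 := by
  rw [momentMap_eq_zero_iff k (genA k x) (fun y z => by
    rw [formV_comm y, formV_genA, formV_genA, phi_eq, phi_eq]; ring) g hg]
  simp only [formV_genA, phi_eq_octInner, Fin.forall_fin_succ, ← octForm_apply]
  simp [selfDual, leftMul_apply, frame, Fin.natAdd]

theorem mem_Z_iff (x : Fin 7 → ℝ) (g : GL (Fin 7) ℝ) : g ∈ Z k x ↔ g ∈ SOV k ∧
    ∀ a, octInner k (toOct x) (selfDual (leftMul k (frame g.1)) a one) = 0 := by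
  constructor
  · rintro ⟨hg, h⟩
    exact ⟨hg, (momentMap_genA_eq_zero_iff x hg).1 (h _ (Submodule.mem_span_singleton_self _))⟩
  · rintro ⟨hg, h⟩
    refine ⟨hg, fun v hv => ?_⟩
    obtain ⟨c, rfl⟩ := Submodule.mem_span_singleton.1 hv
    have h1 := (momentMap_genA_eq_zero_iff x hg).2 h
    have h2 : genA k (c • x) = c • genA k x := by
      refine Matrix.toLin'.injective (LinearMap.ext fun y => ?_)
      rw [Matrix.toLin'_apply, Matrix.toLin'_apply, Matrix.smul_mulVec, genA_mulVec, genA_mulVec,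
        ← ofOctL_toOct (cross k x y), ← ofOctL_toOct (cross k (c • x) y), toOct_cross, toOct_cross,
        map_smul, smul_octMul, smul_formV]
      simp [ofOctL_one]
    rw [← h2, momentMap_genA_eq_zero_iff (c • x) hg]
    intro a
    rw [map_smul, smul_octInner, h, mul_zero]

theorem exists_polar {α β : ℝ} (h : α ≠ 0 ∨ β ≠ 0) :
    ∃ φ r : ℝ, r ≠ 0 ∧ α = r * Real.cos φ ∧ β = r * Real.sin φ := by
  set z : ℂ := ⟨α, β⟩ with hz
  have hz0 : z ≠ 0 := by
    intro h0
    rcases h with h | h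
    · exact h (congrArg Complex.re h0)
    · exact h (congrArg Complex.im h0)
  exact ⟨z.arg, ‖z‖, norm_ne_zero_iff.2 hz0, (Complex.norm_mul_cos_arg z).symm,
    (Complex.norm_mul_sin_arg z).symm⟩

theorem finrank_oct : Module.finrank ℝ Oct = 8 := by
  rw [Module.finrank_prod, Quaternion.finrank_eq_four]

/-- The vanishing of the moment map at a frame means that a unit `cos φ + x sin φ` is annihilated
by the self-dual elements. -/
theorem exists_annihilates_unitO {f : Fin 4 → Fin 7 → ℝ} (hf : IsFrame k f) {x : Fin 7 → ℝ}
    (h : ∀ a, octInner k (toOct x) (selfDual (leftMul k f) a one) = 0) :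
    ∃ φ : ℝ, Annihilates k f (unitO x φ) := by
  obtain ⟨α, β, h0, h1⟩ := hf.cliffordFrame.exists_combination finrank_oct (octForm k)
    (fun p q => octInner_comm p q) (fun p hp => eq_zero_of_octInner p hp)
    (fun i p q => octInner_skew (f i) p q) (s := one) (x := toOct x) h
  obtain ⟨φ, r, hr, rfl, rfl⟩ := exists_polar h0
  refine ⟨φ, fun a => ?_⟩
  have h2 := h1 a
  have h3 : (r * Real.cos φ) • one + (r * Real.sin φ) • toOct x = r • unitO x φ := by
    rw [unitO]; module
  rw [h3, map_smul] at h2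
  exact (smul_eq_zero.1 h2).resolve_left hr

/-- The Σₐ are skew. Pairing cos φ Σₐ1 + sin φ Σₐx = 0 with x and with 1 therefore gives cos φ ⟨x,
Σₐ1⟩ = 0 and sin φ ⟨x, Σₐ1⟩ = 0. -/
theorem octInner_selfDual_of_annihilates {f : Fin 4 → Fin 7 → ℝ} (hf : IsFrame k f) {x : Fin 7 → ℝ}
    {φ : ℝ} (h : Annihilates k f (unitO x φ)) (a : Fin 3) :
    octInner k (toOct x) (selfDual (leftMul k f) a one) = 0 := by
  have hsd := hf.cliffordFrame.bilin_selfDual (octForm k) (fun i p q => octInner_skew (f i) p q) a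
  have h0 : ∀ p, octForm k p (selfDual (leftMul k f) a p) = 0 := by
    intro p
    have h1 := hsd p p
    rw [octForm_apply, octInner_comm, ← octForm_apply] at h1
    linarith
  have h1 := (annihilates_unitO f x φ).1 h a
  have h2 := congrArg (octForm k (toOct x)) h1
  have h3 := congrArg (octForm k one) h1
  have h4 := hsd one (toOct x)
  rw [octForm_apply, octInner_comm, ← octForm_apply] at h4
  simp only [map_add, map_smul, h0, map_zero, smul_eq_mul] at h2 h3
  rw [← octForm_apply]
  linear_combination Real.cos φ * h2 - Real.sin φ * h3 + Real.sin φ ^ 2 * h4 -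
    octForm k (toOct x) (selfDual (leftMul k f) a one) * Real.sin_sq_add_cos_sq φ

theorem exists_mul_mem_sect {x : Fin 7 → ℝ} (hx : formV k x x = 1) {g : GL (Fin 7) ℝ}
    (hg : g ∈ Z k x) : ∃ t ∈ T k x, t * g ∈ sect k := by
  rw [mem_Z_iff] at hg
  obtain ⟨φ, hφ⟩ := exists_annihilates_unitO (isFrame_frame hg.1.1) hg.2
  -- With θ = −φ/3 the lifted rotation takes the annihilated spinor cos φ + x sin φ to 1.
  have h1 : -(3 * (-φ / 3)) = φ := by ring
  rw [← h1, ← annihilates_rot x hx] at hφ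
  have hu : IsUnit (rot (genA k x) (2 * (-φ / 3))).det :=
    IsUnit.of_mul_eq_one _ (det_mul_self_of_formV (rot_formV hx _))
  have ht : Matrix.nonsingInvUnit _ hu ∈ T k x := (mem_T_iff hx _).2 ⟨_, rfl⟩
  exact ⟨_, ht, (mem_sect_iff _).2 ⟨mul_mem (T_le_SOV hx ht) hg.1, hφ⟩⟩

theorem mem_Z_of_mul_mem_sect {x : Fin 7 → ℝ} (hx : formV k x x = 1) {t g : GL (Fin 7) ℝ}
    (ht : t ∈ T k x) (h : t * g ∈ sect k) : g ∈ Z k x := by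
  rw [mem_sect_iff] at h
  have hg : g ∈ SOV k := by
    have := mul_mem (inv_mem (T_le_SOV hx ht)) h.1
    rwa [inv_mul_cancel_left] at this
  obtain ⟨θ, hθ⟩ := (mem_T_iff hx t).1 ht
  have h2 := h.2
  rw [Units.val_mul, hθ, annihilates_rot x hx] at h2
  exact (mem_Z_iff x g).2 ⟨hg, octInner_selfDual_of_annihilates (isFrame_frame hg.1) h2⟩

theorem Z_eq {x : Fin 7 → ℝ} (hx : formV k x x = 1) : Z k x = (T k x : Set _) * sect k := by
  ext g
  constructor
  · intro hg
    obtain ⟨t, ht, h⟩ := exists_mul_mem_sect hx hg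
    exact ⟨t⁻¹, inv_mem ht, t * g, h, by simp⟩
  · rintro ⟨t, ht, s, hs, rfl⟩
    exact mem_Z_of_mul_mem_sect hx (inv_mem ht) (by simpa using hs)

/-! ### Unit quaternions and the structure of H, H'U_τ and H'. -/

theorem quaternion_re_mul_comm (a b : ℍ[ℝ]) : (a * b).re = (b * a).re := by
  simp; ring

theorem unitary_star_mul (p : unitary ℍ[ℝ]) (z : ℍ[ℝ]) : star (p : ℍ[ℝ]) * (p * z) = z := by
  rw [← mul_assoc, Unitary.coe_star_mul_self, one_mul]

theorem unitary_mul_star_self (p : unitary ℍ[ℝ]) : (p : ℍ[ℝ]) * star (p : ℍ[ℝ]) = 1 :=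
  Unitary.mul_star_self_of_mem p.2

theorem unitary_mul_star (p : unitary ℍ[ℝ]) (z : ℍ[ℝ]) : (p : ℍ[ℝ]) * (star (p : ℍ[ℝ]) * z) = z := by
  rw [← mul_assoc, unitary_mul_star_self, one_mul]

theorem mem_unitary_of_normSq {q : ℍ[ℝ]} (h : Quaternion.normSq q = 1) : q ∈ unitary ℍ[ℝ] := by
  rw [Unitary.mem_iff, Quaternion.star_mul_self, Quaternion.self_mul_star, h]
  simp

theorem exists_unitary_smul {q : ℍ[ℝ]} (h : q ≠ 0) : ∃ c : ℝ, c ≠ 0 ∧ c • q ∈ unitary ℍ[ℝ] := by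
  have h0 : ‖q‖ ≠ 0 := norm_ne_zero_iff.2 h
  refine ⟨‖q‖⁻¹, inv_ne_zero h0, mem_unitary_of_normSq ?_⟩
  rw [Quaternion.normSq_eq_norm_mul_self, norm_smul, norm_inv, norm_norm, inv_mul_cancel₀ h0, one_mul]

/-- The normalization r of 1 + p satisfies p r̄ = r, hence r² = p r̄ r = p. Only p = −1 is excluded,
and there i is a root. -/
theorem exists_unitary_sqrt (p : unitary ℍ[ℝ]) : ∃ r : unitary ℍ[ℝ], r * r = p := by
  by_cases hp : (p : ℍ[ℝ]) = -1
  · refine ⟨⟨quat 0 1 0 0, mem_unitary_of_normSq (by simp [Quaternion.normSq_def'])⟩, Subtype.ext ?_⟩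
    rw [hp]
    ext <;> simp
  · have h0 : 1 + (p : ℍ[ℝ]) ≠ 0 := fun h => hp (eq_neg_of_add_eq_zero_right h)
    obtain ⟨c, hc, h⟩ := exists_unitary_smul h0
    refine ⟨⟨_, h⟩, Subtype.ext ?_⟩
    have h1 := Unitary.coe_star_mul_self (⟨_, h⟩ : unitary ℍ[ℝ])
    have h2 : (p : ℍ[ℝ]) * star (c • (1 + (p : ℍ[ℝ]))) = c • (1 + (p : ℍ[ℝ])) := by
      rw [Quaternion.star_smul, mul_smul_comm, star_add, star_one, mul_add, mul_one,
        unitary_mul_star_self, add_comm]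
    show c • (1 + (p : ℍ[ℝ])) * c • (1 + (p : ℍ[ℝ])) = p
    conv_lhs => enter [1]; rw [← h2]
    rw [mul_assoc]
    exact (congrArg _ h1).trans (mul_one _)

theorem toOct_ofOct_of_re {p : Oct} (h : p.1.re = 0) : toOct (ofOct p) = p := by
  have := toOct_ofOct p
  rwa [h, zero_smul, zero_add] at this

theorem re_conj (p : unitary ℍ[ℝ]) (a : ℍ[ℝ]) : ((p : ℍ[ℝ]) * a * star (p : ℍ[ℝ])).re = a.re := by
  rw [mul_assoc, quaternion_re_mul_comm, mul_assoc, Unitary.coe_star_mul_self, mul_one]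

/-- The transformation `(a, b) ↦ (p a p̄, q b r̄)` of the (split) octonions. -/
def blockL (u : unitary ℍ[ℝ] × unitary ℍ[ℝ] × unitary ℍ[ℝ]) : Oct →ₗ[ℝ] Oct where
  toFun w := ((u.1 : ℍ[ℝ]) * w.1 * star (u.1 : ℍ[ℝ]), (u.2.1 : ℍ[ℝ]) * w.2 * star (u.2.2 : ℍ[ℝ]))
  map_add' v w := by simp [mul_add, add_mul]
  map_smul' c w := by simp

theorem blockL_apply (u : unitary ℍ[ℝ] × unitary ℍ[ℝ] × unitary ℍ[ℝ]) (w : Oct) :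
    blockL u w = ((u.1 : ℍ[ℝ]) * w.1 * star (u.1 : ℍ[ℝ]),
      (u.2.1 : ℍ[ℝ]) * w.2 * star (u.2.2 : ℍ[ℝ])) := rfl

/-- The matrix of `(a, b) ↦ (p a p̄, q b r̄)`. -/
def blockMatrix (u : unitary ℍ[ℝ] × unitary ℍ[ℝ] × unitary ℍ[ℝ]) : Matrix (Fin 7) (Fin 7) ℝ :=
  LinearMap.toMatrix' (ofOctL ∘ₗ blockL u ∘ₗ toOct)

theorem toOct_blockMatrix (u : unitary ℍ[ℝ] × unitary ℍ[ℝ] × unitary ℍ[ℝ]) (v : Fin 7 → ℝ) :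
    toOct ((blockMatrix u).mulVec v) = blockL u (toOct v) := by
  rw [blockMatrix, LinearMap.toMatrix'_mulVec]
  exact toOct_ofOct_of_re ((re_conj u.1 (toOct v).1).trans rfl)

theorem matrix_ext {M N : Matrix (Fin 7) (Fin 7) ℝ}
    (h : ∀ v, toOct (M.mulVec v) = toOct (N.mulVec v)) : M = N :=
  Matrix.toLin'.injective (LinearMap.ext fun v => toOct_injective (h v))

/-- The transformations `(a, b) ↦ (p a p̄, q b r̄)` as a group homomorphism. -/
def block : unitary ℍ[ℝ] × unitary ℍ[ℝ] × unitary ℍ[ℝ] →* GL (Fin 7) ℝ :=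
  MonoidHom.toHomUnits
    { toFun := blockMatrix
      map_one' := matrix_ext fun v => by
        rw [toOct_blockMatrix, Matrix.one_mulVec, blockL_apply]; simp
      map_mul' := fun u w => matrix_ext fun v => by
        rw [← Matrix.mulVec_mulVec, toOct_blockMatrix, toOct_blockMatrix, toOct_blockMatrix]
        simp [blockL_apply, mul_assoc] }

theorem toOct_block (p q r : unitary ℍ[ℝ]) (v : Fin 7 → ℝ) :
    toOct ((block (p, q, r)).1.mulVec v) = ((p : ℍ[ℝ]) * (toOct v).1 * star (p : ℍ[ℝ]),
      (q : ℍ[ℝ]) * (toOct v).2 * star (r : ℍ[ℝ])) := toOct_blockMatrix (p, q, r) v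

theorem GL_ext {g h : GL (Fin 7) ℝ} (H : ∀ v, toOct (g.1.mulVec v) = toOct (h.1.mulVec v)) : g = h :=
  Units.ext (matrix_ext H)

theorem block_formV (u : unitary ℍ[ℝ] × unitary ℍ[ℝ] × unitary ℍ[ℝ]) (y z : Fin 7 → ℝ) :
    formV k ((block u).1.mulVec y) ((block u).1.mulVec z) = formV k y z := by
  obtain ⟨p, q, r⟩ := u
  have h (a b : ℍ[ℝ]) (p r : unitary ℍ[ℝ]) : ((p : ℍ[ℝ]) * a * star (r : ℍ[ℝ]) *
      star ((p : ℍ[ℝ]) * b * star (r : ℍ[ℝ]))).re = (a * star b).re := by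
    rw [← re_conj p (a * star b)]
    simp only [star_mul, star_star, mul_assoc, unitary_star_mul]
  rw [formV, toOct_block, toOct_block]
  exact congrArg₂ (· + k.eps * ·) (h _ _ p p) (h _ _ q r)

/-- Since unit quaternions have square roots, each of these isometries is the square of another one,
so its determinant is 1. -/
theorem block_mem_SOV (u : unitary ℍ[ℝ] × unitary ℍ[ℝ] × unitary ℍ[ℝ]) : block u ∈ SOV k := by
  refine ⟨block_formV u, ?_⟩
  obtain ⟨p, hp⟩ := exists_unitary_sqrt u.1
  obtain ⟨q, hq⟩ := exists_unitary_sqrt u.2.1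
  obtain ⟨r, hr⟩ := exists_unitary_sqrt u.2.2
  have h : u = (p, q, r) * (p, q, r) := by ext1 <;> [exact hp.symm; ext1 <;> [exact hq.symm; exact hr.symm]]
  rw [h, map_mul, Units.val_mul, Matrix.det_mul]
  exact det_mul_self_of_formV (k := k) (block_formV _)

theorem block_mem_SO3 (p : unitary ℍ[ℝ]) : block (p, 1, 1) ∈ SO3 k := by
  refine ⟨block_mem_SOV _, fun j hj => toOct_injective ?_⟩
  have h : (toOct (e j)).1 = 0 := by
    fin_cases j <;> simp at hj <;> ext <;> simp [toOct, e]
  rw [toOct_block, h]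
  ext1 <;> simp [h]

theorem block_mem_SO4 (q r : unitary ℍ[ℝ]) : block (1, q, r) ∈ SO4 k := by
  refine ⟨block_mem_SOV _, fun j hj => toOct_injective ?_⟩
  have h : (toOct (e j)).2 = 0 := by
    fin_cases j <;> simp at hj <;> ext <;> simp [toOct, e]
  rw [toOct_block, h]
  ext1 <;> simp [h]

theorem mem_quatGroup_iff (Q : Subgroup (unitary ℍ[ℝ])) (g : GL (Fin 7) ℝ) :
    g ∈ quatGroup Q ↔ ∃ p, ∃ q ∈ Q, g = block (p, q, p) := by
  constructor
  · rintro ⟨p, q, hq, h⟩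
    exact ⟨p, q, hq, GL_ext fun v => by rw [h, toOct_block]⟩
  · rintro ⟨p, q, hq, rfl⟩
    exact ⟨p, q, hq, toOct_block p q p⟩

theorem extend_block (p q r : unitary ℍ[ℝ]) (w : Oct) :
    extend (block (p, q, r)).1 w = blockL (p, q, r) w := by
  rw [extend_apply, toOct_block]
  conv_rhs => rw [← toOct_ofOct w, map_add, map_smul]
  congr 2
  ext1 <;> simp [blockL_apply, one]

theorem block_mem_G2 (p q : unitary ℍ[ℝ]) : block (p, q, p) ∈ G2 k := by
  rw [mem_G2_iff]
  intro y z
  have h : -(formV k y z) • one + toOct ((block (p, q, p)).1.mulVec (cross k y z)) =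
      extend (block (p, q, p)).1 (octMul k (toOct y) (toOct z)) := by
    rw [octMul_toOct, map_add, map_smul, extend_one_eq, extend_toOct]
  rw [h, extend_block, toOct_block, toOct_block]
  generalize toOct y = y
  generalize toOct z = z
  ext1 <;> simp [octMul, blockL_apply, mul_assoc, unitary_star_mul, mul_sub, sub_mul, mul_add, add_mul]

theorem quatGroup_le_G2 (Q : Subgroup (unitary ℍ[ℝ])) : quatGroup Q ≤ G2 k := by
  intro g hg
  obtain ⟨p, q, _, rfl⟩ := (mem_quatGroup_iff Q g).1 hg
  exact block_mem_G2 p q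

theorem block_mul (p q r p' q' r' : unitary ℍ[ℝ]) :
    block (p, q, r) * block (p', q', r') = block (p * p', q * q', r * r') := (map_mul _ _ _).symm

theorem quatGroup_le_H (Q : Subgroup (unitary ℍ[ℝ])) : quatGroup Q ≤ H k := by
  intro g hg
  obtain ⟨p, q, _, rfl⟩ := (mem_quatGroup_iff Q g).1 hg
  have := mul_mem (Subgroup.mem_sup_left (T := SO4 k) (block_mem_SO3 (k := k) p))
    (Subgroup.mem_sup_right (S := SO3 k) (block_mem_SO4 (k := k) q p))
  rwa [block_mul, mul_one, one_mul, one_mul] at this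

/-- Three quaternions that satisfy the relations of `i`, `j`, `k` are conjugate to these. -/
theorem exists_conj_quat {f g h : ℍ[ℝ]} (hf : f * f = -1) (hg : g * g = -1) (hfg : f * g = h)
    (hgf : g * f = -h) : ∃ r : unitary ℍ[ℝ], f * r = r * quat 0 1 0 0 ∧ g * r = r * quat 0 0 1 0 ∧
      h * r = r * quat 0 0 0 1 := by
  set i := quat 0 1 0 0
  set j := quat 0 0 1 0
  set l := quat 0 0 0 1
  have ii : i * i = -1 := by ext <;> simp [i]
  have jj : j * j = -1 := by ext <;> simp [j]
  have ll : l * l = -1 := by ext <;> simp [l]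
  have ij : i * j = l := by ext <;> simp [i, j, l]
  have ji : j * i = -l := by ext <;> simp [i, j, l]
  have jl : j * l = i := by ext <;> simp [i, j, l]
  have lj : l * j = -i := by ext <;> simp [i, j, l]
  have li : l * i = j := by ext <;> simp [i, j, l]
  have il : i * l = -j := by ext <;> simp [i, j, l]
  have hf' (z) : f * (f * z) = -z := by rw [← mul_assoc, hf, neg_one_mul]
  have hg' (z) : g * (g * z) = -z := by rw [← mul_assoc, hg, neg_one_mul]
  have hfg' (z) : f * (g * z) = h * z := by rw [← mul_assoc, hfg]
  have hgf' (z) : g * (f * z) = -(h * z) := by rw [← mul_assoc, hgf, neg_mul]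
  have hfh' (z) : f * (h * z) = -(g * z) := by rw [← hfg, mul_assoc, hf']
  have hgh' (z) : g * (h * z) = f * z := by
    rw [← neg_neg (h * z), ← neg_mul, ← hgf, mul_assoc, mul_neg, hg', neg_neg]
  -- Up to a factor this averages p over the two quaternion actions, which makes R p an intertwiner.
  let R (p : ℍ[ℝ]) : ℍ[ℝ] := p - f * (p * i) - g * (p * j) - h * (p * l)
  have hR1 (p) : f * R p = R p * i := by
    simp only [R, mul_sub, sub_mul, mul_assoc, hf', hfg', hfh', ii, ji, li, mul_neg, mul_one]
    abel
  have hR2 (p) : g * R p = R p * j := by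
    simp only [R, mul_sub, sub_mul, mul_assoc, hgf', hg', hgh', ij, jj, lj, mul_neg, mul_one]
    abel
  have hne : ∃ p, R p ≠ 0 := by
    by_contra! hc
    -- In this combination all terms with f, g and h cancel, so R cannot vanish at all four
    -- arguments.
    have e : R 1 - R i * i - R j * j - R l * l = 1 + 1 + 1 + 1 := by
      simp only [R, sub_mul, mul_assoc, ii, ij, il, ji, jj, jl, li, lj, ll, mul_neg, neg_mul, mul_one,
        one_mul]
      abel
    rw [hc, hc, hc, hc] at e
    have := congrArg (fun z : ℍ[ℝ] => z.re) e
    simp at this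
    norm_num at this
  obtain ⟨p, hp⟩ := hne
  obtain ⟨c, hc, hu⟩ := exists_unitary_smul hp
  have e1 : f * (c • R p) = (c • R p) * i := by rw [mul_smul_comm, hR1, smul_mul_assoc]
  have e2 : g * (c • R p) = (c • R p) * j := by rw [mul_smul_comm, hR2, smul_mul_assoc]
  refine ⟨⟨_, hu⟩, e1, e2, ?_⟩
  show h * (c • R p) = (c • R p) * l
  rw [← hfg, mul_assoc, e2, ← mul_assoc, e1, mul_assoc, ij]

theorem quat_basis (b : ℍ[ℝ]) : b = b.re • 1 + b.imI • quat 0 1 0 0 + b.imJ • quat 0 0 1 0 +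
    b.imK • quat 0 0 0 1 := by
  ext <;> simp

/-- Of three anticommuting imaginary units each is up to a sign the product of the others. -/
theorem mul_eq_or_mul_eq_neg {f g h : ℍ[ℝ]} (h1 : f.re = 0) (h2 : g.re = 0) (h3 : h.re = 0)
    (ff : f * f = -1) (gg : g * g = -1) (hhh : h * h = -1) (gf : g * f = -(f * g))
    (hhf : h * f = -(f * h)) (hhg : h * g = -(g * h)) : f * g = h ∨ f * g = -h := by
  have hn (z : ℍ[ℝ]) (hz : z.re = 0) : star z = -z := by ext <;> simp [hz]
  have sf : star f = -f := hn f h1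
  have sg : star g = -g := hn g h2
  have sh : star h = -h := hn h h3
  have e1 : h * (f * g) = f * g * h := by
    rw [← mul_assoc, hhf, neg_mul, mul_assoc, hhg, mul_neg, neg_neg, mul_assoc]
  have e2 : f * g * (f * g) = -1 := by
    rw [mul_assoc, ← mul_assoc g, gf, neg_mul, mul_assoc, gg, mul_neg_one, neg_neg, ff]
  -- As h commutes with fg, the product h(fg) is self-conjugate and therefore real; its square is 1.
  have e3 : star (h * (f * g)) = h * (f * g) := by
    rw [star_mul, star_mul, sf, sg, sh, neg_mul_neg, gf, neg_mul_neg, e1]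
  obtain ⟨c, hc⟩ : ∃ c : ℝ, h * (f * g) = (c : ℍ[ℝ]) :=
    ⟨_, Quaternion.star_eq_self.1 e3⟩
  have e4 : h = -(c * (f * g)) := by
    rw [← hc, mul_assoc, e2, mul_neg_one, neg_neg]
  have e5 : (c : ℍ[ℝ]) * c = 1 := by
    have e6 : (c : ℍ[ℝ]) * (f * g) = (f * g) * c := (Quaternion.coe_commutes c _)
    have := hhh
    rw [e4, neg_mul_neg, mul_assoc, ← mul_assoc (f * g), ← e6, mul_assoc, e2, mul_neg_one, mul_neg,
      neg_inj] at this
    exact this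
  have e7 : c * c = 1 := by simpa using congrArg (fun z : ℍ[ℝ] => z.re) e5
  rcases mul_self_eq_one_iff.1 e7 with rfl | rfl
  · right; rw [e4]; simp
  · left; rw [e4]; simp

/-- A linear isometry of the quaternions is `b ↦ q b r̄` or `b ↦ q b̄ r̄`. -/
theorem exists_quat_isometry (L : ℍ[ℝ] →ₗ[ℝ] ℍ[ℝ])
    (hL : ∀ b c, (L b * star (L c)).re = (b * star c).re) : ∃ q r : unitary ℍ[ℝ],
      (∀ b, L b = (q : ℍ[ℝ]) * b * star (r : ℍ[ℝ])) ∨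
      (∀ b, L b = (q : ℍ[ℝ]) * star b * star (r : ℍ[ℝ])) := by
  have h1 : L 1 ∈ unitary ℍ[ℝ] := mem_unitary_of_normSq (by
    rw [Quaternion.normSq_def, hL]; simp)
  set u : unitary ℍ[ℝ] := ⟨L 1, h1⟩ with hu
  have hLu : L 1 = u := rfl
  -- Dividing by L 1 gives an isometry that fixes 1 and so preserves the imaginary quaternions.
  let R (b : ℍ[ℝ]) : ℍ[ℝ] := L b * star (u : ℍ[ℝ])
  have hLR (b) : L b = R b * u := by
    simp only [R, mul_assoc, Unitary.coe_star_mul_self, mul_one]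
  have hR1 : R 1 = 1 := by simp only [R, hLu, unitary_mul_star_self]
  have hR (b c) : (R b * star (R c)).re = (b * star c).re := by
    have e1 := hL b c
    rw [hLR b, hLR c, star_mul, mul_assoc, unitary_mul_star] at e1
    exact e1
  have hRadd (b c) : R (b + c) = R b + R c := by simp only [R, map_add, add_mul]
  have hRsmul (t : ℝ) (b) : R (t • b) = t • R b := by simp only [R, map_smul, smul_mul_assoc]
  have him (b : ℍ[ℝ]) (hb : b.re = 0) : (R b).re = 0 := by
    have := hR b 1
    rw [hR1] at this
    simpa [hb] using this
  have hanti (b c : ℍ[ℝ]) (hb : b.re = 0) (hc : c.re = 0) (h : (b * star c).re = 0) :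
      R c * R b = -(R b * R c) := by
    have e1 := him b hb
    have e2 := him c hc
    have e3 := hR b c
    rw [h] at e3
    simp [e1, e2] at e3
    ext <;> simp [e1, e2] <;> linarith
  have hsq (b : ℍ[ℝ]) (hb : b.re = 0) (h : (b * star b).re = 1) : R b * R b = -1 := by
    have e1 := him b hb
    have e3 := hR b b
    rw [h] at e3
    simp [e1] at e3
    ext <;> simp [e1] <;> linarith
  set f := R (quat 0 1 0 0) with hf
  set g := R (quat 0 0 1 0) with hg
  set h := R (quat 0 0 0 1) with hh
  have ff : f * f = -1 := hsq _ (by simp) (by simp)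
  have gg : g * g = -1 := hsq _ (by simp) (by simp)
  have hhh : h * h = -1 := hsq _ (by simp) (by simp)
  have gf : g * f = -(f * g) := hanti _ _ (by simp) (by simp) (by simp)
  have hhf : h * f = -(f * h) := hanti _ _ (by simp) (by simp) (by simp)
  have hhg : h * g = -(g * h) := hanti _ _ (by simp) (by simp) (by simp)
  -- The sign is the orientation of the isometry on the imaginary quaternions; it decides between b
  -- and its conjugate.
  have key : f * g = h ∨ f * g = -h := by
    exact mul_eq_or_mul_eq_neg (him _ (by simp)) (him _ (by simp)) (him _ (by simp)) ff gg hhh gf hhf hhg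
  have fin (σ : ℝ) (r : unitary ℍ[ℝ]) (e1 : f * r = σ • (r * quat 0 1 0 0))
      (e2 : g * r = σ • (r * quat 0 0 1 0)) (e3 : h * r = σ • (r * quat 0 0 0 1)) (b : ℍ[ℝ]) :
      L b = r * (b.re • 1 + σ • (b.imI • quat 0 1 0 0 + b.imJ • quat 0 0 1 0 + b.imK • quat 0 0 0 1))
        * star ((star (u : ℍ[ℝ])) * r) := by
    have e : R b * r = r * (b.re • 1 + σ • (b.imI • quat 0 1 0 0 + b.imJ • quat 0 0 1 0 +
        b.imK • quat 0 0 0 1)) := by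
      conv_lhs => rw [quat_basis b]
      simp only [hRadd, hRsmul, hR1, ← hf, ← hg, ← hh, add_mul, smul_mul_assoc, e1, e2, e3, one_mul,
        mul_add, mul_smul_comm, mul_one]
      module
    rw [← e, star_mul, star_star, mul_assoc, unitary_mul_star, hLR]
  rcases key with key | key
  · obtain ⟨r, e1, e2, e3⟩ := exists_conj_quat ff gg key (by rw [gf, key])
    refine ⟨r, u⁻¹ * r, Or.inl fun b => ?_⟩
    have := fin 1 r (by rw [e1, one_smul]) (by rw [e2, one_smul]) (by rw [e3, one_smul]) b
    rw [this]
    conv_rhs => rw [quat_basis b]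
    rw [one_smul, ← add_assoc, ← add_assoc]
    rfl
  · obtain ⟨r, e1, e2, e3⟩ := exists_conj_quat (f := -f) (g := -g) (h := -h) (by rw [neg_mul_neg, ff])
      (by rw [neg_mul_neg, gg]) (by rw [neg_mul_neg, key]) (by rw [neg_mul_neg, gf, key])
    refine ⟨r, u⁻¹ * r, Or.inr fun b => ?_⟩
    rw [neg_mul] at e1 e2 e3
    have := fin (-1) r (by rw [← e1]; simp) (by rw [← e2]; simp) (by rw [← e3]; simp) b
    rw [this]
    have e4 : star b = b.re • 1 + (-1 : ℝ) • (b.imI • quat 0 1 0 0 + b.imJ • quat 0 0 1 0 +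
        b.imK • quat 0 0 0 1) := by ext <;> simp
    rw [e4]
    rfl

theorem mulVec_eq_self_of_e {M : Matrix (Fin 7) (Fin 7) ℝ} {v : Fin 7 → ℝ}
    (h : ∀ j, v j ≠ 0 → M.mulVec (e j) = e j) : M.mulVec v = v := by
  have h1 : v = ∑ j, v j • e j := by
    ext i; simp [Finset.sum_apply, Pi.single_apply]
  conv_lhs => rw [h1]
  conv_rhs => rw [h1]
  rw [Matrix.mulVec_sum]
  refine Finset.sum_congr rfl fun j _ => ?_
  rw [Matrix.mulVec_smul]
  by_cases hj : v j = 0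
  · rw [hj, zero_smul, zero_smul]
  · rw [h j hj]

theorem SO3_fix {s : GL (Fin 7) ℝ} (hs : s ∈ SO3 k) {v : Fin 7 → ℝ} (hv : (toOct v).1 = 0) :
    s.1.mulVec v = v := by
  refine mulVec_eq_self_of_e fun j hj => hs.2 j ?_
  have h0 : v 0 = 0 := congrArg (fun z : ℍ[ℝ] => z.imI) hv
  have h1 : v 1 = 0 := congrArg (fun z : ℍ[ℝ] => z.imJ) hv
  have h2 : v 2 = 0 := congrArg (fun z : ℍ[ℝ] => z.imK) hv
  fin_cases j <;> simp_all

theorem SO4_fix {s : GL (Fin 7) ℝ} (hs : s ∈ SO4 k) {v : Fin 7 → ℝ} (hv : (toOct v).2 = 0) :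
    s.1.mulVec v = v := by
  refine mulVec_eq_self_of_e fun j hj => hs.2 j ?_
  have h0 : v 3 = 0 := congrArg (fun z : ℍ[ℝ] => z.re) hv
  have h1 : v 4 = 0 := congrArg (fun z : ℍ[ℝ] => z.imI) hv
  have h2 : v 5 = 0 := congrArg (fun z : ℍ[ℝ] => z.imJ) hv
  have h3 : v 6 = 0 := congrArg (fun z : ℍ[ℝ] => z.imK) hv
  fin_cases j <;> simp_all

/-- The component of a vector in the first three coordinates. -/
def fstV (v : Fin 7 → ℝ) : Fin 7 → ℝ := ofOct ((toOct v).1, 0)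

/-- The component of a vector in the last four coordinates. -/
def sndV (v : Fin 7 → ℝ) : Fin 7 → ℝ := ofOct (0, (toOct v).2)

theorem toOct_fstV (v : Fin 7 → ℝ) : toOct (fstV v) = ((toOct v).1, 0) := toOct_ofOct_of_re rfl

theorem toOct_sndV (v : Fin 7 → ℝ) : toOct (sndV v) = (0, (toOct v).2) := toOct_ofOct_of_re rfl

theorem fstV_add_sndV (v : Fin 7 → ℝ) : v = fstV v + sndV v := by
  apply toOct_injective
  rw [map_add, toOct_fstV, toOct_sndV]
  ext1 <;> simp

theorem formV_fst_snd {y z : Fin 7 → ℝ} (hy : (toOct y).2 = 0) (hz : (toOct z).1 = 0) :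
    formV k y z = 0 := by
  rw [formV, octInner, hy, hz]; simp

theorem snd_eq_zero_of_formV {y : Fin 7 → ℝ} (h : ∀ z, (toOct z).1 = 0 → formV k y z = 0) :
    (toOct y).2 = 0 := by
  have h0 := k.eps_ne_zero
  have h1 (i : Fin 7) (hi : 3 ≤ i) : y i = 0 := by
    have h2 := h (e i) (by fin_cases i <;> simp at hi <;> ext <;> simp [toOct, e])
    rw [formV_eq] at h2
    fin_cases i <;> simp at hi <;> simpa [h0] using h2
  ext <;> simp [toOct, h1]

theorem fst_eq_zero_of_formV {y : Fin 7 → ℝ} (h : ∀ z, (toOct z).2 = 0 → formV k y z = 0) :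
    (toOct y).1 = 0 := by
  have h1 (i : Fin 7) (hi : i < 3) : y i = 0 := by
    have h2 := h (e i) (by fin_cases i <;> simp at hi <;> ext <;> simp [toOct, e])
    rw [formV_eq] at h2
    fin_cases i <;> simp at hi <;> simpa using h2
  ext <;> simp [toOct, h1]

theorem SO3_snd {s : GL (Fin 7) ℝ} (hs : s ∈ SO3 k) {v : Fin 7 → ℝ} (hv : (toOct v).2 = 0) :
    (toOct (s.1.mulVec v)).2 = 0 := by
  refine snd_eq_zero_of_formV (k := k) fun z hz => ?_
  rw [← SO3_fix hs hz, hs.1.1, formV_fst_snd hv hz]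

theorem SO4_fst {s : GL (Fin 7) ℝ} (hs : s ∈ SO4 k) {v : Fin 7 → ℝ} (hv : (toOct v).1 = 0) :
    (toOct (s.1.mulVec v)).1 = 0 := by
  refine fst_eq_zero_of_formV (k := k) fun z hz => ?_
  rw [← SO4_fix hs hz, hs.1.1, formV_comm, formV_fst_snd hz hv]

theorem toOct_SO3 {s : GL (Fin 7) ℝ} (hs : s ∈ SO3 k) (v : Fin 7 → ℝ) :
    toOct (s.1.mulVec v) = ((toOct (s.1.mulVec (fstV v))).1, (toOct v).2) := by
  conv_lhs => rw [fstV_add_sndV v, Matrix.mulVec_add, map_add,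
    SO3_fix hs (v := sndV v) (by rw [toOct_sndV]), toOct_sndV]
  have := SO3_snd hs (v := fstV v) (by rw [toOct_fstV])
  ext1
  · simp
  · simp [this]

theorem toOct_SO4 {s : GL (Fin 7) ℝ} (hs : s ∈ SO4 k) (v : Fin 7 → ℝ) :
    toOct (s.1.mulVec v) = ((toOct v).1, (toOct (s.1.mulVec (sndV v))).2) := by
  conv_lhs => rw [fstV_add_sndV v, Matrix.mulVec_add, map_add,
    SO4_fix hs (v := fstV v) (by rw [toOct_fstV]), toOct_fstV]
  have := SO4_fst hs (v := sndV v) (by rw [toOct_sndV])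
  ext1
  · simp [this]
  · simp

theorem SO3_SO4_comm {s t : GL (Fin 7) ℝ} (hs : s ∈ SO3 k) (ht : t ∈ SO4 k) : s * t = t * s := by
  refine GL_ext fun v => ?_
  have h1 : fstV (t.1.mulVec v) = fstV v := by
    rw [fstV, toOct_SO4 ht]; rfl
  have h2 : sndV (s.1.mulVec v) = sndV v := by
    rw [sndV, toOct_SO3 hs]; rfl
  rw [Units.val_mul, Units.val_mul, ← Matrix.mulVec_mulVec, ← Matrix.mulVec_mulVec, toOct_SO3 hs,
    toOct_SO4 ht, h1, toOct_SO4 ht (s.1.mulVec v), toOct_SO3 hs v, h2]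

theorem H_eq_mul : (H k : Set (GL (Fin 7) ℝ)) = (SO3 k : Set _) * (SO4 k : Set _) := by
  refine Subgroup.coe_mul_of_left_le_normalizer_right _ _ fun s hs => ?_
  rw [Subgroup.mem_normalizer_iff]
  intro t
  constructor
  · intro ht
    rwa [SO3_SO4_comm hs ht, mul_inv_cancel_right]
  · intro ht
    have h := SO3_SO4_comm (inv_mem hs) ht
    have h2 : t = s * t * s⁻¹ := by
      have : s⁻¹ * (s * t * s⁻¹) = s * t * s⁻¹ * s⁻¹ := h
      have h3 := congrArg (· * s) this
      simpa [mul_assoc] using h3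
    rwa [h2]

/-- The action on 0 ⊕ ℍ is one of the two kinds of quaternionic isometries. The kind that involves
b̄ has determinant −1 and is excluded. -/
theorem SO4_eq_block {g : GL (Fin 7) ℝ} (hg : g ∈ SO4 k) :
    ∃ q r : unitary ℍ[ℝ], g = block (1, q, r) := by
  let ι : ℍ[ℝ] →ₗ[ℝ] Fin 7 → ℝ := ofOctL ∘ₗ LinearMap.inr ℝ ℍ[ℝ] ℍ[ℝ]
  have hι (b : ℍ[ℝ]) : toOct (ι b) = (0, b) := toOct_ofOct_of_re (p := (0, b)) rfl
  have hs (v : Fin 7 → ℝ) : sndV v = ι (toOct v).2 := rfl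
  let L : ℍ[ℝ] →ₗ[ℝ] ℍ[ℝ] := LinearMap.snd ℝ ℍ[ℝ] ℍ[ℝ] ∘ₗ toOct ∘ₗ g.1.mulVecLin ∘ₗ ι
  have hL (b) : toOct (g.1.mulVec (ι b)) = (0, L b) := by
    ext1
    · exact SO4_fst hg (by rw [hι])
    · rfl
  have hgL (v : Fin 7 → ℝ) : toOct (g.1.mulVec v) = ((toOct v).1, L (toOct v).2) := by
    rw [toOct_SO4 hg]; rfl
  have hiso (b c) : (L b * star (L c)).re = (b * star c).re := by
    have h := hg.1.1 (ι b) (ι c)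
    rw [formV, formV, hL, hL, hι, hι] at h
    simp only [octInner, zero_mul, Quaternion.re_zero, zero_add] at h
    exact mul_left_cancel₀ k.eps_ne_zero h
  obtain ⟨q, r, h | h⟩ := exists_quat_isometry L hiso
  · refine ⟨q, r, GL_ext fun v => ?_⟩
    rw [hgL, toOct_block, h]
    simp
  · exfalso
    let D : Matrix (Fin 7) (Fin 7) ℝ := Matrix.diagonal ![1, 1, 1, 1, -1, -1, -1]
    have hD (v) : toOct (D.mulVec v) = ((toOct v).1, star (toOct v).2) := by
      ext <;> simp [D, toOct, Matrix.mulVec_diagonal]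
    have h1 : g.1 = (block (1, q, r)).1 * D := matrix_ext fun v => by
      rw [hgL, ← Matrix.mulVec_mulVec, toOct_block, h, hD]
      simp
    have h2 := congrArg Matrix.det h1
    rw [Matrix.det_mul, hg.1.2, (block_mem_SOV (k := k) _).2, Matrix.det_diagonal,
      Fin.prod_univ_seven] at h2
    simp at h2
    norm_num at h2

/-- An element b ↦ q b p̄ of SO(4) extends to the automorphism (a,b) ↦ (p a p̄, q b p̄), and the
discrepancy lies in SO(3). Hence every group between SO(3) and H is its part in G₂ times SO(3). -/
theorem H_decomp {h : GL (Fin 7) ℝ} (hh : h ∈ H k) :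
    ∃ p q : unitary ℍ[ℝ], ∃ s ∈ SO3 k, h = block (p, q, p) * s := by
  have h1 : h ∈ (SO3 k : Set (GL (Fin 7) ℝ)) * (SO4 k : Set _) := by rw [← H_eq_mul]; exact hh
  obtain ⟨s, hs, t, ht, rfl⟩ := h1
  obtain ⟨q, p, rfl⟩ := SO4_eq_block ht
  refine ⟨p, q, block (p⁻¹, 1, 1) * s, mul_mem (block_mem_SO3 _) hs, ?_⟩
  rw [← mul_assoc, block_mul, mul_inv_cancel, mul_one, mul_one]
  exact SO3_SO4_comm hs ht

theorem SO3_le_H : SO3 k ≤ H k := le_sup_left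

theorem SO3_commute_sMat {s : GL (Fin 7) ℝ} (hs : s ∈ SO3 k) (τ : Fin 3 → ℝ) :
    s.1 * sMat τ = sMat τ * s.1 := by
  refine matrix_ext fun v => ?_
  rw [← Matrix.mulVec_mulVec, ← Matrix.mulVec_mulVec, SO3_fix hs (by rw [toOct_sMat]), toOct_sMat,
    toOct_sMat, toOct_SO3 hs v]

theorem SO3_le_HU (τ : Fin 3 → ℝ) : SO3 k ≤ HU k τ :=
  fun _ hs => ⟨SO3_le_H hs, SO3_commute_sMat hs τ⟩

theorem SO3_le_Hprime : SO3 k ≤ Hprime k := le_iInf SO3_le_HU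

theorem block_commute_sMat_iff (p q r : unitary ℍ[ℝ]) (τ : Fin 3 → ℝ) :
    (block (p, q, r)).1 * sMat τ = sMat τ * (block (p, q, r)).1 ↔ q ∈ U1 τ := by
  have h (v : Fin 7 → ℝ) : toOct (((block (p, q, r)).1 * sMat τ).mulVec v) =
      toOct ((sMat τ * (block (p, q, r)).1).mulVec v) ↔
        (q : ℍ[ℝ]) * imQ τ * (toOct v).2 = imQ τ * q * (toOct v).2 := by
    rw [← Matrix.mulVec_mulVec, ← Matrix.mulVec_mulVec, toOct_block, toOct_sMat, toOct_sMat,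
      toOct_block, Prod.ext_iff]
    simp only [mul_zero, zero_mul, true_and, ← mul_assoc]
    constructor
    · intro h
      have := congrArg (· * (r : ℍ[ℝ])) h
      simpa only [mul_assoc, Unitary.coe_star_mul_self, mul_one] using this
    · intro h
      rw [h]
  constructor
  · intro h1
    have h2 := (h (e 3)).1 (by rw [h1])
    have h3 : (toOct (e 3)).2 = 1 := by ext <;> simp [toOct, e]
    rwa [h3, mul_one, mul_one] at h2
  · intro h1
    refine matrix_ext fun v => (h v).2 ?_
    rw [show (q : ℍ[ℝ]) * imQ τ = imQ τ * q from h1]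

theorem block_mem_H (p q : unitary ℍ[ℝ]) : block (p, q, p) ∈ H k :=
  quatGroup_le_H ⊤ ((mem_quatGroup_iff _ _).2 ⟨p, q, trivial, rfl⟩)

theorem G2Sp1U1_le_HU (τ : Fin 3 → ℝ) : G2Sp1U1 τ ≤ HU k τ := by
  intro g hg
  obtain ⟨p, q, hq, rfl⟩ := (mem_quatGroup_iff _ g).1 hg
  exact ⟨block_mem_H p q, (block_commute_sMat_iff p q p τ).2 hq⟩

theorem G2Sp1_le_Hprime : G2Sp1 ≤ Hprime k := by
  refine le_iInf fun τ g hg => ?_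
  obtain ⟨p, q, hq, rfl⟩ := (mem_quatGroup_iff _ g).1 hg
  rw [Subgroup.mem_bot.1 hq]
  exact ⟨block_mem_H p 1, (block_commute_sMat_iff p 1 p τ).2 (one_mem _)⟩

theorem HU_decomp {τ : Fin 3 → ℝ} {h : GL (Fin 7) ℝ} (hh : h ∈ HU k τ) :
    ∃ p, ∃ q ∈ U1 τ, ∃ s ∈ SO3 k, h = block (p, q, p) * s := by
  obtain ⟨p, q, s, hs, rfl⟩ := H_decomp hh.1
  refine ⟨p, q, (block_commute_sMat_iff p q p τ).1 ?_, s, hs, rfl⟩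
  have := mul_mem hh (inv_mem (SO3_le_HU τ hs))
  rw [mul_inv_cancel_right] at this
  exact this.2

theorem HU_le_mul (τ : Fin 3 → ℝ) :
    (HU k τ : Set (GL (Fin 7) ℝ)) ⊆ (G2Sp1U1 τ : Set _) * (SO3 k : Set _) := by
  intro h hh
  obtain ⟨p, q, hq, s, hs, rfl⟩ := HU_decomp hh
  exact ⟨_, (mem_quatGroup_iff _ _).2 ⟨p, q, hq, rfl⟩, s, hs, rfl⟩

theorem H_le_mul : (H k : Set (GL (Fin 7) ℝ)) ⊆ (G2SO4 : Set _) * (SO3 k : Set _) := by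
  intro h hh
  obtain ⟨p, q, s, hs, rfl⟩ := H_decomp hh
  exact ⟨_, (mem_quatGroup_iff _ _).2 ⟨p, q, trivial, rfl⟩, s, hs, rfl⟩

theorem eq_one_or_neg_one {z : ℍ[ℝ]} (h : z * star z = 1) (h1 : z.imI = 0) (h2 : z.imJ = 0)
    (h3 : z.imK = 0) : z = 1 ∨ z = -1 := by
  have h4 := congrArg (fun z : ℍ[ℝ] => z.re) h
  simp [h1, h2, h3] at h4
  rcases mul_self_eq_one_iff.1 h4 with h5 | h5
  · left; ext <;> simp [h1, h2, h3, h5]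
  · right; ext <;> simp [h1, h2, h3, h5]

/-- Here q commutes with every imaginary quaternion, so q = ±1; the sign is absorbed by passing from
p to −p. -/
theorem Hprime_le_mul : (Hprime k : Set (GL (Fin 7) ℝ)) ⊆ (G2Sp1 : Set _) * (SO3 k : Set _) := by
  intro h hh
  have hh' : ∀ τ, h ∈ HU k τ := Subgroup.mem_iInf.1 hh
  obtain ⟨p, q, s, hs, rfl⟩ := H_decomp (hh' 0).1
  have hq (τ : Fin 3 → ℝ) : (q : ℍ[ℝ]) * imQ τ = imQ τ * q := by
    refine (block_commute_sMat_iff p q p τ).1 ?_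
    have := mul_mem (hh' τ) (inv_mem (SO3_le_HU τ hs))
    rw [mul_inv_cancel_right] at this
    exact this.2
  have hq1 := hq ![1, 0, 0]
  have hq2 := hq ![0, 1, 0]
  have a1 := congrArg (fun z : ℍ[ℝ] => z.imJ) hq1
  have a2 := congrArg (fun z : ℍ[ℝ] => z.imK) hq1
  have a3 := congrArg (fun z : ℍ[ℝ] => z.imK) hq2
  simp [imQ] at a1 a2 a3
  have b1 : (q : ℍ[ℝ]).imK = 0 := by linarith
  have b2 : (q : ℍ[ℝ]).imJ = 0 := by linarith
  have b3 : (q : ℍ[ℝ]).imI = 0 := by linarith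
  have hc := eq_one_or_neg_one (unitary_mul_star_self q) b3 b2 b1
  rcases hc with hc | hc
  · exact ⟨_, (mem_quatGroup_iff _ _).2 ⟨p, q, Subgroup.mem_bot.2 (Subtype.ext hc), rfl⟩, s, hs, rfl⟩
  · refine ⟨_, ?_, s, hs, rfl⟩
    refine (mem_quatGroup_iff _ _).2 ⟨-p, 1, one_mem _, GL_ext fun v => ?_⟩
    rw [toOct_block, toOct_block, hc]
    simp [Unitary.coe_neg]

/-- The first three basis vectors are, up to sign, products of the last four, so an automorphism
that fixes the latter fixes everything. -/
theorem eq_one_of_mem_G2_SO3 {g : GL (Fin 7) ℝ} (h2 : g ∈ G2 k) (h3 : g ∈ SO3 k) : g = 1 := by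
  have hc (i j l : Fin 7) (hi : 3 ≤ i) (hj : 3 ≤ j) (h : cross k (e i) (e j) = k.eps • e l) :
      g.1.mulVec (e l) = e l := by
    have h1 := G2_cross h2 (e i) (e j)
    rw [h3.2 i hi, h3.2 j hj, h, Matrix.mulVec_smul] at h1
    exact (smul_right_injective _ k.eps_ne_zero h1).symm
  have hall : ∀ j, g.1.mulVec (e j) = e j := by
    intro j
    by_cases hj : 3 ≤ j
    · exact h3.2 j hj
    · have : j = 0 ∨ j = 1 ∨ j = 2 := by
        fin_cases j <;> simp at hj ⊢
      rcases this with rfl | rfl | rfl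
      · refine hc 3 4 0 (by decide) (by decide) ?_
        rw [cross_eq]; ext i; fin_cases i <;> simp
      · refine hc 3 5 1 (by decide) (by decide) ?_
        rw [cross_eq]; ext i; fin_cases i <;> simp
      · refine hc 3 6 2 (by decide) (by decide) ?_
        rw [cross_eq]; ext i; fin_cases i <;> simp
  refine GL_ext fun v => ?_
  rw [mulVec_eq_self_of_e fun j _ => hall j, Units.val_one, Matrix.one_mulVec]

/-! ### The group of order three and the irregular points. -/

/-- The exponential of `tA` as an element of the general linear group. -/
def expGL (A : Matrix (Fin 7) (Fin 7) ℝ) (t : ℝ) : GL (Fin 7) ℝ := (Matrix.isUnit_exp (t • A)).unit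

theorem expGL_val (A : Matrix (Fin 7) (Fin 7) ℝ) (t : ℝ) :
    (expGL A t).1 = NormedSpace.exp (t • A) := rfl

theorem expGL_add (A : Matrix (Fin 7) (Fin 7) ℝ) (s t : ℝ) :
    expGL A (s + t) = expGL A s * expGL A t := Units.ext (by
  rw [Units.val_mul, expGL_val, expGL_val, expGL_val, add_smul,
    Matrix.exp_add_of_commute _ _ (((Commute.refl A).smul_left s).smul_right t)])

theorem expGL_zero (A : Matrix (Fin 7) (Fin 7) ℝ) : expGL A 0 = 1 := Units.ext (by
  rw [expGL_val, zero_smul, NormedSpace.exp_zero, Units.val_one])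

theorem expGL_zsmul (A : Matrix (Fin 7) (Fin 7) ℝ) (t : ℝ) (n : ℤ) :
    expGL A (n * t) = expGL A t ^ n := by
  let f : Multiplicative ℝ →* GL (Fin 7) ℝ :=
    { toFun := fun s => expGL A s.toAdd, map_one' := expGL_zero A, map_mul' := fun s t => expGL_add A _ _ }
  have := map_zpow f (Multiplicative.ofAdd t) n
  rw [← ofAdd_zsmul, zsmul_eq_mul] at this
  exact this

theorem expGL_mem_T (x : Fin 7 → ℝ) (t : ℝ) : expGL (genA k x) t ∈ T k x := ⟨t, rfl⟩

theorem exists_expGL_of_mem_T {x : Fin 7 → ℝ} {t : GL (Fin 7) ℝ} (ht : t ∈ T k x) :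
    ∃ θ : ℝ, t = expGL (genA k x) (2 * θ) := by
  obtain ⟨s, hs⟩ := ht
  exact ⟨s / 2, Units.ext (by rw [hs, expGL_val, mul_div_cancel₀ _ two_ne_zero])⟩

theorem expGL_genA_val {x : Fin 7 → ℝ} (hx : formV k x x = 1) (t : ℝ) :
    (expGL (genA k x) t).1 = rot (genA k x) t := by
  rw [expGL_val, exp_eq_rot (genA_cube x hx)]

/-- By `annihilates_rot` at the identity, cos 3θ − x sin 3θ has to be annihilated by the standard
frame, that is, to lie in ℍ ⊕ 0. -/
theorem expGL_mem_sect_iff {x : Fin 7 → ℝ} (hx : formV k x x = 1) (θ : ℝ) :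
    expGL (genA k x) (2 * θ) ∈ sect k ↔ Real.sin (3 * θ) = 0 ∨ (toOct x).2 = 0 := by
  rw [mem_sect_iff, and_iff_right (T_le_SOV hx (expGL_mem_T x _)), expGL_genA_val hx, ← mul_one (rot _ _),
    annihilates_rot x hx, annihilates_one]
  simp [unitO, one, Real.sin_neg]

theorem spin_octMul_octMul {x : Fin 7 → ℝ} (hx : formV k x x = 1) (θ : ℝ) (y z : Fin 7 → ℝ) :
    octMul k (toOct ((rot (genA k x) (2 * θ)).mulVec y)) (toOct ((rot (genA k x) (2 * θ)).mulVec z)) =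
      spin k x θ (octMul k (toOct y) (octMul k (toOct z) (unitO x (-(3 * θ))))) := by
  rw [spin_octMul x hx, spin_octMul x hx, spin_unitO x hx, octMul_one]

theorem extend_rot {x : Fin 7 → ℝ} (hx : formV k x x = 1) (θ : ℝ) (p : Oct) :
    extend (rot (genA k x) (2 * θ)) p = spin k x θ (octMul k p (unitO x (-(3 * θ)))) := by
  conv_rhs => rw [← toOct_ofOct p]
  rw [extend_apply, add_octMul, smul_octMul, one_octMul, spin_add, spin_smul, spin_unitO x hx,
    spin_octMul x hx, spin_unitO x hx, octMul_one]
  rfl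

/-- No nonzero imaginary element associates with everything. The associators with three pairs of
basis vectors already detect all coordinates of x. -/
theorem exists_associator_ne_zero {x : Fin 7 → ℝ} (hx : x ≠ 0) : ∃ y z : Fin 7 → ℝ,
    octMul k (toOct y) (octMul k (toOct z) (toOct x)) ≠
      octMul k (octMul k (toOct y) (toOct z)) (toOct x) := by
  by_contra! h
  have he (j : Fin 7) : toOct (e j) =
      oct8 0 (e j 0) (e j 1) (e j 2) (e j 3) (e j 4) (e j 5) (e j 6) := rfl
  have hx' : toOct x = oct8 0 (x 0) (x 1) (x 2) (x 3) (x 4) (x 5) (x 6) := rfl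
  have h1 := h (e 0) (e 1)
  have h2 := h (e 3) (e 0)
  have h3 := h (e 3) (e 1)
  rw [he, he, hx'] at h1 h2 h3
  simp only [octMul_oct8] at h1 h2 h3
  apply hx
  cases k <;> simp [oct8, Kind.eps, Prod.ext_iff, Quaternion.ext_iff] at h1 h2 h3 <;> ext i <;>
    fin_cases i <;> simp <;> linarith

/-- After the injective lift is cancelled, the automorphism property reads y(zw) = (yz)w with w =
cos 3θ − x sin 3θ. The defect is, up to sign, sin 3θ times the associator of y, z and x. -/
theorem expGL_mem_G2_iff {x : Fin 7 → ℝ} (hx : formV k x x = 1) (θ : ℝ) :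
    expGL (genA k x) (2 * θ) ∈ G2 k ↔ Real.sin (3 * θ) = 0 := by
  rw [mem_G2_iff, expGL_genA_val hx]
  have h0 (y z : Fin 7 → ℝ) : -(formV k y z) • one +
      toOct ((rot (genA k x) (2 * θ)).mulVec (cross k y z)) =
        spin k x θ (octMul k (octMul k (toOct y) (toOct z)) (unitO x (-(3 * θ)))) := by
    rw [← extend_rot hx, octMul_toOct, map_add, map_smul, extend_one_eq, extend_toOct]
  simp only [h0, spin_octMul_octMul hx, (spin_injective x hx θ).eq_iff]
  simp only [unitO, octMul_add, octMul_smul, octMul_one, Real.sin_neg, add_right_inj, neg_smul,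
    octMul_neg, neg_inj]
  constructor
  · intro h
    have hx0 : x ≠ 0 := by
      rintro rfl
      simp [formV_eq] at hx
    obtain ⟨y, z, hyz⟩ := exists_associator_ne_zero (k := k) hx0
    by_contra hs
    exact hyz (smul_right_injective _ hs (h y z))
  · intro h y z
    rw [h, zero_smul, zero_smul]

theorem genA_ne_zero {x : Fin 7 → ℝ} (hx : formV k x x = 1) : genA k x ≠ 0 := by
  intro h
  have h1 (y : Fin 7 → ℝ) : y = formV k x y • x := by
    have h2 := genA_sq x y hx
    rw [← genA_mulVec, h, Matrix.zero_mulVec] at h2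
    exact neg_add_eq_zero.1 h2.symm
  have h2 := h1 (e 0)
  have h3 := h1 (e 1)
  have a := congrFun h2 0
  have b := congrFun h2 1
  have c := congrFun h3 0
  have d := congrFun h3 1
  simp at a b c d
  rcases b with b | b
  · simp [b] at a
  · simp [b] at d

theorem expGL_two_pi {x : Fin 7 → ℝ} (hx : formV k x x = 1) :
    expGL (genA k x) (2 * Real.pi) = 1 := Units.ext (by
  rw [expGL_genA_val hx, rot]; simp)

theorem Z3_eq_zpowers {x : Fin 7 → ℝ} (hx : formV k x x = 1) :
    Z3 k x = Subgroup.zpowers (expGL (genA k x) (2 * (Real.pi / 3))) := by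
  ext t
  constructor
  · rintro ⟨ht, h⟩
    obtain ⟨θ, rfl⟩ := exists_expGL_of_mem_T ht
    obtain ⟨n, hn⟩ := Real.sin_eq_zero_iff.1 ((expGL_mem_G2_iff hx θ).1 h)
    refine ⟨n, ?_⟩
    show expGL _ _ ^ n = _
    rw [← expGL_zsmul]
    congr 1
    linarith
  · intro ht
    refine (Subgroup.zpowers_le.2 ?_) ht
    refine ⟨expGL_mem_T x _, (expGL_mem_G2_iff hx _).2 ?_⟩
    rw [mul_div_cancel₀ _ three_ne_zero, Real.sin_pi]

theorem card_Z3 {x : Fin 7 → ℝ} (hx : formV k x x = 1) : Nat.card (Z3 k x) = 3 := by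
  rw [Z3_eq_zpowers hx, Nat.card_zpowers]
  have : Fact (Nat.Prime 3) := ⟨Nat.prime_three⟩
  apply orderOf_eq_prime
  · rw [← zpow_natCast, ← expGL_zsmul, ← expGL_two_pi hx]
    congr 1
    push_cast
    ring
  · intro h
    have h1 := congrArg Units.val h
    rw [expGL_genA_val hx, Units.val_one, rot] at h1
    set s := Real.sin (2 * (Real.pi / 3)) with hs
    set c := Real.cos (2 * (Real.pi / 3)) with hc
    set A := genA k x with hA
    have h2 : s • A + (1 - c) • (A * A) = 0 := by
      rw [add_assoc] at h1
      exact add_eq_left.1 h1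
    have h3 : s • (A * A) - (1 - c) • A = 0 := by
      have := congrArg (· * A) h2
      simp only [add_mul, smul_mul_assoc, zero_mul] at this
      have hA3 : A * A * A = -A := genA_cube x hx
      rw [hA3] at this
      rw [← this]; module
    -- A² is eliminated from the relation and its multiple by A.
    have h4 : (s ^ 2 + (1 - c) ^ 2) • A = 0 := by
      linear_combination (norm := module) s • h2 - (1 - c) • h3
    have h5 := (smul_eq_zero.1 h4).resolve_right (genA_ne_zero hx)
    have h6 : 1 - c = 0 := by nlinarith [sq_nonneg s, sq_nonneg (1 - c)]
    have h7 : c < 1 := by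
      rw [hc, ← Real.cos_zero]
      exact Real.cos_lt_cos_of_nonneg_of_le_pi le_rfl (by linarith [Real.pi_pos]) (by linarith [Real.pi_pos])
    linarith

theorem isCyclic_Z3 {x : Fin 7 → ℝ} (hx : formV k x x = 1) : IsCyclic (Z3 k x) := by
  have : Fact (Nat.Prime 3) := ⟨Nat.prime_three⟩
  exact isCyclic_of_prime_card (card_Z3 hx)

theorem H_snd {h : GL (Fin 7) ℝ} (hh : h ∈ H k) {v : Fin 7 → ℝ} (hv : (toOct v).2 = 0) :
    (toOct (h.1.mulVec v)).2 = 0 := by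
  obtain ⟨p, q, s, hs, rfl⟩ := H_decomp hh
  rw [Units.val_mul, ← Matrix.mulVec_mulVec, toOct_block, SO3_snd hs hv]
  simp

theorem Hprime_le_HU (τ : Fin 3 → ℝ) : Hprime k ≤ HU k τ := iInf_le _ _

theorem Hprime_le_H : Hprime k ≤ H k := fun _ h => (Hprime_le_HU 0 h).1

/-- The rotations by ±π/2 are 1 ± A + A², so their difference shows that A_x also preserves ℍ ⊕ 0 at
the first basis vector. The last four coordinates of the product of x with that vector are, up to
sign and order, those of x. -/
theorem snd_eq_zero_of_T_le {x : Fin 7 → ℝ} (hx : formV k x x = 1) (h : T k x ≤ H k) :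
    (toOct x).2 = 0 := by
  have h0 : (toOct (e 0)).2 = 0 := by ext <;> simp [toOct, e]
  have h1 := H_snd (h (expGL_mem_T x (Real.pi / 2))) h0
  have h2 := H_snd (h (expGL_mem_T x (-(Real.pi / 2)))) h0
  rw [expGL_genA_val hx, rot] at h1 h2
  simp only [Real.sin_neg, Real.cos_neg, Real.sin_pi_div_two, Matrix.add_mulVec, Matrix.smul_mulVec,
    map_add, map_smul, Prod.snd_add, Prod.smul_snd] at h1 h2
  have h3 : (toOct ((genA k x).mulVec (e 0))).2 = 0 := by
    have : (2 : ℝ) • (toOct ((genA k x).mulVec (e 0))).2 = 0 := by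
      linear_combination (norm := module) h1 - h2
    exact (smul_eq_zero.1 this).resolve_left two_ne_zero
  rw [genA_mulVec, cross_eq] at h3
  have a0 := congrArg (fun z : ℍ[ℝ] => z.re) h3
  have a1 := congrArg (fun z : ℍ[ℝ] => z.imI) h3
  have a2 := congrArg (fun z : ℍ[ℝ] => z.imJ) h3
  have a3 := congrArg (fun z : ℍ[ℝ] => z.imK) h3
  simp [toOct] at a0 a1 a2 a3
  ext <;> simp [toOct, *]

theorem block_one_mem_Hprime (p r : unitary ℍ[ℝ]) : block (p, 1, r) ∈ Hprime k := by
  have h1 : block (r, 1, r) ∈ Hprime k :=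
    G2Sp1_le_Hprime ((mem_quatGroup_iff _ _).2 ⟨r, 1, one_mem _, rfl⟩)
  have h2 := mul_mem h1 (SO3_le_Hprime (block_mem_SO3 (k := k) (r⁻¹ * p)))
  rwa [block_mul, mul_inv_cancel_left, mul_one, mul_one] at h2

/-- If x is an imaginary quaternion then u = (v,0), and y ↦ uyū becomes (a,b) ↦ (v a v̄, b v²). The
second component is multiplied only from the right, so this commutes with 𝔰. -/
theorem T_le_Hprime {x : Fin 7 → ℝ} (hx : formV k x x = 1) (h : (toOct x).2 = 0) :
    T k x ≤ Hprime k := by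
  intro t ht
  obtain ⟨θ, rfl⟩ := exists_expGL_of_mem_T ht
  have hu : unitO x θ = ((unitO x θ).1, 0) := by
    ext1
    · rfl
    · simp [unitO, h, one]
  have hu' : unitO x (-θ) = (star (unitO x θ).1, 0) := by
    rw [← conj_unitO, conj, hu]; simp
  have hv : (unitO x θ).1 ∈ unitary ℍ[ℝ] := mem_unitary_of_normSq (by
    have := octInner_unitO x hx θ
    rw [hu, octInner] at this
    simpa [Quaternion.normSq_def] using this)
  set v : unitary ℍ[ℝ] := ⟨(unitO x θ).1, hv⟩ with hvdef
  have hvv : (unitO x θ).1 = (v : ℍ[ℝ]) := rfl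
  have : expGL (genA k x) (2 * θ) = block (v, 1, (v * v)⁻¹) := by
    refine GL_ext fun y => ?_
    rw [expGL_genA_val hx, toOct_rot x y hx, toOct_block, hu', hu, hvv]
    have e1 : star (((v * v)⁻¹ : unitary ℍ[ℝ]) : ℍ[ℝ]) = (v : ℍ[ℝ]) * v := by
      show star (star ((v : ℍ[ℝ]) * v)) = _
      rw [star_star]
    rw [e1]
    ext1 <;> simp [octMul, mul_assoc]
  rw [this]
  exact block_one_mem_Hprime v _

theorem sect_mul_iff {a s m : GL (Fin 7) ℝ} (ha : a ∈ G2 k) (hs : s ∈ SO3 k) :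
    a * m * s ∈ sect k ↔ m ∈ sect k := by
  have key {a s m : GL (Fin 7) ℝ} (ha : a ∈ G2 k) (hs : s ∈ SO3 k) (h : m ∈ sect k) :
      a * m * s ∈ sect k := by
    obtain ⟨b, hb, r, hr, rfl⟩ := h
    exact ⟨a * b, mul_mem ha hb, r * s, mul_mem hr hs, by simp only [mul_assoc]⟩
  refine ⟨fun h => ?_, key ha hs⟩
  have := key (inv_mem ha) (inv_mem hs) h
  simpa [mul_assoc] using this

theorem G2_conj_T' {a : GL (Fin 7) ℝ} (ha : a ∈ G2 k) {x : Fin 7 → ℝ} (hx : formV k x x = 1)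
    {t : GL (Fin 7) ℝ} (ht : t ∈ T k x) : a⁻¹ * t * a ∈ T k ((a⁻¹).1.mulVec x) := by
  have := G2_conj_T (inv_mem ha) hx ht
  rwa [inv_inv] at this

/-- Conjugation by the automorphism a turns T_x into the group of a⁻¹x, and s lies in H', so the
question is reduced to the identity. -/
theorem irregular_iff {a s : GL (Fin 7) ℝ} (ha : a ∈ G2 k) (hs : s ∈ SO3 k) {x : Fin 7 → ℝ}
    (hx : formV k x x = 1) : Irregular k x (a * s) ↔ (toOct ((a⁻¹).1.mulVec x)).2 = 0 := by
  have hx' : formV k ((a⁻¹).1.mulVec x) ((a⁻¹).1.mulVec x) = 1 := by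
    rw [G2_formV (inv_mem ha), hx]
  have hsH := SO3_le_Hprime hs
  constructor
  · intro h
    refine snd_eq_zero_of_T_le hx' fun t ht => Hprime_le_H ?_
    have h1 := G2_conj_T ha hx' ht
    rw [Matrix.mulVec_mulVec, ← Units.val_mul, mul_inv_cancel, Units.val_one, Matrix.one_mulVec] at h1
    have h2 := mul_mem (mul_mem hsH (h _ h1)) (inv_mem hsH)
    simpa [mul_assoc] using h2
  · intro h t ht
    have h1 := T_le_Hprime hx' h (G2_conj_T' ha hx ht)
    have h2 := mul_mem (mul_mem (inv_mem hsH) h1) hsH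
    simpa [mul_assoc] using h2

/-- After conjugation by the G₂-factor of g the two alternatives are those of `expGL_mem_sect_iff`:
sin 3θ = 0 means that t is an automorphism, and a⁻¹x in ℍ ⊕ 0 means that g is irregular. -/
theorem mul_mem_sect_iff {x : Fin 7 → ℝ} (hx : formV k x x = 1) {g t : GL (Fin 7) ℝ}
    (hg : g ∈ sect k) (ht : t ∈ T k x) : t * g ∈ sect k ↔ t ∈ Z3 k x ∨ Irregular k x g := by
  obtain ⟨a, ha, s, hs, rfl⟩ := hg
  have hx' : formV k ((a⁻¹).1.mulVec x) ((a⁻¹).1.mulVec x) = 1 := by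
    rw [G2_formV (inv_mem ha), hx]
  have e1 : t * (a * s) = a * (a⁻¹ * t * a) * s := by group
  have e2 : t ∈ Z3 k x ↔ a⁻¹ * t * a ∈ G2 k := by
    constructor
    · intro h
      exact mul_mem (mul_mem (inv_mem ha) h.2) ha
    · intro h
      refine ⟨ht, ?_⟩
      have := mul_mem (mul_mem ha h) (inv_mem ha)
      simpa [mul_assoc] using this
  obtain ⟨θ, hθ⟩ := exists_expGL_of_mem_T (G2_conj_T' ha hx ht)
  show t * (a * s) ∈ _ ↔ _ ∨ Irregular k x (a * s)
  rw [e1, sect_mul_iff ha hs, e2, irregular_iff ha hs hx, hθ, expGL_mem_sect_iff hx',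
    expGL_mem_G2_iff hx']

/-! ### Maps between double coset spaces. -/

section DoubleCosets

variable {L L' K K' : Subgroup (GL (Fin 7) ℝ)} {X X' S : Set (GL (Fin 7) ℝ)}

/-- The map of double coset spaces induced by an inclusion. -/
def DC.map (hL : L ≤ L') (hK : K ≤ K') (hX : X ⊆ X') : DC L X K → DC L' X' K' :=
  Quotient.map (Set.inclusion hX) (by
    rintro a b ⟨l, hl, h, hh, e⟩
    exact ⟨l, hL hl, h, hK hh, e⟩)

theorem DC.isInduced_map (hL : L ≤ L') (hK : K ≤ K') (hX : X ⊆ X') :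
    IsInduced (DC.map hL hK hX) := fun _ hg => ⟨hX hg, rfl⟩

theorem DC.mk_eq_mk {g g' : GL (Fin 7) ℝ} (hg : g ∈ X) (hg' : g' ∈ X) :
    DC.mk L K hg = DC.mk L K hg' ↔ ∃ l ∈ L, ∃ h ∈ K, g' = l * g * h := Quotient.eq

theorem DC.ind_mk {p : DC L X K → Prop} (h : ∀ g, ∀ hg : g ∈ X, p (DC.mk L K hg)) (c) : p c :=
  Quotient.ind (fun a => h a.1 a.2) c

theorem DC.isClosed_iff {C : Set (DC L X K)} :
    IsClosed C ↔ IsClosed {z : X | DC.mk L K z.2 ∈ C} := isQuotientMap_quotient_mk'.isClosed_preimage.symm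

theorem DC.continuous_map (hL : L ≤ L') (hK : K ≤ K') (hX : X ⊆ X') :
    Continuous (DC.map hL hK hX) :=
  Continuous.quotient_map' (continuous_inclusion hX) _

/-- The saturation of a closed set under compact groups is closed. As X is cut out of X' by a closed
set S, closed sets downstairs can be tested on X. -/
theorem DC.isQuotientMap_map (hL : L ≤ L') (hK : K ≤ K') (hX : X ⊆ X') (hS : IsClosed S)
    (hXS : X = S ∩ X') (hL' : IsCompact (L' : Set (GL (Fin 7) ℝ)))
    (hK' : IsCompact (K' : Set (GL (Fin 7) ℝ)))
    (hsat : ∀ l ∈ L', ∀ g ∈ X', ∀ h ∈ K', l * g * h ∈ X')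
    (hsurj : ∀ g ∈ X', ∃ l ∈ L', ∃ a ∈ X, ∃ h ∈ K', g = l * a * h) :
    Topology.IsQuotientMap (DC.map hL hK hX) := by
  have hcont := DC.continuous_map hL hK hX
  refine Topology.isQuotientMap_iff_isClosed.2 ⟨DC.ind_mk fun g hg => ?_, fun C =>
    ⟨fun h => h.preimage hcont, fun h => ?_⟩⟩
  · obtain ⟨l, hl, a, ha, h, hh, e⟩ := hsurj g hg
    exact ⟨DC.mk L K ha, (DC.mk_eq_mk _ _).2 ⟨l, hl, h, hh, e⟩⟩
  · rw [DC.isClosed_iff] at h ⊢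
    obtain ⟨D, hD, hDX⟩ := isClosed_induced_iff.1 h
    have hmem (g) (hg : g ∈ X) : g ∈ D ↔ DC.mk L' K' (hX hg) ∈ C :=
       Set.ext_iff.1 hDX ⟨g, hg⟩
    -- D is only closed with the right trace on X; intersecting with S keeps the points of X' in
    -- this product within the saturation of X.
    refine isClosed_induced_iff.2 ⟨(L' : Set (GL (Fin 7) ℝ)) * (D ∩ S) * (K' : Set (GL (Fin 7) ℝ)),
      ((hD.inter hS).mul_left_of_isCompact hL').mul_right_of_isCompact hK', ?_⟩
    ext ⟨z, hz⟩
    constructor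
    · rintro ⟨_, ⟨l, hl, d, ⟨hd, hdS⟩, rfl⟩, h, hh, e⟩
      have e1 : z = l * d * h := e.symm
      have hdX' : d ∈ X' := by
        have := hsat _ (inv_mem hl) z hz _ (inv_mem hh)
        rwa [e1, show l⁻¹ * (l * d * h) * h⁻¹ = d by group] at this
      have hdX : d ∈ X := by rw [hXS]; exact ⟨hdS, hdX'⟩
      have h1 : DC.mk L' K' hdX' = DC.mk L' K' hz := (DC.mk_eq_mk _ _).2 ⟨l, hl, h, hh, e1⟩
      show DC.mk L' K' hz ∈ C
      rw [← h1]
      exact (hmem d hdX).1 hd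
    · intro hz'
      obtain ⟨l, hl, a, ha, h, hh, e⟩ := hsurj z hz
      have h1 : DC.mk L' K' (hX ha) = DC.mk L' K' hz := (DC.mk_eq_mk _ _).2 ⟨l, hl, h, hh, e⟩
      have haS : a ∈ S := by rw [hXS] at ha; exact ha.1
      refine ⟨l * a, ⟨l, hl, a, ⟨(hmem a ha).2 ?_, haS⟩, rfl⟩, h, hh, e.symm⟩
      rw [h1]
      exact hz'

/-- An injective quotient map is a homeomorphism. By `hinj`, points of X in a common double coset of
the large groups already share one of the small groups. -/
theorem DC.exists_homeomorph (hL : L ≤ L') (hK : K ≤ K') (hX : X ⊆ X') (hS : IsClosed S)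
    (hXS : X = S ∩ X') (hL' : IsCompact (L' : Set (GL (Fin 7) ℝ)))
    (hK' : IsCompact (K' : Set (GL (Fin 7) ℝ)))
    (hsat : ∀ l ∈ L', ∀ g ∈ X', ∀ h ∈ K', l * g * h ∈ X')
    (hsurj : ∀ g ∈ X', ∃ l ∈ L', ∃ a ∈ X, ∃ h ∈ K', g = l * a * h)
    (hinj : ∀ g ∈ X, ∀ l ∈ L', ∀ h ∈ K', l * g * h ∈ X → ∃ l' ∈ L, ∃ h' ∈ K,
      l * g * h = l' * g * h') :
    ∃ f : DC L X K ≃ₜ DC L' X' K', IsInduced f := by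
  have hq := DC.isQuotientMap_map hL hK hX hS hXS hL' hK' hsat hsurj
  have hi : Function.Injective (DC.map hL hK hX) := by
    intro a b
    induction a using DC.ind_mk with | h g hg
    induction b using DC.ind_mk with | h g' hg'
    intro hab
    obtain ⟨l, hl, h, hh, rfl⟩ := (DC.mk_eq_mk _ _).1 hab
    exact (DC.mk_eq_mk _ _).2 (hinj g hg l hl h hh hg')
  refine ⟨(Equiv.ofBijective _ ⟨hi, hq.surjective⟩).toHomeomorph fun s => ?_, DC.isInduced_map hL hK hX⟩
  exact hq.isOpen_preimage

end DoubleCosets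

/-! ### Closed and compact groups. -/

section Compactness

theorem continuous_mulVec (y : Fin 7 → ℝ) : Continuous fun g : GL (Fin 7) ℝ => g.1.mulVec y :=
  Units.continuous_val.matrix_mulVec continuous_const

theorem isClosed_SOV : IsClosed (SOV k : Set (GL (Fin 7) ℝ)) := by
  have hv : Continuous fun g : GL (Fin 7) ℝ => g.1 := Units.continuous_val
  have : (SOV k : Set (GL (Fin 7) ℝ)) = (⋂ y, ⋂ z, {g : GL (Fin 7) ℝ |
      formV k (g.1.mulVec y) (g.1.mulVec z) = formV k y z}) ∩ {g : GL (Fin 7) ℝ | g.1.det = 1} := by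
    ext g
    simp only [Set.mem_inter_iff, Set.mem_iInter]
    rfl
  rw [this]
  refine (isClosed_iInter fun y => isClosed_iInter fun z => isClosed_eq ?_ continuous_const).inter
    (isClosed_eq hv.matrix_det continuous_const)
  simp only [formV_eq]
  have := continuous_mulVec y
  have := continuous_mulVec z
  fun_prop

theorem continuous_toOct : Continuous toOct := toOct.continuous_of_finiteDimensional

theorem continuous_octMul : Continuous fun p : Oct × Oct => octMul k p.1 p.2 := by
  unfold octMul
  fun_prop

theorem isClosed_SO3 : IsClosed (SO3 k : Set (GL (Fin 7) ℝ)) := by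
  have : (SO3 k : Set (GL (Fin 7) ℝ)) = (SOV k : Set (GL (Fin 7) ℝ)) ∩
      ⋂ j : Fin 7, ⋂ _ : 3 ≤ j, {g : GL (Fin 7) ℝ | g.1.mulVec (e j) = e j} := by
    ext g
    simp only [Set.mem_inter_iff, Set.mem_iInter]
    rfl
  rw [this]
  exact isClosed_SOV.inter (isClosed_iInter fun j => isClosed_iInter fun _ =>
    isClosed_eq (continuous_mulVec _) continuous_const)

theorem isClosed_SO4 : IsClosed (SO4 k : Set (GL (Fin 7) ℝ)) := by
  have : (SO4 k : Set (GL (Fin 7) ℝ)) = (SOV k : Set (GL (Fin 7) ℝ)) ∩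
      ⋂ j : Fin 7, ⋂ _ : j < 3, {g : GL (Fin 7) ℝ | g.1.mulVec (e j) = e j} := by
    ext g
    simp only [Set.mem_inter_iff, Set.mem_iInter]
    rfl
  rw [this]
  exact isClosed_SOV.inter (isClosed_iInter fun j => isClosed_iInter fun _ =>
    isClosed_eq (continuous_mulVec _) continuous_const)

/-- A closed subgroup of bounded matrices is compact. -/
theorem isCompact_of_entries_le {M : Subgroup (GL (Fin 7) ℝ)} (hM : IsClosed (M : Set (GL (Fin 7) ℝ)))
    (h : ∀ g ∈ M, ∀ i j, |g.1 i j| ≤ 1) : IsCompact (M : Set (GL (Fin 7) ℝ)) := by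
  let B : Set (Matrix (Fin 7) (Fin 7) ℝ) := Set.univ.pi fun _ => Set.univ.pi fun _ => Set.Icc (-1) 1
  have hB : IsCompact B := isCompact_univ_pi fun _ => isCompact_univ_pi fun _ => isCompact_Icc
  -- The topology of the units records g and g⁻¹; as M is a group, the bound holds for both.
  have hB' : IsCompact (B ×ˢ (MulOpposite.op '' B)) :=
    hB.prod (hB.image MulOpposite.continuous_op)
  refine (Units.isClosedEmbedding_embedProduct.isCompact_preimage hB').of_isClosed_subset hM ?_
  intro g hg
  exact ⟨fun i _ j _ => abs_le.1 (h g hg i j), _, fun i _ j _ => abs_le.1 (h _ (inv_mem hg) i j), rfl⟩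

/-- SO(3) preserves the span of the first three basis vectors, on which the form is definite in both
signatures, so the columns are bounded. -/
theorem isCompact_SO3 : IsCompact (SO3 k : Set (GL (Fin 7) ℝ)) := by
  refine isCompact_of_entries_le isClosed_SO3 fun g hg i j => ?_
  have h1 : g.1 i j = g.1.mulVec (e j) i := by simp
  rw [h1]
  by_cases hj : 3 ≤ j
  · rw [hg.2 j hj]
    by_cases hij : i = j <;> simp [e, hij]
  · have h2 : (toOct (e j)).2 = 0 := by fin_cases j <;> simp at hj <;> ext <;> simp [toOct, e]
    have h3 := SO3_snd hg h2
    have a0 : g.1.mulVec (e j) 3 = 0 := congrArg (fun z : ℍ[ℝ] => z.re) h3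
    have a1 : g.1.mulVec (e j) 4 = 0 := congrArg (fun z : ℍ[ℝ] => z.imI) h3
    have a2 : g.1.mulVec (e j) 5 = 0 := congrArg (fun z : ℍ[ℝ] => z.imJ) h3
    have a3 : g.1.mulVec (e j) 6 = 0 := congrArg (fun z : ℍ[ℝ] => z.imK) h3
    have h4 := hg.1.1 (e j) (e j)
    have h5 : formV k (e j) (e j) = 1 := by fin_cases j <;> simp at hj <;> simp [formV_eq, e]
    rw [h5, formV_eq, a0, a1, a2, a3] at h4
    generalize g.1.mulVec (e j) = v at *
    rw [abs_le_one_iff_mul_self_le_one]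
    fin_cases i <;> simp [a0, a1, a2, a3] <;>
      nlinarith [mul_self_nonneg (v 0), mul_self_nonneg (v 1), mul_self_nonneg (v 2)]

theorem isCompact_SO4 : IsCompact (SO4 k : Set (GL (Fin 7) ℝ)) := by
  refine isCompact_of_entries_le isClosed_SO4 fun g hg i j => ?_
  have h1 : g.1 i j = g.1.mulVec (e j) i := by simp
  rw [h1]
  by_cases hj : j < 3
  · rw [hg.2 j hj]
    by_cases hij : i = j <;> simp [e, hij]
  · have h2 : (toOct (e j)).1 = 0 := by fin_cases j <;> simp at hj <;> ext <;> simp [toOct, e]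
    have h3 := SO4_fst hg h2
    have a0 : g.1.mulVec (e j) 0 = 0 := congrArg (fun z : ℍ[ℝ] => z.imI) h3
    have a1 : g.1.mulVec (e j) 1 = 0 := congrArg (fun z : ℍ[ℝ] => z.imJ) h3
    have a2 : g.1.mulVec (e j) 2 = 0 := congrArg (fun z : ℍ[ℝ] => z.imK) h3
    have h4 := hg.1.1 (e j) (e j)
    have h5 : formV k (e j) (e j) = k.eps := by fin_cases j <;> simp at hj <;> simp [formV_eq, e]
    rw [h5, formV_eq, a0, a1, a2] at h4
    have h6 := k.eps_ne_zero
    generalize g.1.mulVec (e j) = v at *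
    have h7 : v 3 * v 3 + v 4 * v 4 + v 5 * v 5 + v 6 * v 6 = 1 := by
      apply mul_left_cancel₀ h6
      linarith
    rw [abs_le_one_iff_mul_self_le_one]
    fin_cases i <;> simp [a0, a1, a2] <;>
      nlinarith [mul_self_nonneg (v 3), mul_self_nonneg (v 4), mul_self_nonneg (v 5), mul_self_nonneg (v 6)]

theorem isCompact_H : IsCompact (H k : Set (GL (Fin 7) ℝ)) := by
  rw [H_eq_mul]
  exact isCompact_SO3.mul isCompact_SO4

theorem isCompact_HU (τ : Fin 3 → ℝ) : IsCompact (HU k τ : Set (GL (Fin 7) ℝ)) := by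
  have : (HU k τ : Set (GL (Fin 7) ℝ)) =
      (H k : Set (GL (Fin 7) ℝ)) ∩ {g : GL (Fin 7) ℝ | g.1 * sMat τ = sMat τ * g.1} := rfl
  rw [this]
  refine isCompact_H.inter_right (isClosed_eq ?_ ?_)
  · exact Units.continuous_val.mul continuous_const
  · exact continuous_const.mul Units.continuous_val

theorem isCompact_Hprime : IsCompact (Hprime k : Set (GL (Fin 7) ℝ)) := by
  refine (isCompact_HU 0).of_isClosed_subset ?_ (Hprime_le_HU 0)
  rw [Hprime, Subgroup.coe_iInf]
  exact isClosed_iInter fun τ => (isCompact_HU τ).isClosed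

theorem expGL_inv (A : Matrix (Fin 7) (Fin 7) ℝ) (t : ℝ) : (expGL A t)⁻¹ = expGL A (-t) := by
  rw [inv_eq_iff_mul_eq_one, ← expGL_add, add_neg_cancel, expGL_zero]

theorem continuous_expGL {x : Fin 7 → ℝ} (hx : formV k x x = 1) : Continuous (expGL (genA k x)) := by
  rw [Units.continuous_iff]
  have h : Continuous fun t => rot (genA k x) t := by
    unfold rot
    fun_prop
  constructor
  · convert h using 2 with t
    exact expGL_genA_val hx t
  · convert h.comp continuous_neg using 2 with t
    rw [expGL_inv]
    exact expGL_genA_val hx (-t)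

/-- T_x is the image of one period [0, 2π]. -/
theorem isCompact_T {x : Fin 7 → ℝ} (hx : formV k x x = 1) : IsCompact (T k x : Set (GL (Fin 7) ℝ)) := by
  have hper : Function.Periodic (expGL (genA k x)) (2 * Real.pi) := fun t => by
    rw [expGL_add, expGL_two_pi hx, mul_one]
  convert isCompact_Icc.image (continuous_expGL hx) (s := Set.Icc 0 (0 + 2 * Real.pi)) using 1
  rw [hper.image_Icc Real.two_pi_pos]
  ext t
  constructor
  · intro ht
    obtain ⟨θ, rfl⟩ := exists_expGL_of_mem_T ht
    exact ⟨_, rfl⟩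
  · rintro ⟨θ, rfl⟩
    exact expGL_mem_T x θ

theorem isClosed_G2 : IsClosed (G2 k : Set (GL (Fin 7) ℝ)) := by
  have : (G2 k : Set (GL (Fin 7) ℝ)) = ⋂ y, ⋂ z, {g : GL (Fin 7) ℝ |
      octMul k (toOct (g.1.mulVec y)) (toOct (g.1.mulVec z)) =
        -(formV k y z) • one + toOct (g.1.mulVec (cross k y z))} := by
    ext g
    simp only [Set.mem_iInter]
    exact mem_G2_iff g
  rw [this]
  refine isClosed_iInter fun y => isClosed_iInter fun z => isClosed_eq ?_ ?_
  · have h1 := continuous_toOct.comp (continuous_mulVec y)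
    have h2 := continuous_toOct.comp (continuous_mulVec z)
    exact continuous_octMul.comp (h1.prodMk h2)
  · exact continuous_const.add (continuous_toOct.comp (continuous_mulVec _))

theorem isClosed_sect : IsClosed (sect k) := isClosed_G2.mul_right_of_isCompact isCompact_SO3

end Compactness

/-! ### The reductions as quotients of G₂(V)·SO(3) and G₂(V). -/

theorem sect_subset_Z {x : Fin 7 → ℝ} (hx : formV k x x = 1) : sect k ⊆ Z k x := by
  rw [Z_eq hx]
  exact fun g hg => ⟨1, one_mem _, g, hg, one_mul g⟩

theorem mul_mem_Z {x : Fin 7 → ℝ} (hx : formV k x x = 1) {t g : GL (Fin 7) ℝ} (ht : t ∈ T k x)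
    (hg : g ∈ Z k x) : t * g ∈ Z k x := by
  rw [Z_eq hx] at hg ⊢
  obtain ⟨u, hu, a, ha, rfl⟩ := hg
  exact ⟨t * u, mul_mem ht hu, a, ha, mul_assoc _ _ _⟩

theorem Z3_le_T (x : Fin 7 → ℝ) : Z3 k x ≤ T k x := inf_le_left

theorem exists_isQuotientMap {x : Fin 7 → ℝ} (hx : formV k x x = 1) :
    ∃ f : DC (Z3 k x) (sect k) ⊥ → RG k x, IsInduced f ∧ Topology.IsQuotientMap f := by
  refine ⟨_, DC.isInduced_map (Z3_le_T x) le_rfl (sect_subset_Z hx),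
    DC.isQuotientMap_map (S := sect k) _ _ _ isClosed_sect ?_ (isCompact_T hx) ?_ ?_ ?_⟩
  · exact (Set.inter_eq_left.2 (sect_subset_Z hx)).symm
  · rw [Subgroup.coe_bot]; exact isCompact_singleton
  · intro l hl g hg h hh
    rw [Subgroup.mem_bot.1 hh, mul_one]
    exact mul_mem_Z hx hl hg
  · intro g hg
    rw [Z_eq hx] at hg
    obtain ⟨u, hu, a, ha, rfl⟩ := hg
    exact ⟨u, hu, a, ha, 1, one_mem _, (mul_one _).symm⟩

theorem T_comm {x : Fin 7 → ℝ} {s t : GL (Fin 7) ℝ} (hs : s ∈ T k x) (ht : t ∈ T k x) :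
    s * t = t * s := by
  obtain ⟨a, rfl⟩ := exists_expGL_of_mem_T hs
  obtain ⟨b, rfl⟩ := exists_expGL_of_mem_T ht
  rw [← expGL_add, add_comm, expGL_add]

theorem irregular_mul_iff {x : Fin 7 → ℝ} {t : GL (Fin 7) ℝ} (ht : t ∈ T k x) (g : GL (Fin 7) ℝ) :
    Irregular k x (t * g) ↔ Irregular k x g := by
  have h (s) (hs : s ∈ T k x) : (t * g)⁻¹ * s * (t * g) = g⁻¹ * s * g := by
    rw [mul_inv_rev, mul_assoc _ s, ← mul_assoc s, T_comm hs ht]; group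
  exact forall₂_congr fun s hs => by rw [h s hs]

theorem exists_homeomorph_regular {x : Fin 7 → ℝ} (hx : formV k x x = 1) :
    ∃ f : DC (Z3 k x) {g | g ∈ sect k ∧ ¬ Irregular k x g} ⊥ ≃ₜ
        DC (T k x) {g | g ∈ Z k x ∧ ¬ Irregular k x g} ⊥, IsInduced f := by
  refine DC.exists_homeomorph (S := sect k) (Z3_le_T x) le_rfl
    (fun g hg => ⟨sect_subset_Z hx hg.1, hg.2⟩) isClosed_sect ?_ (isCompact_T hx) ?_ ?_ ?_ ?_
  · ext g
    exact ⟨fun h => ⟨h.1, sect_subset_Z hx h.1, h.2⟩, fun h => ⟨h.1, h.2.2⟩⟩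
  · rw [Subgroup.coe_bot]; exact isCompact_singleton
  · intro l hl g hg h hh
    rw [Subgroup.mem_bot.1 hh, mul_one]
    exact ⟨mul_mem_Z hx hl hg.1, (irregular_mul_iff hl g).not.2 hg.2⟩
  · rintro g ⟨hg, hr⟩
    rw [Z_eq hx] at hg
    obtain ⟨u, hu, a, ha, rfl⟩ := hg
    exact ⟨u, hu, a, ⟨ha, (irregular_mul_iff hu a).not.1 hr⟩, 1, one_mem _, (mul_one _).symm⟩
  · intro g hg l hl h hh hlg
    have h1 : h = 1 := Subgroup.mem_bot.1 hh
    subst h1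
    rw [mul_one] at hlg
    exact ⟨l, ((mul_mem_sect_iff hx hg.1 hl).1 hlg.1).resolve_right hg.2, 1, one_mem _, rfl⟩

theorem isOpen_regular (x : Fin 7 → ℝ) : IsOpen {g : GL (Fin 7) ℝ | ¬ Irregular k x g} := by
  have : {g : GL (Fin 7) ℝ | Irregular k x g} =
      ⋂ t : GL (Fin 7) ℝ, ⋂ _ : t ∈ T k x, {g | g⁻¹ * t * g ∈ Hprime k} := by
    ext g
    simp only [Set.mem_iInter]
    rfl
  have h : IsClosed {g : GL (Fin 7) ℝ | Irregular k x g} := by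
    rw [this]
    refine isClosed_iInter fun t => isClosed_iInter fun _ => ?_
    exact isCompact_Hprime.isClosed.preimage ((continuous_inv.mul continuous_const).mul continuous_id)
  exact h.isOpen_compl

/-- The SO(3)-factor of an automorphism in K' is itself an automorphism, hence trivial. -/
theorem mem_of_mem_G2_of_mem_mul {K K' : Subgroup (GL (Fin 7) ℝ)} (hKG : K ≤ G2 k)
    (hK : (K' : Set (GL (Fin 7) ℝ)) ⊆ (K : Set _) * (SO3 k : Set _)) {g : GL (Fin 7) ℝ}
    (hg : g ∈ G2 k) (hg' : g ∈ K') : g ∈ K := by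
  obtain ⟨a, ha, s, hs, rfl⟩ := hK hg'
  have h1 := mul_mem (inv_mem (hKG ha)) hg
  have h2 : s = 1 := eq_one_of_mem_G2_SO3 (by simpa using h1) hs
  show a * s ∈ K
  rw [h2, mul_one]
  exact ha

/-- All three levels share this argument: K' contains SO(3), so G₂ meets every double coset in the
zero locus, and its elements in a common double coset are compared by `mul_mem_sect_iff`. -/
theorem exists_homeomorph_reduction {x : Fin 7 → ℝ} (hx : formV k x x = 1)
    {K K' : Subgroup (GL (Fin 7) ℝ)} (hKG : K ≤ G2 k) (hKK : K ≤ K') (hH : Hprime k ≤ K')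
    (hK : (K' : Set (GL (Fin 7) ℝ)) ⊆ (K : Set _) * (SO3 k : Set _))
    (hc : IsCompact (K' : Set (GL (Fin 7) ℝ))) :
    ∃ f : DC (Z3 k x) (G2 k) K ≃ₜ DC (T k x) (Z k x) K', IsInduced f := by
  have hGs : (G2 k : Set (GL (Fin 7) ℝ)) ⊆ sect k := fun g hg => ⟨g, hg, 1, one_mem _, mul_one g⟩
  -- G₂·SO(3) is stable under right translation by K', because the SO(3)-factor lies in K' and K' is
  -- contained in K·SO(3).
  have hsK {g h : GL (Fin 7) ℝ} (hg : g ∈ sect k) (hh : h ∈ K') : ∃ a ∈ G2 k, ∃ s ∈ SO3 k,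
      g * h = a * s := by
    obtain ⟨a, ha, s, hs, rfl⟩ := hg
    have h1 := hK (mul_mem (hH (SO3_le_Hprime hs)) hh)
    obtain ⟨b, hb, r, hr, e⟩ := h1
    refine ⟨a * b, mul_mem ha (hKG hb), r, hr, ?_⟩
    have e' : b * r = s * h := e
    show a * s * h = _
    rw [mul_assoc, ← e', mul_assoc]
  refine DC.exists_homeomorph (S := (G2 k : Set _)) (Z3_le_T x) hKK
    (hGs.trans (sect_subset_Z hx)) isClosed_G2 ?_ (isCompact_T hx) hc ?_ ?_ ?_
  · exact (Set.inter_eq_left.2 (hGs.trans (sect_subset_Z hx))).symm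
  · intro l hl g hg h hh
    rw [Z_eq hx] at hg
    obtain ⟨u, hu, a, ha, rfl⟩ := hg
    obtain ⟨b, hb, s, hs, e⟩ := hsK ha hh
    have : l * (u * a) * h = l * u * (b * s) := by rw [← e]; group
    show l * (u * a) * h ∈ _
    rw [this]
    exact mul_mem_Z hx (mul_mem hl hu) (sect_subset_Z hx ⟨b, hb, s, hs, rfl⟩)
  · intro g hg
    rw [Z_eq hx] at hg
    obtain ⟨u, hu, _, ⟨a, ha, s, hs, rfl⟩, rfl⟩ := hg
    exact ⟨u, hu, a, ha, s, hH (SO3_le_Hprime hs), (mul_assoc _ _ _).symm⟩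
  · intro g hg l hl h hh hlg
    have h1 : l * g ∈ sect k := by
      have := hsK (hGs hlg) (inv_mem hh)
      rw [mul_inv_cancel_right] at this
      obtain ⟨a, ha, s, hs, e⟩ := this
      exact ⟨a, ha, s, hs, e.symm⟩
    rcases (mul_mem_sect_iff hx (hGs hg) hl).1 h1 with h2 | h2
    · refine ⟨l, h2, h, mem_of_mem_G2_of_mem_mul hKG hK ?_ hh, rfl⟩
      have := (G2 k).mul_mem ((G2 k).inv_mem ((G2 k).mul_mem h2.2 hg)) hlg
      simpa [mul_assoc] using this
    -- At an irregular point l passes to the right of g as an element of H', so no left factor is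
    -- needed.
    · have e1 : l * g * h = g * (g⁻¹ * l * g * h) := by group
      refine ⟨1, one_mem _, g⁻¹ * l * g * h,
        mem_of_mem_G2_of_mem_mul hKG hK ?_ (mul_mem (hH (h2 l hl)) hh), by rw [e1, one_mul]⟩
      rw [e1] at hlg
      have := mul_mem (inv_mem hg) hlg
      simpa using this

/-! ### Density of the regular points. -/

/-- The trigonometric or hyperbolic cosine. -/
def Kind.cos : Kind → ℝ → ℝ
  | .compact => Real.cos
  | .split => Real.cosh

/-- The trigonometric or hyperbolic sine. -/
def Kind.sin : Kind → ℝ → ℝ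
  | .compact => Real.sin
  | .split => Real.sinh

theorem Kind.cos_sin (k : Kind) (r : ℝ) : k.cos r * k.cos r + k.eps * (k.sin r * k.sin r) = 1 := by
  cases k
  · simp only [Kind.cos, Kind.sin, Kind.eps]
    linear_combination Real.cos_sq_add_sin_sq r
  · simp only [Kind.cos, Kind.sin, Kind.eps]
    linear_combination Real.cosh_sq_sub_sinh_sq r

theorem Kind.continuous_cos (k : Kind) : Continuous k.cos := by
  cases k
  · exact Real.continuous_cos
  · exact Real.continuous_cosh

theorem Kind.continuous_sin (k : Kind) : Continuous k.sin := by
  cases k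
  · exact Real.continuous_sin
  · exact Real.continuous_sinh

theorem Kind.sin_pos (k : Kind) {r : ℝ} (h0 : 0 < r) (h1 : r < Real.pi) : 0 < k.sin r := by
  cases k
  · exact Real.sin_pos_of_pos_of_lt_pi h0 h1
  · exact Real.sinh_pos_iff.2 h0

/-- The complex linear map (for the complex structure given by the multiplication by `e₃`) that
mixes the complex lines of `e₁` and `e₄`. -/
def mixMatrix (k : Kind) (c s : ℝ) : Matrix (Fin 7) (Fin 7) ℝ :=
  !![c, 0, 0, -k.eps * s, 0, 0, 0;
     0, c, 0, 0, 0, 0, -k.eps * s;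
     0, 0, 1, 0, 0, 0, 0;
     s, 0, 0, c, 0, 0, 0;
     0, 0, 0, 0, 1, 0, 0;
     0, 0, 0, 0, 0, 1, 0;
     0, s, 0, 0, 0, 0, c]

theorem mixMatrix_mulVec (c s : ℝ) (v : Fin 7 → ℝ) : (mixMatrix k c s).mulVec v =
    ![c * v 0 - k.eps * s * v 3, c * v 1 - k.eps * s * v 6, v 2, s * v 0 + c * v 3, v 4, v 5,
      s * v 1 + c * v 6] := by
  ext i
  fin_cases i <;> simp [mixMatrix, Matrix.mulVec, dotProduct, Fin.sum_univ_seven] <;> ring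

theorem mixMatrix_mul (c s : ℝ) (h : c * c + k.eps * (s * s) = 1) :
    mixMatrix k c s * mixMatrix k c (-s) = 1 := by
  refine matrix_ext fun v => ?_
  rw [← Matrix.mulVec_mulVec, mixMatrix_mulVec, mixMatrix_mulVec, Matrix.one_mulVec]
  congr 1
  ext i
  fin_cases i <;> simp
  · linear_combination v 0 * h
  · linear_combination v 1 * h
  · linear_combination v 3 * h
  · linear_combination v 6 * h

/-- The one-parameter group of automorphisms given by `mixMatrix`. -/
def mix (k : Kind) (r : ℝ) : GL (Fin 7) ℝ where
  val := mixMatrix k (k.cos r) (k.sin r)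
  inv := mixMatrix k (k.cos r) (-k.sin r)
  val_inv := mixMatrix_mul _ _ (k.cos_sin r)
  inv_val := by
    have := mixMatrix_mul (k.cos r) (-k.sin r) (by rw [neg_mul_neg, k.cos_sin])
    rwa [neg_neg] at this

theorem mix_zero : mix k 0 = 1 := by
  have hc : k.cos 0 = 1 := by cases k <;> simp [Kind.cos]
  have hs : k.sin 0 = 0 := by cases k <;> simp [Kind.sin]
  refine Units.ext (matrix_ext fun v => congrArg toOct ?_)
  show (mixMatrix k _ _).mulVec v = _
  rw [mixMatrix_mulVec, hc, hs, Units.val_one, Matrix.one_mulVec]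
  ext i
  fin_cases i <;> simp

theorem continuous_mixMatrix : Continuous fun p : ℝ × ℝ => mixMatrix k p.1 p.2 := by
  refine continuous_matrix fun i j => ?_
  fin_cases i <;> fin_cases j <;> simp [mixMatrix] <;> fun_prop

theorem continuous_mix : Continuous (mix k) := by
  rw [Units.continuous_iff]
  exact ⟨continuous_mixMatrix.comp (k.continuous_cos.prodMk k.continuous_sin),
    continuous_mixMatrix.comp (k.continuous_cos.prodMk k.continuous_sin.neg)⟩

/-- The map fixes the third basis vector and is complex linear on the complement with determinant
cos² + ε sin² = 1. The coordinate check uses only this relation. -/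
theorem mix_mem_G2 (r : ℝ) : mix k r ∈ G2 k := by
  rw [mem_G2_iff]
  intro y z
  show octMul k (toOct ((mixMatrix k _ _).mulVec y)) (toOct ((mixMatrix k _ _).mulVec z)) =
    _ + toOct ((mixMatrix k _ _).mulVec _)
  have h := k.cos_sin r
  generalize k.cos r = c at h ⊢
  generalize k.sin r = s at h ⊢
  have hε := k.eps_mul_self
  rw [octMul_toOct]
  have h1 : formV k ((mixMatrix k c s).mulVec y) ((mixMatrix k c s).mulVec z) = formV k y z := by
    simp only [mixMatrix_mulVec, formV_eq]
    simp
    cases k <;> simp only [Kind.eps] at h ⊢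
    · linear_combination (y 0 * z 0 + y 1 * z 1 + y 3 * z 3 + y 6 * z 6) * h
    · linear_combination (y 0 * z 0 + y 1 * z 1 - y 3 * z 3 - y 6 * z 6) * h
  rw [h1]
  congr 2
  simp only [mixMatrix_mulVec, cross_eq]
  ext i
  cases k <;> simp only [Kind.eps] at h ⊢ <;> fin_cases i <;> simp
  any_goals ring1
  · linear_combination (y 0 * z 1 - y 1 * z 0 + (y 3 * z 6 - y 6 * z 3)) * h
  · linear_combination (y 0 * z 3 - y 3 * z 0 + y 6 * z 1 - y 1 * z 6) * h
  · linear_combination (y 1 * z 3 - y 3 * z 1 + y 0 * z 6 - y 6 * z 0) * h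
  · linear_combination (y 0 * z 1 - y 1 * z 0 - (y 3 * z 6 - y 6 * z 3)) * h
  · linear_combination (y 0 * z 3 - y 3 * z 0 + y 6 * z 1 - y 1 * z 6) * h
  · linear_combination (y 1 * z 3 - y 3 * z 1 + y 0 * z 6 - y 6 * z 0) * h

/-- The quaternion `(1 + i + j + k) / 2`, conjugation with which permutes `i`, `j` and `k`. -/
def hurwitz : unitary ℍ[ℝ] := ⟨quat (1 / 2) (1 / 2) (1 / 2) (1 / 2), mem_unitary_of_normSq (by
  rw [Quaternion.normSq_def']; simp; norm_num)⟩

/-- The group `mix` fixes the third axis, so a vector u along that axis first has to be turned away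
from it by the cyclic permutation of i, j, k. -/
theorem exists_block_ne_zero {u : Fin 7 → ℝ} (hu : formV k u u = 1) (h : (toOct u).2 = 0) :
    ∃ p : unitary ℍ[ℝ], ((block (p, p, p)).1.mulVec u 0 ≠ 0 ∨ (block (p, p, p)).1.mulVec u 1 ≠ 0) := by
  by_cases h0 : u 0 ≠ 0 ∨ u 1 ≠ 0
  · refine ⟨1, ?_⟩
    rw [show block (1, 1, 1) = 1 from map_one block, Units.val_one, Matrix.one_mulVec]
    exact h0
  · push Not at h0
    refine ⟨hurwitz, Or.inl ?_⟩
    have h1 : (block (hurwitz, hurwitz, hurwitz)).1.mulVec u 0 = _ :=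
      congrArg (fun w : Oct => w.1.imI) (toOct_block hurwitz hurwitz hurwitz u)
    have a0 : u 3 = 0 := congrArg (fun z : ℍ[ℝ] => z.re) h
    have a1 : u 4 = 0 := congrArg (fun z : ℍ[ℝ] => z.imI) h
    have a2 : u 5 = 0 := congrArg (fun z : ℍ[ℝ] => z.imJ) h
    have a3 : u 6 = 0 := congrArg (fun z : ℍ[ℝ] => z.imK) h
    rw [h1]
    intro h2
    simp [hurwitz, toOct, h0] at h2
    rw [formV_eq, a0, a1, a2, a3, h0.1, h0.2] at hu
    have h3 : u 2 = 0 := by linarith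
    rw [h3] at hu
    simp at hu

/-- `mix` moves the first two coordinates of an imaginary quaternion into 0 ⊕ ℍ with factor ± sin r,
or ± sinh r. Conjugation by P, which preserves ℍ ⊕ 0, ensures that one of these coordinates is
nonzero. -/
theorem exists_path {u : Fin 7 → ℝ} (hu : formV k u u = 1) (h : (toOct u).2 = 0) :
    ∃ γ : ℝ → GL (Fin 7) ℝ, Continuous γ ∧ γ 0 = 1 ∧ (∀ r, γ r ∈ G2 k) ∧
      ∀ r, 0 < r → r < Real.pi → (toOct ((γ r)⁻¹.1.mulVec u)).2 ≠ 0 := by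
  obtain ⟨p, hp⟩ := exists_block_ne_zero hu h
  set P := block (p, p, p) with hP
  have hPG : P ∈ G2 k := block_mem_G2 p p
  refine ⟨fun r => P⁻¹ * mix k r * P, (continuous_const.mul continuous_mix).mul continuous_const,
    by simp [mix_zero], fun r => mul_mem (mul_mem (inv_mem hPG) (mix_mem_G2 r)) hPG, ?_⟩
  intro r h0 h1 h2
  have hv : (toOct (P.1.mulVec u)).2 = 0 := by rw [hP, toOct_block, h]; simp
  generalize hw : P.1.mulVec u = v at *
  have e : (P⁻¹ * mix k r * P)⁻¹.1.mulVec u = (P⁻¹).1.mulVec ((mix k r)⁻¹.1.mulVec v) := by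
    rw [← hw, Matrix.mulVec_mulVec, Matrix.mulVec_mulVec, ← Units.val_mul, ← Units.val_mul]
    congr 2
    group
  have hPinv : P⁻¹ = block (p⁻¹, p⁻¹, p⁻¹) := (map_inv block (p, p, p)).symm
  have h3 : (toOct ((mix k r)⁻¹.1.mulVec v)).2 = 0 := by
    have h4 : (mix k r)⁻¹.1.mulVec v = P.1.mulVec ((P⁻¹ * mix k r * P)⁻¹.1.mulVec u) := by
      rw [e, Matrix.mulVec_mulVec, ← Units.val_mul, mul_inv_cancel, Units.val_one, Matrix.one_mulVec]
    rw [h4, hP, toOct_block]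
    simp only at h2
    rw [h2]
    simp
  have h5 : (mix k r)⁻¹.1 = mixMatrix k (k.cos r) (-k.sin r) := rfl
  have a0 : v 3 = 0 := congrArg (fun z : ℍ[ℝ] => z.re) hv
  have a3 : v 6 = 0 := congrArg (fun z : ℍ[ℝ] => z.imK) hv
  have hs := (k.sin_pos h0 h1).ne'
  have b0 := congrArg (fun z : ℍ[ℝ] => z.re) h3
  have b3 := congrArg (fun z : ℍ[ℝ] => z.imK) h3
  rw [h5, mixMatrix_mulVec] at b0 b3
  simp [toOct, a0, a3, hs] at b0 b3
  tauto

/-- An irregular point t a s is the limit of the points t a γ(r) s of the zero locus as r decreases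
to 0. By `irregular_iff` these are regular, since γ(r)⁻¹ moves a⁻¹x out of ℍ ⊕ 0. -/
theorem dense_regular {x : Fin 7 → ℝ} (hx : formV k x x = 1) :
    Dense {z : Z k x | ¬ Irregular k x z.1} := by
  rintro ⟨g, hg⟩
  by_cases hirr : Irregular k x g
  swap
  · exact subset_closure hirr
  obtain ⟨t, ht, _, ⟨a, ha, s, hs, rfl⟩, rfl⟩ : g ∈ (T k x : Set (GL (Fin 7) ℝ)) * sect k := by
    rw [← Z_eq hx]; exact hg
  have h1 := (irregular_iff ha hs hx).1 ((irregular_mul_iff ht _).1 hirr)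
  obtain ⟨γ, hγ, hγ0, hγG, hγr⟩ := exists_path (by rw [G2_formV (inv_mem ha), hx]) h1
  have hmem (r : ℝ) : t * (a * γ r * s) ∈ Z k x :=
    mul_mem_Z hx ht (sect_subset_Z hx ⟨a * γ r, mul_mem ha (hγG r), s, hs, rfl⟩)
  let f : ℝ → Z k x := fun r => ⟨_, hmem r⟩
  have hf : Continuous f := Continuous.subtype_mk
    (continuous_const.mul ((continuous_const.mul hγ).mul continuous_const)) _
  have hf0 : f 0 = ⟨t * (a * s), hg⟩ := Subtype.ext (by simp [f, hγ0])
  have ht := (hf.tendsto 0).mono_left (nhdsWithin_le_nhds (s := Set.Ioi 0))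
  rw [hf0] at ht
  refine mem_closure_of_tendsto ht ?_
  filter_upwards [Ioo_mem_nhdsGT Real.pi_pos] with r hr
  show ¬ Irregular k x (t * (a * γ r * s))
  rw [irregular_mul_iff ‹t ∈ T k x›, irregular_iff (mul_mem ha (hγG r)) hs hx, mul_inv_rev,
    Units.val_mul, ← Matrix.mulVec_mulVec]
  exact hγr r hr.1 hr.2

end OctRed

end

theorem mainTheorem1 (k : OctRed.Kind) (x : Fin 7 → ℝ) (hx : OctRed.formV k x x = 1) :
    -- the zero locus
    OctRed.Z k x =
      (OctRed.T k x : Set (GL (Fin 7) ℝ)) * ((OctRed.G2 k : Set _) * (OctRed.SO3 k : Set _)) ∧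
    -- `T_x ∩ G₂(V)` is a cyclic group of order three
    (IsCyclic (OctRed.Z3 k x) ∧ Nat.card (OctRed.Z3 k x) = 3) ∧
    -- group level: `T_x`-orbits meet `G₂(V)·SO(3)` in orbits of the group of order three,
    -- except at the irregular points, whose orbits are contained in it
    (∀ g ∈ OctRed.sect k, ∀ t ∈ OctRed.T k x,
      (t * g ∈ OctRed.sect k ↔ t ∈ OctRed.Z3 k x ∨ OctRed.Irregular k x g)) ∧
    (∃ f : OctRed.DC (OctRed.Z3 k x) (OctRed.sect k) ⊥ → OctRed.RG k x,
      OctRed.IsInduced f ∧ Topology.IsQuotientMap f) ∧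
    (∃ f : OctRed.DC (OctRed.Z3 k x) {g | g ∈ OctRed.sect k ∧ ¬ OctRed.Irregular k x g} ⊥ ≃ₜ
        OctRed.DC (OctRed.T k x) {g | g ∈ OctRed.Z k x ∧ ¬ OctRed.Irregular k x g} ⊥,
      OctRed.IsInduced f) ∧
    (IsOpen {z : OctRed.Z k x | ¬ OctRed.Irregular k x z.1} ∧
      Dense {z : OctRed.Z k x | ¬ OctRed.Irregular k x z.1}) ∧
    -- the 3-Sasakian reduction
    (∃ f : OctRed.DC (OctRed.Z3 k x) (OctRed.G2 k) OctRed.G2Sp1 ≃ₜ OctRed.RS k x,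
      OctRed.IsInduced f) ∧
    -- the twistor reductions
    (∀ τ : Fin 3 → ℝ, ∑ i, τ i ^ 2 = 1 →
      ∃ f : OctRed.DC (OctRed.Z3 k x) (OctRed.G2 k) (OctRed.G2Sp1U1 τ) ≃ₜ OctRed.RZ k x τ,
        OctRed.IsInduced f) ∧
    -- the quaternion-Kähler reduction
    (∃ f : OctRed.DC (OctRed.Z3 k x) (OctRed.G2 k) OctRed.G2SO4 ≃ₜ OctRed.RO k x,
      OctRed.IsInduced f) := by
  refine ⟨OctRed.Z_eq hx, ⟨OctRed.isCyclic_Z3 hx, OctRed.card_Z3 hx⟩,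
    fun g hg t ht => OctRed.mul_mem_sect_iff hx hg ht, OctRed.exists_isQuotientMap hx,
    OctRed.exists_homeomorph_regular hx,
    ⟨(OctRed.isOpen_regular x).preimage continuous_subtype_val, OctRed.dense_regular hx⟩,
    OctRed.exists_homeomorph_reduction hx (OctRed.quatGroup_le_G2 _) OctRed.G2Sp1_le_Hprime le_rfl
      OctRed.Hprime_le_mul OctRed.isCompact_Hprime,
    fun τ _ => OctRed.exists_homeomorph_reduction hx (OctRed.quatGroup_le_G2 _)
      (OctRed.G2Sp1U1_le_HU τ) (OctRed.Hprime_le_HU τ) (OctRed.HU_le_mul τ) (OctRed.isCompact_HU τ),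
    OctRed.exists_homeomorph_reduction hx (OctRed.quatGroup_le_G2 _) (OctRed.quatGroup_le_H _)
      OctRed.Hprime_le_H OctRed.H_le_mul OctRed.isCompact_H⟩
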